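/- Let $d\ge 1$ and $n$ be integers, let $1\le p<r<q\le\infty$, put $t=r/p$ and $s=(q/r)'$ (where $u'$ denotes the conjugate exponent of $u$), and let $\gamma>0$. There is a constant $C_2$, depending only on $d,n,p,q,r,\gamma$, such that the following holds. Let $B_1,B_2$ be real Banach spaces and let $\mathscr D$ be a dyadic lattice in $\mathbb R^d$, i.e. a collection of half-open cubes with side lengths $2^k$, $k\in\mathbb Z$, which contains all dyadic subcubes of its members, in which any two members are dyadic subcubes of a common member, and such that every compact set lies in some member. Let $F$ be a linear space of strongly measurable functions $\mathbb R^d\to B_1$ that belong to $L^p(Q,B_1)$ for all $Q\in\mathscr D$, and $G$ a linear space of strongly measurable functions $\mathbb R^d\to B_2^*$ that belong to $L^{q'}(Q,B_2^*)$ for all $Q\in\mathscr D$, where $G$ contains all functions $a\mathbf 1_Q$ with $a\in B_2^*$, $Q\in\mathscr D$ (functions equal almost everywhere are identified). Let $T$ be a linear operator from $F$ to the strongly measurable functions $\mathbb R^d\to B_2$ such that $\langle Tf,g\rangle=\int_{\mathbb R^d}\langle Tf(x),g(x)\rangle\,dx$ converges absolutely for all $f\in F$, $g\in G$. Put $T\vec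 f=(Tf_i)_{i=1}^n$ and $\langle T\vec f,\vec g\,\rangle=\sum_{i=1}^n\langle Tf_i,g_i\rangle$. Assume that $T$ satisfies $(Ł^p_{B_1},Ł^{q'}_{B_2^*})$ convex body domination with constant $C_1\ge 0$: for all $\vec f\in F^n$ and $\vec g\in G^n$ there is a $\gamma$-sparse collection $\mathscr Q\subset\mathscr D$ (there are pairwise disjoint measurable sets $E_Q\subset Q$, $Q\in\mathscr Q$, with $|E_Q|\ge\gamma|Q|$) such that $$|\langle T\vec f,\vec g\,\rangle|\le C_1\sum_{Q\in\mathscr Q}|Q|\,\langle\!\langle\vec f\,\rangle\!\rangle_{Ł^p(Q,B_1)}\cdot\langle\!\langle\vec g\,\rangle\!\rangle_{Ł^{q'}(Q,B_2^*)}.$$ Here $\|f\|_{Ł^p(Q,B)}=\big(\frac1{|Q|}\int_Q|f|_B^p\big)^{1/p}$; for a normed space $X$ and $\vec x\in X^n$, $\langle\!\langle\vec x\rangle\!\rangle_X=\{(\langle x_i,x^*\rangle)_{i=1}^n: x^*\in X^*,\ \|x^*\|\le 1\}\subset\mathbb R^n$; and for two such bodies $A\cdot B$ denotes the right end point of the interval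 $\{a\cdot b:a\in A,\ b\in B\}$. Let $W:\mathbb R^d\to\mathbb R^{n\times n}$ be a matrix weight (locally integrable and almost everywhere positive definite) such that $$[W]_{A_t}=\sup_Q\frac1{|Q|}\int_Q\Big(\frac1{|Q|}\int_Q|W^{1/t}(x)W^{-1/t}(y)|_{op}^{t'}\,dy\Big)^{t/t'}dx<\infty,$$ $$[W]_{RH_{t,s}}=\sup_{y\in\mathbb R^n}\sup_Q\Big(\frac1{|Q|}\int_Q|W^{1/t}(x)y|^{ts}\,dx\Big)^{1/s}\Big(\frac1{|Q|}\int_Q|W^{1/t}(x)y|^{t}\,dx\Big)^{-1}<\infty,$$ the suprema in $Q$ being over all axis-parallel cubes, and $y=0$ contributing $0$ to the second one. Then for every $\vec f\in F^n$ with $\vec f\in L^r_{B_1^n}(W)$ we have $T\vec f\in L^r_{B_2^n}(W)$ and $$\|T\vec f\|_{L^r_{B_2^n}(W)}\le C_1C_2\,[W]_{A_t}^{\frac{t'}{r}+\frac{s}{r'}}\,[W]_{RH_{t,s}}^{\frac1r+\frac{s}{r'}}\,\|\vec f\|_{L^r_{B_1^n}(W)},$$ where $\|\vec f\|_{L^r_{B^n}(W)}=\|W^{1/r}\vec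 f\|_{L^r(\mathbb R^d;B^n)}$ and $B^n$ carries the norm $(\sum_i|v_i|_B^2)^{1/2}$. -/

import Mathlib

open MeasureTheory
open scoped ENNReal NNReal

noncomputable section

namespace ConvexBody

/-! ### Cubes, dyadic lattices and sparse collections

`ℝ^d` is modelled by `Fin d → ℝ`; only its topology and its Lebesgue measure are used. -/

/-- The half-open axis-parallel cube with corner `a` and side length `ℓ`. -/
def cube {d : ℕ} (a : Fin d → ℝ) (ℓ : ℝ) : Set (Fin d → ℝ) :=
  Set.univ.pi fun i => Set.Ico (a i) (a i + ℓ)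

/-- The set of all axis-parallel cubes of `ℝ^d`. -/
def cubes (d : ℕ) : Set (Set (Fin d → ℝ)) :=
  {Q | ∃ (a : Fin d → ℝ) (ℓ : ℝ), 0 < ℓ ∧ Q = cube a ℓ}

/-- `𝒟(Q)`: for each `j`, bisecting the sides of the cube `Q` `j` times gives `2 ^ (j d)`
dyadic subcubes of `Q`. -/
def dyadicSubcubes {d : ℕ} (Q : Set (Fin d → ℝ)) : Set (Set (Fin d → ℝ)) :=
  {Q' | ∃ (a : Fin d → ℝ) (ℓ : ℝ) (j : ℕ) (m : Fin d → ℕ),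
    0 < ℓ ∧ Q = cube a ℓ ∧ (∀ i, m i < 2 ^ j) ∧
    Q' = cube (fun i => a i + (m i : ℝ) * (ℓ / 2 ^ j)) (ℓ / 2 ^ j)}

/-- Dyadic lattices of cubes in `ℝ^d`. -/
structure IsDyadicLattice {d : ℕ} (𝒟 : Set (Set (Fin d → ℝ))) : Prop where
  side_length : ∀ Q ∈ 𝒟, ∃ (a : Fin d → ℝ) (k : ℤ), Q = cube a ((2 : ℝ) ^ k)
  subcube_mem : ∀ Q ∈ 𝒟, ∀ Q' ∈ dyadicSubcubes Q, Q' ∈ 𝒟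
  common_ancestor : ∀ Q' ∈ 𝒟, ∀ Q'' ∈ 𝒟, ∃ Q ∈ 𝒟, Q' ∈ dyadicSubcubes Q ∧ Q'' ∈ dyadicSubcubes Q
  compact_subset : ∀ K : Set (Fin d → ℝ), IsCompact K → ∃ Q ∈ 𝒟, K ⊆ Q

/-- `γ`-sparse collections of cubes. -/
def IsSparse {d : ℕ} (γ : ℝ) (𝒬 : Set (Set (Fin d → ℝ))) : Prop :=
  ∃ E : Set (Fin d → ℝ) → Set (Fin d → ℝ),
    (∀ Q ∈ 𝒬, E Q ⊆ Q ∧ MeasurableSet (E Q) ∧ ENNReal.ofReal γ * volume Q ≤ volume (E Q)) ∧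
    𝒬.PairwiseDisjoint E

/-! ### Convex bodies -/

/-- The convex body `⟪x⟫_X ⊆ ℝ^n` of a vector `x ∈ X^n`. -/
def convexBody {X : Type*} [NormedAddCommGroup X] [NormedSpace ℝ X] {n : ℕ} (x : Fin n → X) :
    Set (Fin n → ℝ) :=
  {v | ∃ φ : StrongDual ℝ X, ‖φ‖ ≤ 1 ∧ v = fun i => φ (x i)}

/-- The right end point of the Minkowski dot product `A · B = {a · b : a ∈ A, b ∈ B}`, which is a
compact symmetric interval when `A` and `B` are convex bodies. -/
def bodyDot {n : ℕ} (A B : Set (Fin n → ℝ)) : ℝ :=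
  sSup {c | ∃ a ∈ A, ∃ b ∈ B, c = a ⬝ᵥ b}

/-- Normalized Lebesgue measure on `Q`. The space `Ł^p(Q, B)`, normed by
`(⨍_Q |f|_B ^ p) ^ (1 / p)`, is `Lp B p (avgMeasure Q)`. -/
def avgMeasure {d : ℕ} (Q : Set (Fin d → ℝ)) : Measure (Fin d → ℝ) :=
  ProbabilityTheory.cond volume Q

/-- The convex body of a vector of functions in `Ł^p(Q, B)`. -/
def localBody {d n : ℕ} {B : Type*} [NormedAddCommGroup B] [NormedSpace ℝ B] (p : ℝ≥0∞)
    [Fact (1 ≤ p)] (Q : Set (Fin d → ℝ)) (f : Fin n → ((Fin d → ℝ) →ₘ[volume] B))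
    (hf : ∀ i, MemLp (f i) p (avgMeasure Q)) : Set (Fin n → ℝ) :=
  convexBody fun i => ((hf i).toLp (f i) : Lp B p (avgMeasure Q))

/-- Step functions: finite linear combinations of `a • 1_Q` with `a ∈ B` and `Q ∈ 𝒟`. -/
def stepFunctions {d : ℕ} (𝒟 : Set (Set (Fin d → ℝ))) (B : Type*) [NormedAddCommGroup B]
    [NormedSpace ℝ B] : Submodule ℝ ((Fin d → ℝ) →ₘ[volume] B) :=
  Submodule.span ℝ {f | ∃ Q ∈ 𝒟, ∃ a : B, ⇑f =ᵐ[volume] Q.indicator fun _ => a}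

/-- The pointwise pairing `x ↦ ⟨u(x), v(x)⟩` of a `B`-valued and a `B*`-valued function. -/
def pairing {d : ℕ} {B : Type*} [NormedAddCommGroup B] [NormedSpace ℝ B]
    (u : (Fin d → ℝ) →ₘ[volume] B) (v : (Fin d → ℝ) →ₘ[volume] StrongDual ℝ B)
    (x : Fin d → ℝ) : ℝ :=
  v x (u x)

/-- Let `F` and `G` be spaces of functions with values in `B₁` and `B₂*`. A linear operator `T` from
`F` to the strongly measurable `B₂`-valued functions satisfies `(Ł^p_{B₁}, Ł^{q'}_{B₂*})` convex
body domination on `F^n × G^n`, with constant `C₁` and sparseness parameter `γ`. Here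
`⟨T f, g⟩ = ∑ᵢ ∫ ⟨T fᵢ(x), gᵢ(x)⟩ dx`, and the dominating sum takes values in `[0, ∞]`. -/
structure ConvexBodyDomination {d : ℕ} (𝒟 : Set (Set (Fin d → ℝ))) (n : ℕ) (p q' : ℝ≥0∞)
    [Fact (1 ≤ p)] [Fact (1 ≤ q')] (γ : ℝ) (C₁ : ℝ≥0)
    {B₁ B₂ : Type*} [NormedAddCommGroup B₁] [NormedSpace ℝ B₁]
    [NormedAddCommGroup B₂] [NormedSpace ℝ B₂]
    (F : Submodule ℝ ((Fin d → ℝ) →ₘ[volume] B₁))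
    (G : Submodule ℝ ((Fin d → ℝ) →ₘ[volume] StrongDual ℝ B₂))
    (T : F →ₗ[ℝ] ((Fin d → ℝ) →ₘ[volume] B₂)) : Prop where
  left_mem : ∀ f ∈ F, ∀ Q ∈ 𝒟, MemLp f p (avgMeasure Q)
  right_mem : ∀ g ∈ G, ∀ Q ∈ 𝒟, MemLp g q' (avgMeasure Q)
  integrable : ∀ (f : F) (g : G), Integrable (pairing (T f) g) volume
  domination : ∀ (f : Fin n → F) (g : Fin n → G),
    ∃ (𝒬 : Set (Set (Fin d → ℝ))) (h𝒬 : 𝒬 ⊆ 𝒟), IsSparse γ 𝒬 ∧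
      ENNReal.ofReal |∑ i, ∫ x, pairing (T (f i)) (g i) x| ≤
        C₁ * ∑' Q : 𝒬, volume (Q : Set (Fin d → ℝ)) * ENNReal.ofReal (bodyDot
          (localBody p (Q : Set (Fin d → ℝ)) (fun i => (f i : _ →ₘ[volume] B₁))
            fun i => left_mem _ (f i).2 _ (h𝒬 Q.2))
          (localBody q' (Q : Set (Fin d → ℝ)) (fun i => (g i : _ →ₘ[volume] StrongDual ℝ B₂))
            fun i => right_mem _ (g i).2 _ (h𝒬 Q.2)))

/-! ### Matrix weights -/

/-- The real power `A ^ α` of a positive definite matrix. -/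
def matPow {n : ℕ} (A : Matrix (Fin n) (Fin n) ℝ) (α : ℝ) : Matrix (Fin n) (Fin n) ℝ :=
  cfc (fun x : ℝ => x ^ α) A

/-- Matrix weights: locally integrable and almost everywhere positive definite. -/
structure IsMatrixWeight {d n : ℕ} (W : (Fin d → ℝ) → Matrix (Fin n) (Fin n) ℝ) : Prop where
  locallyIntegrable : ∀ i j, LocallyIntegrable (fun x => W x i j) volume
  posDef : ∀ᵐ x ∂volume, (W x).PosDef

/-- The operator norm of a matrix acting on Euclidean `ℝ^n`, as an element of `[0, ∞]`. -/
def opNorm {n : ℕ} (A : Matrix (Fin n) (Fin n) ℝ) : ℝ≥0∞ :=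
  ‖Matrix.toEuclideanCLM (n := Fin n) (𝕜 := ℝ) A‖ₑ

/-- The Euclidean norm `|A y|`, as an element of `[0, ∞]`. -/
def normMulVec {n : ℕ} (A : Matrix (Fin n) (Fin n) ℝ) (y : EuclideanSpace ℝ (Fin n)) : ℝ≥0∞ :=
  ‖Matrix.toEuclideanCLM (n := Fin n) (𝕜 := ℝ) A y‖ₑ

/-- The matrix `A_t` constant, `1 < t < ∞`:
`sup_Q ⨍_Q (⨍_Q |W^{1/t}(x) W^{-1/t}(y)|_op ^ t' dy) ^ (t / t') dx`. -/
def ApConst {d n : ℕ} (W : (Fin d → ℝ) → Matrix (Fin n) (Fin n) ℝ) (t : ℝ) : ℝ≥0∞ :=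
  ⨆ Q ∈ cubes d, ⨍⁻ x in Q, (⨍⁻ y in Q,
    opNorm (matPow (W x) (1 / t) * matPow (W y) (-(1 / t))) ^ t.conjExponent ∂volume)
      ^ (t / t.conjExponent) ∂volume

/-- The reverse Hölder constant `[W]_{RH_{t,s}}`:
`sup_y sup_Q (⨍_Q |W^{1/t}(x) y| ^ (t s) dx) ^ (1 / s) (⨍_Q |W^{1/t}(x) y| ^ t dx)⁻¹`.
The vector `y = 0` contributes `0 * ∞ = 0`. -/
def RHConst {d n : ℕ} (W : (Fin d → ℝ) → Matrix (Fin n) (Fin n) ℝ) (t s : ℝ) : ℝ≥0∞ :=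
  ⨆ y : EuclideanSpace ℝ (Fin n), ⨆ Q ∈ cubes d,
    (⨍⁻ x in Q, normMulVec (matPow (W x) (1 / t)) y ^ (t * s) ∂volume) ^ (1 / s) *
      (⨍⁻ x in Q, normMulVec (matPow (W x) (1 / t)) y ^ t ∂volume)⁻¹

/-- A matrix acting on `B^n`, which carries the norm `(∑ᵢ |vᵢ|_B ^ 2) ^ (1 / 2)`. -/
def matAct {n : ℕ} {B : Type*} [NormedAddCommGroup B] [NormedSpace ℝ B]
    (A : Matrix (Fin n) (Fin n) ℝ) (v : Fin n → B) : PiLp 2 (fun _ : Fin n => B) :=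
  WithLp.toLp 2 fun i => ∑ j, A i j • v j

/-- The function `W^{1/r} f`. -/
def weighted {d n : ℕ} {B : Type*} [NormedAddCommGroup B] [NormedSpace ℝ B]
    (W : (Fin d → ℝ) → Matrix (Fin n) (Fin n) ℝ) (r : ℝ≥0)
    (f : Fin n → ((Fin d → ℝ) →ₘ[volume] B)) : (Fin d → ℝ) → PiLp 2 (fun _ : Fin n => B) :=
  fun x => matAct (matPow (W x) (1 / r)) fun i => f i x

/-- Membership in `L^r_{B^n}(W)`. -/
def MemWeightedLp {d n : ℕ} {B : Type*} [NormedAddCommGroup B] [NormedSpace ℝ B]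
    (W : (Fin d → ℝ) → Matrix (Fin n) (Fin n) ℝ) (r : ℝ≥0)
    (f : Fin n → ((Fin d → ℝ) →ₘ[volume] B)) : Prop :=
  MemLp (weighted W r f) r volume

/-- The norm of `L^r_{B^n}(W)`, as an element of `[0, ∞]`. -/
def weightedNorm {d n : ℕ} {B : Type*} [NormedAddCommGroup B] [NormedSpace ℝ B]
    (W : (Fin d → ℝ) → Matrix (Fin n) (Fin n) ℝ) (r : ℝ≥0)
    (f : Fin n → ((Fin d → ℝ) →ₘ[volume] B)) : ℝ≥0∞ :=
  eLpNorm (weighted W r f) r volume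

end ConvexBody

end

/-! By duality it suffices to bound `|⟨Tf, g⟩|` by a multiple of `‖W^{1/r} f‖_r ‖W^{-1/r} g‖_{r'}`,
and convex body domination reduces this to a sum over sparse cubes. The dot product of two bodies
may be computed in any orthonormal basis `e` of `ℝ^n`, so a cube `Q` contributes at most `|Q| ∑ᵢ
‖eᵢ·f‖ ‖eᵢ·g‖` with norms in `Ł^p(Q)` and `Ł^{q'}(Q)`, and the basis may depend on `Q`
(`ofReal_bodyDot_le`). Since `1/r = (1/t)(1/p)`, inserting `W^{-1/r} W^{1/r}` and applying Jensen in
the eigenbasis of `W(x)` gives `|eᵢ·f| ≤ |W^{-1/t} eᵢ|^{1/p} |W^{1/r} f|`, and likewise `|eᵢ·g| ≤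
|W^{1/t} eᵢ|^{1/p} |W^{-1/r} g|`. From here on the problem is scalar.

The scalar weights `|W^{-1/t} e|^{t'}` and `|W^{1/t} e|^{ts}` satisfy `⨍ w ≤ K (⨍ w^{1/2})²` on all
cubes, uniformly in the direction `e`, with `K₁ = [W]_{A_t}^{t'-1}` and `K₂ = ([W]_{A_t}
[W]_{RH})^s` (`dual_sq_le`, `direct_sq_le`). Such a bound controls the localized maximal function of
`w`, and this self-improves to a reverse Hölder inequality with exponent `1 + ε`, `ε ~ 1/K`
(`reverse_holder`). Hölder then splits each local norm into an average of the weight and a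
`κ`-average of the function, with `κ` below the critical exponent by an amount of order `1/K`; the
maximal operator that dominates the `κ`-averages therefore costs only one factor `K`
(`exists_bump_exponent`).

It remains to multiply the averages of the two weights in the direction `eᵢ`. For an arbitrary
direction the product is not controlled by `[W]_{A_t}` (a constant weight and a vector that is not
an eigenvector show this), but it is for a basis built by successive minimization of the norm `z ↦
(⨍_Q |W^{-1/t} z|^{t'})^{1/t'}` (`exists_orthonormal_of_seminorm`, `exists_basis`). Sparseness turns
the sum into the integral of a product of two maximal functions, and Hölder finishes the bound
(`exists_sparse_form_bound`). The local product gives `([W]_{A_t} [W]_{RH})^{1/r}`, the maximal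
functions give `K₁^{1/r} K₂^{1/r'}`; together these are the stated powers.

Duality needs care, because only dyadic step functions are known to be admissible as `g`, and `B₂`
is arbitrary. The bound first passes to bounded, compactly supported `g` with finitely many
functionals, by dyadic averaging of the scalar coefficients (`bound_of_stepFunctions`). Then a
nearly extremal `g` is built from a countable norming family and a measurable choice of index, one
coordinate of `W^{1/r} Tf` at a time (`eLpNorm_matAct_le`). -/

noncomputable section

namespace ConvexBody

/-! ### Layer cake estimates -/

section LayerCake

variable {X : Type*} [MeasurableSpace X]

/-- The layer cake formula for powers of `[0, ∞]`-valued functions. -/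
theorem lintegral_rpow_eq_layer (μ : Measure X) {F : X → ℝ≥0∞} (hF : AEMeasurable F μ)
    (hfin : ∀ᵐ x ∂μ, F x ≠ ∞) {p : ℝ} (hp : 0 < p) :
    ∫⁻ x, F x ^ p ∂μ = ENNReal.ofReal p *
      ∫⁻ t in Set.Ioi (0 : ℝ), μ {x | ENNReal.ofReal t < F x} * ENNReal.ofReal (t ^ (p - 1)) := by
  have h := lintegral_rpow_eq_lintegral_meas_lt_mul μ (f := fun x => (F x).toReal)
    (Filter.Eventually.of_forall fun x => ENNReal.toReal_nonneg) hF.ennreal_toReal hp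
  rw [lintegral_congr_ae (g := fun x => ENNReal.ofReal ((F x).toReal ^ p)), h]
  · congr 1
    refine setLIntegral_congr_fun measurableSet_Ioi fun t ht => ?_
    congr 1
    refine measure_congr ?_
    filter_upwards [hfin] with x hx
    exact propext (ENNReal.ofReal_lt_iff_lt_toReal (le_of_lt ht) hx).symm
  · filter_upwards [hfin] with x hx
    rw [ENNReal.toReal_rpow, ENNReal.ofReal_toReal (ENNReal.rpow_ne_top_of_nonneg hp.le hx)]

/-- A comparison of moments for two measures whose level sets are comparable. -/
theorem lintegral_rpow_le_of_level (ν μ : Measure X) {F : X → ℝ≥0∞} (hF : Measurable F)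
    (hν : ∀ᵐ x ∂ν, F x ≠ ∞) (hμ : ∀ᵐ x ∂μ, F x ≠ ∞) {A : ℝ} {c : ℝ≥0∞} {ε : ℝ}
    (hε : 0 < ε) (h : ∀ t, 0 < t → A ≤ t → ν {x | ENNReal.ofReal t < F x} ≤
      c * ENNReal.ofReal t * μ {x | ENNReal.ofReal t < F x}) :
    ∫⁻ x, F x ^ ε ∂ν ≤ ENNReal.ofReal A ^ ε * ν Set.univ +
      c * ENNReal.ofReal ε * ∫⁻ x, F x ^ (1 + ε) ∂μ := by
  -- The levels below `A` are bounded trivially: their contribution is the layer cake integral of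
  -- the constant function `A`.
  have e0 : ∫⁻ _, ENNReal.ofReal A ^ ε ∂ν = ENNReal.ofReal A ^ ε * ν Set.univ := by simp
  have e1 := lintegral_rpow_eq_layer ν (F := fun _ => ENNReal.ofReal A) aemeasurable_const
    (Filter.Eventually.of_forall fun _ => ENNReal.ofReal_ne_top) hε
  have e2 := lintegral_rpow_eq_layer μ hF.aemeasurable hμ (p := 1 + ε) (by linarith)
  have hm : ∀ (κ : Measure X) (F : X → ℝ≥0∞) , Measurable fun t : ℝ => κ {x | ENNReal.ofReal t < F x} := by
    intro κ F
    have ha : Antitone fun t : ℝ => κ {x | ENNReal.ofReal t < F x} := by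
      refine fun s t hst => measure_mono fun x hx => ?_
      exact lt_of_le_of_lt (ENNReal.ofReal_le_ofReal hst) hx
    exact ha.measurable
  have hm' : ∀ a : ℝ, Measurable fun t : ℝ => ENNReal.ofReal (t ^ a) := fun a => by fun_prop
  rw [lintegral_rpow_eq_layer ν hF.aemeasurable hν hε, ← e0, e1, e2]
  calc ENNReal.ofReal ε * ∫⁻ t in Set.Ioi (0 : ℝ), ν {x | ENNReal.ofReal t < F x} *
        ENNReal.ofReal (t ^ (ε - 1))
      ≤ ENNReal.ofReal ε * ∫⁻ t in Set.Ioi (0 : ℝ),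
        (ν {x | ENNReal.ofReal t < ENNReal.ofReal A} * ENNReal.ofReal (t ^ (ε - 1)) +
        c * (μ {x | ENNReal.ofReal t < F x} * ENNReal.ofReal (t ^ (1 + ε - 1)))) := by
        refine mul_le_mul' le_rfl ?_
        refine setLIntegral_mono' measurableSet_Ioi fun t ht => ?_
        have ht : 0 < t := ht
        rcases lt_or_ge t A with hA | hA
        · refine le_trans ?_ le_self_add
          refine mul_le_mul' (measure_mono fun x _ => ?_) le_rfl
          exact (ENNReal.ofReal_lt_ofReal_iff (ht.trans hA)).2 hA
        · refine le_trans ?_ le_add_self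
          calc _ ≤ (c * ENNReal.ofReal t * μ {x | ENNReal.ofReal t < F x}) *
                ENNReal.ofReal (t ^ (ε - 1)) := by gcongr; exact h t ht hA
            _ = c * (μ {x | ENNReal.ofReal t < F x} *
                (ENNReal.ofReal t * ENNReal.ofReal (t ^ (ε - 1)))) := by ring
            _ = _ := by
              rw [← ENNReal.ofReal_mul ht.le]
              congr 4
              rw [show 1 + ε - 1 = 1 + (ε - 1) by ring, Real.rpow_add ht, Real.rpow_one]
    _ = ENNReal.ofReal ε * (∫⁻ t in Set.Ioi (0 : ℝ),
        ν {x | ENNReal.ofReal t < ENNReal.ofReal A} * ENNReal.ofReal (t ^ (ε - 1))) +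
        ENNReal.ofReal ε * (c * ∫⁻ t in Set.Ioi (0 : ℝ), μ {x | ENNReal.ofReal t < F x} *
          ENNReal.ofReal (t ^ (1 + ε - 1))) := by
        rw [lintegral_add_left (by exact (hm ν _).mul (hm' _)), mul_add,
          lintegral_const_mul _ (by exact (hm μ _).mul (hm' _))]
    _ ≤ _ := by
        -- The exact constant would be `ε / (1 + ε)`; the denominator is dropped.
        refine add_le_add le_rfl ?_
        rw [← mul_assoc, mul_comm (ENNReal.ofReal ε)]
        refine mul_le_mul' le_rfl ?_
        refine le_mul_of_one_le_left zero_le ?_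
        exact ENNReal.one_le_ofReal.2 (by linarith)

end LayerCake

/-! ### Maximal functions of laminar families -/

section Maximal

variable {X : Type*} [MeasurableSpace X]

/-- Families of measurable sets of positive finite measure, any two of which are nested or
disjoint. -/
structure IsLaminar (μ : Measure X) (𝒮 : Set (Set X)) : Prop where
  measurableSet : ∀ S ∈ 𝒮, MeasurableSet S
  ne_zero : ∀ S ∈ 𝒮, μ S ≠ 0
  ne_top : ∀ S ∈ 𝒮, μ S ≠ ∞
  nested : ∀ S ∈ 𝒮, ∀ S' ∈ 𝒮, S ⊆ S' ∨ S' ⊆ S ∨ Disjoint S S'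

theorem IsLaminar.mono {μ : Measure X} {𝒮 𝒮' : Set (Set X)} (h : IsLaminar μ 𝒮) (hs : 𝒮' ⊆ 𝒮) :
    IsLaminar μ 𝒮' where
  measurableSet S hS := h.measurableSet S (hs hS)
  ne_zero S hS := h.ne_zero S (hs hS)
  ne_top S hS := h.ne_top S (hs hS)
  nested S hS S' hS' := h.nested S (hs hS) S' (hs hS')

/-- Two measures can be compared on the union of a finite laminar family by comparing them on the
maximal members. -/
theorem IsLaminar.measure_biUnion_le {μ : Measure X} {𝒮 : Finset (Set X)}
    (h : IsLaminar μ (𝒮 : Set (Set X))) {ν ν' : Measure X}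
    (hmax : ∀ S ∈ 𝒮, (∀ S' ∈ 𝒮, S ⊆ S' → S' = S) → ν S ≤ ν' S) :
    ν (⋃ S ∈ 𝒮, S) ≤ ν' (⋃ S ∈ 𝒮, S) := by
  classical
  set 𝒯 := 𝒮.filter fun S => ∀ S' ∈ 𝒮, S ⊆ S' → S' = S with h𝒯
  have hU : (⋃ S ∈ 𝒮, S) = ⋃ S ∈ 𝒯, S := by
    refine subset_antisymm ?_ ?_
    · refine Set.iUnion₂_subset fun S hS => ?_
      obtain ⟨S', hSS', hS'⟩ := 𝒮.exists_le_maximal hS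
      refine (show S ⊆ S' from hSS').trans (Set.subset_biUnion_of_mem (u := fun S => S) ?_)
      simp only [h𝒯, Finset.coe_filter]
      exact ⟨hS'.1, fun S'' hS'' hsub => (hS'.eq_of_le hS'' hsub).symm⟩
    · exact Set.biUnion_subset_biUnion_left fun S hS => (Finset.mem_filter.1 hS).1
  have hd : (𝒯 : Set (Set X)).PairwiseDisjoint id := by
    intro S hS S' hS' hne
    obtain ⟨h1, h2⟩ := Finset.mem_filter.1 (Finset.mem_coe.1 hS)
    obtain ⟨h1', h2'⟩ := Finset.mem_filter.1 (Finset.mem_coe.1 hS')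
    rcases h.nested S h1 S' h1' with hs | hs | hs
    · exact absurd (h2 S' h1' hs).symm hne
    · exact absurd (h2' S h1 hs) hne
    · exact hs
  have hms : ∀ S ∈ 𝒯, MeasurableSet (id S) := fun S hS =>
    h.measurableSet S (Finset.mem_filter.1 hS).1
  have key : ∀ κ : Measure X, κ (⋃ S ∈ 𝒯, S) = ∑ S ∈ 𝒯, κ S := fun κ =>
    measure_biUnion_finset hd hms
  rw [hU, key, key]
  refine Finset.sum_le_sum fun S hS => ?_
  exact hmax S (Finset.mem_filter.1 hS).1 (Finset.mem_filter.1 hS).2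

/-- The maximal function of a finite family of sets. -/
def maxFn (μ : Measure X) (𝒮 : Finset (Set X)) (g : X → ℝ≥0∞) (x : X) : ℝ≥0∞ :=
  𝒮.sup fun S => S.indicator (fun _ => ⨍⁻ y in S, g y ∂μ) x

variable {μ : Measure X} {𝒮 : Finset (Set X)}

theorem laverage_le_maxFn (g : X → ℝ≥0∞) {S : Set X} (hS : S ∈ 𝒮) {x : X} (hx : x ∈ S) :
    ⨍⁻ y in S, g y ∂μ ≤ maxFn μ 𝒮 g x := by
  have := Finset.le_sup (f := fun S => S.indicator (fun _ => ⨍⁻ y in S, g y ∂μ) x) hS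
  rwa [Set.indicator_of_mem hx] at this

theorem maxFn_le_iff {g : X → ℝ≥0∞} {x : X} {c : ℝ≥0∞} :
    maxFn μ 𝒮 g x ≤ c ↔ ∀ S ∈ 𝒮, x ∈ S → ⨍⁻ y in S, g y ∂μ ≤ c := by
  classical
  simp only [maxFn, Finset.sup_le_iff, Set.indicator_apply]
  refine forall₂_congr fun S _ => ?_
  split_ifs with h <;> simp [h]

theorem lt_maxFn_iff {g : X → ℝ≥0∞} {x : X} {c : ℝ≥0∞} :
    c < maxFn μ 𝒮 g x ↔ ∃ S ∈ 𝒮, x ∈ S ∧ c < ⨍⁻ y in S, g y ∂μ := by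
  rw [← not_le, maxFn_le_iff]
  push Not
  rfl

theorem measurable_maxFn (h : IsLaminar μ (𝒮 : Set (Set X))) (g : X → ℝ≥0∞) :
    Measurable (maxFn μ 𝒮 g) := by
  have : maxFn μ 𝒮 g = fun x => ⨆ S ∈ 𝒮, S.indicator (fun _ => ⨍⁻ y in S, g y ∂μ) x := by
    ext x; simp only [maxFn, Finset.sup_eq_iSup]
  rw [this]
  exact Measurable.biSup _ 𝒮.countable_toSet fun S hS =>
    measurable_const.indicator (h.measurableSet S hS)

theorem IsLaminar.laverage_mul (h : IsLaminar μ (𝒮 : Set (Set X))) {S : Set X} (hS : S ∈ 𝒮)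
    (g : X → ℝ≥0∞) : (⨍⁻ y in S, g y ∂μ) * μ S = ∫⁻ y in S, g y ∂μ := by
  rw [setLAverage_eq, ENNReal.div_mul_cancel (h.ne_zero S hS) (h.ne_top S hS)]

/-- The weak type `(1, 1)` inequality. -/
theorem IsLaminar.weak_type (h : IsLaminar μ (𝒮 : Set (Set X))) (g : X → ℝ≥0∞) (c : ℝ≥0∞) :
    c * μ {x | c < maxFn μ 𝒮 g x} ≤ ∫⁻ x, g x ∂μ := by
  classical
  set 𝒯 := 𝒮.filter fun S => c < ⨍⁻ y in S, g y ∂μ with h𝒯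
  have hsub : (𝒯 : Set (Set X)) ⊆ 𝒮 := fun S hS => (Finset.mem_filter.1 hS).1
  have hU : {x | c < maxFn μ 𝒮 g x} = ⋃ S ∈ 𝒯, S := by
    ext x
    simp only [Set.mem_ofPred_eq, lt_maxFn_iff, h𝒯, Set.mem_iUnion, Finset.mem_filter]
    constructor
    · rintro ⟨S, hS, hx, hc⟩; exact ⟨S, ⟨hS, hc⟩, hx⟩
    · rintro ⟨S, ⟨hS, hc⟩, hx⟩; exact ⟨S, hS, hx, hc⟩
  have := (h.mono hsub).measure_biUnion_le (ν := c • μ) (ν' := μ.withDensity g) fun S hS _ => by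
    have hS' := Finset.mem_filter.1 hS
    rw [withDensity_apply _ (h.measurableSet S hS'.1), ← h.laverage_mul hS'.1]
    simp only [Measure.smul_apply, smul_eq_mul]
    gcongr
    exact hS'.2.le
  rw [hU]
  calc _ = (c • μ) (⋃ S ∈ 𝒯, S) := by simp
    _ ≤ _ := this
    _ ≤ _ := by
      rw [withDensity_apply _ (𝒯.measurableSet_biUnion fun S hS => h.measurableSet S (hsub hS))]
      exact setLIntegral_le_lintegral _ _

theorem IsLaminar.setLIntegral_ne_top (h : IsLaminar μ (𝒮 : Set (Set X))) {g : X → ℝ≥0∞}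
    {b : ℝ} (hb : 1 ≤ b) (hfin : ∫⁻ x, g x ^ b ∂μ ≠ ∞) {S : Set X} (hS : S ∈ 𝒮) :
    ∫⁻ y in S, g y ∂μ ≠ ∞ := by
  refine ne_top_of_le_ne_top (b := ∫⁻ y in S, (1 + g y ^ b) ∂μ) ?_ (lintegral_mono fun y => ?_)
  · rw [lintegral_add_left measurable_const]
    refine ENNReal.add_ne_top.2 ⟨by simpa using h.ne_top S hS, ?_⟩
    exact ne_top_of_le_ne_top hfin (setLIntegral_le_lintegral _ _)
  · rcases le_total (g y) 1 with h1 | h1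
    · exact h1.trans le_self_add
    · refine le_trans ?_ le_add_self
      calc g y = g y ^ (1 : ℝ) := (ENNReal.rpow_one _).symm
        _ ≤ _ := ENNReal.rpow_le_rpow_of_exponent_le h1 hb

/-- The strong type inequality with the sharp order of the constant as `b → 1`. -/
theorem IsLaminar.strong_type (h : IsLaminar μ (𝒮 : Set (Set X))) {g : X → ℝ≥0∞}
    (hg : AEMeasurable g μ) {b : ℝ} (hb : 1 < b) :
    ∫⁻ x, maxFn μ 𝒮 g x ^ b ∂μ ≤
      ENNReal.ofReal (2 ^ b * (b / (b - 1))) * ∫⁻ x, g x ^ b ∂μ := by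
  have hb0 : 0 < b := by linarith
  have hb1 : 0 < b - 1 := by linarith
  by_cases hfin : ∫⁻ x, g x ^ b ∂μ = ∞
  · rw [hfin, ENNReal.mul_top]
    · exact le_top
    · have : 0 < (2 : ℝ) ^ b * (b / (b - 1)) := by positivity
      simpa using this
  have hMfin : ∀ x, maxFn μ 𝒮 g x ≠ ∞ := by
    intro x
    refine ((Finset.sup_lt_iff ENNReal.zero_lt_top).2 fun S hS => ?_).ne
    by_cases hx : x ∈ S
    · rw [Set.indicator_of_mem hx, setLAverage_eq]
      exact ENNReal.div_lt_top (h.setLIntegral_ne_top hb.le hfin hS) (h.ne_zero S hS)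
    · simp [hx]
  have hgfin : ∀ᵐ x ∂μ, g x ≠ ∞ := by
    filter_upwards [ae_lt_top' (hg.pow_const b) hfin] with x hx hx'
    rw [hx', ENNReal.top_rpow_of_pos hb0] at hx
    exact lt_irrefl _ hx
  have weak : ∀ t : ℝ, 0 < t → ENNReal.ofReal t * μ {x | ENNReal.ofReal t < maxFn μ 𝒮 g x} ≤
      2 * (μ.withDensity g) {x | ENNReal.ofReal t < 2 * g x} := by
    intro t ht
    have h2 : ENNReal.ofReal t = 2 * ENNReal.ofReal (t / 2) := by
      rw [show (2 : ℝ≥0∞) = ENNReal.ofReal 2 by simp, ← ENNReal.ofReal_mul (by norm_num)]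
      congr 1; ring
    -- Off `E` the function is at most `t / 2`, so truncating `g` to `E` lowers each average by at
    -- most `t / 2`; the weak type bound is then used at level `t / 2`.
    set E := {x | ENNReal.ofReal t < 2 * g x} with hE
    have hE' : NullMeasurableSet E μ :=
      nullMeasurableSet_lt aemeasurable_const (hg.const_mul 2)
    have hsub : {x | ENNReal.ofReal t < maxFn μ 𝒮 g x} ⊆
        {x | ENNReal.ofReal (t / 2) < maxFn μ 𝒮 (E.indicator g) x} := by
      intro x hx
      obtain ⟨S, hS, hxS, hlt⟩ := lt_maxFn_iff.1 hx
      refine lt_maxFn_iff.2 ⟨S, hS, hxS, ?_⟩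
      have hle : ⨍⁻ y in S, g y ∂μ ≤ (⨍⁻ y in S, E.indicator g y ∂μ) + ENNReal.ofReal (t / 2) := by
        have : ⨍⁻ y in S, ENNReal.ofReal (t / 2) ∂μ = ENNReal.ofReal (t / 2) := by
          rw [setLAverage_eq]; simp only [lintegral_const, Measure.restrict_apply_univ]
          rw [ENNReal.mul_div_cancel_right (h.ne_zero S hS) (h.ne_top S hS)]
        conv_rhs => rw [← this]
        rw [laverage, laverage, laverage, ← lintegral_add_right _ measurable_const]
        refine lintegral_mono fun y => ?_
        by_cases hy : y ∈ E
        · rw [Set.indicator_of_mem hy]; exact le_self_add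
        · rw [Set.indicator_of_notMem hy, zero_add]
          have : 2 * g y ≤ 2 * ENNReal.ofReal (t / 2) := by rw [← h2]; exact not_lt.1 hy
          exact (ENNReal.mul_le_mul_iff_right (by simp) (by simp)).1 this
      have h3 := hlt.trans_le hle
      rw [h2, two_mul] at h3
      exact lt_of_add_lt_add_right h3
    calc ENNReal.ofReal t * μ {x | ENNReal.ofReal t < maxFn μ 𝒮 g x}
        ≤ 2 * (ENNReal.ofReal (t / 2) *
          μ {x | ENNReal.ofReal (t / 2) < maxFn μ 𝒮 (E.indicator g) x}) := by
          rw [← mul_assoc, ← h2]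
          exact mul_le_mul' le_rfl (measure_mono hsub)
      _ ≤ 2 * ∫⁻ x, E.indicator g x ∂μ := by gcongr; exact h.weak_type _ _
      _ = _ := by rw [lintegral_indicator₀ hE', withDensity_apply₀ _ hE']
  have hac : μ.withDensity g ≪ μ := withDensity_absolutelyContinuous μ g
  -- Reading the layer cake formula backwards for the measure `g dμ` and the function `2g` replaces
  -- an interchange of integrals: it produces `∫ (2g)^(b-1) g dμ`.
  have layer2 := lintegral_rpow_eq_layer (μ.withDensity g) (F := fun x => 2 * g x)
    ((hg.const_mul 2).mono_ac hac)
    (hac.ae_le (hgfin.mono fun x hx => ENNReal.mul_ne_top (by simp) hx)) hb1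
  rw [lintegral_rpow_eq_layer μ (measurable_maxFn h g).aemeasurable
    (Filter.Eventually.of_forall hMfin) hb0]
  have step : ∫⁻ t in Set.Ioi (0 : ℝ), μ {x | ENNReal.ofReal t < maxFn μ 𝒮 g x} *
      ENNReal.ofReal (t ^ (b - 1)) ≤ 2 * ∫⁻ t in Set.Ioi (0 : ℝ),
        (μ.withDensity g) {x | ENNReal.ofReal t < 2 * g x} * ENNReal.ofReal (t ^ (b - 1 - 1)) := by
    rw [← lintegral_const_mul' _ _ (by simp)]
    refine setLIntegral_mono' measurableSet_Ioi fun t ht => ?_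
    have ht : 0 < t := ht
    calc _ = (ENNReal.ofReal t * μ {x | ENNReal.ofReal t < maxFn μ 𝒮 g x}) *
          ENNReal.ofReal (t ^ (b - 1 - 1)) := by
          rw [show b - 1 = 1 + (b - 1 - 1) by ring, Real.rpow_add ht, Real.rpow_one,
            ENNReal.ofReal_mul ht.le]
          ring_nf
      _ ≤ _ := by
          rw [← mul_assoc]; exact mul_le_mul' (weak t ht) le_rfl
  have hI : ENNReal.ofReal (b - 1) * ∫⁻ t in Set.Ioi (0 : ℝ),
        (μ.withDensity g) {x | ENNReal.ofReal t < 2 * g x} * ENNReal.ofReal (t ^ (b - 1 - 1)) =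
      ENNReal.ofReal (2 ^ (b - 1)) * ∫⁻ x, g x ^ b ∂μ := by
    rw [← layer2, lintegral_withDensity_eq_lintegral_mul₀ hg
      (((hg.const_mul 2).pow_const _)), ← lintegral_const_mul' _ _ (by simp)]
    refine lintegral_congr fun x => ?_
    simp only [Pi.mul_apply]
    rw [ENNReal.mul_rpow_of_nonneg _ _ hb1.le, ← ENNReal.ofReal_rpow_of_pos (by norm_num)]
    simp only [ENNReal.ofReal_ofNat]
    conv_rhs => rw [show b = 1 + (b - 1) by ring]
    rw [ENNReal.rpow_add_of_nonneg _ _ (by norm_num) hb1.le, ENNReal.rpow_one]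
    ring_nf
  have hc : ENNReal.ofReal b * 2 = ENNReal.ofReal (2 * (b / (b - 1))) * ENNReal.ofReal (b - 1) := by
    rw [← ENNReal.ofReal_mul (by positivity), show (2 : ℝ≥0∞) = ENNReal.ofReal 2 by simp,
      ← ENNReal.ofReal_mul hb0.le]
    congr 1; field_simp
  calc _ ≤ ENNReal.ofReal b * (2 * ∫⁻ t in Set.Ioi (0 : ℝ),
        (μ.withDensity g) {x | ENNReal.ofReal t < 2 * g x} *
          ENNReal.ofReal (t ^ (b - 1 - 1))) := by gcongr
    _ = ENNReal.ofReal (2 * (b / (b - 1))) * (ENNReal.ofReal (2 ^ (b - 1)) *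
        ∫⁻ x, g x ^ b ∂μ) := by rw [← mul_assoc, hc, mul_assoc, hI]
    _ = _ := by
        rw [← mul_assoc, ← ENNReal.ofReal_mul (by positivity)]
        congr 2
        rw [show (2 : ℝ) ^ b = 2 * 2 ^ (b - 1) by
          rw [← Real.rpow_one_add' (by norm_num) (by linarith)]; ring_nf]
        ring

end Maximal

/-! ### Geometry of dyadic cubes -/

section Cubes

open Filter Topology

variable {d : ℕ}

theorem measurableSet_cube (a : Fin d → ℝ) (ℓ : ℝ) : MeasurableSet (cube a ℓ) :=
  MeasurableSet.univ_pi fun _ => measurableSet_Ico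

theorem volume_cube (a : Fin d → ℝ) (ℓ : ℝ) : volume (cube a ℓ) = ENNReal.ofReal ℓ ^ d := by
  simp [cube, volume_pi_pi]

theorem volume_cube_ne_zero (a : Fin d → ℝ) {ℓ : ℝ} (hℓ : 0 < ℓ) : volume (cube a ℓ) ≠ 0 := by
  rw [volume_cube]; exact pow_ne_zero _ (by simpa using hℓ)

theorem volume_cube_ne_top (a : Fin d → ℝ) (ℓ : ℝ) : volume (cube a ℓ) ≠ ∞ := by
  rw [volume_cube]; exact ENNReal.pow_ne_top ENNReal.ofReal_ne_top

theorem mem_cube {a : Fin d → ℝ} {ℓ : ℝ} {x : Fin d → ℝ} :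
    x ∈ cube a ℓ ↔ ∀ i, a i ≤ x i ∧ x i < a i + ℓ := by
  simp [cube, Set.mem_pi]

/-- Needed so that two members of a lattice that are subcubes of a common cube belong to the same
grid. In dimension zero all cubes coincide and the side length is lost, hence `0 < d`. -/
theorem cube_inj (hd : 0 < d) {a a' : Fin d → ℝ} {ℓ ℓ' : ℝ} (hℓ : 0 < ℓ) (hℓ' : 0 < ℓ')
    (h : cube a ℓ = cube a' ℓ') : a = a' ∧ ℓ = ℓ' := by
  have hne : (cube a ℓ).Nonempty := ⟨a, mem_cube.2 fun i => ⟨le_rfl, by linarith⟩⟩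
  have hne' : (cube a' ℓ').Nonempty := h ▸ hne
  have hi : ∀ i, Set.Ico (a i) (a i + ℓ) = Set.Ico (a' i) (a' i + ℓ') := by
    intro i
    have := congrArg (fun S => Function.eval i '' S) h
    simp only [cube] at this hne hne'
    rwa [Set.eval_image_univ_pi hne, Set.eval_image_univ_pi hne'] at this
  have h1 : ∀ i, a i = a' i := fun i => by
    have := congrArg sInf (hi i)
    rwa [csInf_Ico (by linarith), csInf_Ico (by linarith)] at this
  refine ⟨funext h1, ?_⟩
  have := congrArg sSup (hi ⟨0, hd⟩)
  rw [csSup_Ico (by linarith), csSup_Ico (by linarith), h1] at this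
  linarith

/-- The cubes of the grid obtained by bisecting the sides of `cube a ℓ` `j` times. -/
def gridCube (a : Fin d → ℝ) (ℓ : ℝ) (j : ℕ) (m : Fin d → ℕ) : Set (Fin d → ℝ) :=
  cube (fun i => a i + (m i : ℝ) * (ℓ / 2 ^ j)) (ℓ / 2 ^ j)

/-- The index of the grid cube of generation `j` that contains `x`. -/
def gridIndex (a : Fin d → ℝ) (ℓ : ℝ) (j : ℕ) (x : Fin d → ℝ) : Fin d → ℕ :=
  fun i => ⌊(x i - a i) / (ℓ / 2 ^ j)⌋₊

theorem mem_gridCube_iff {a : Fin d → ℝ} {ℓ : ℝ} (hℓ : 0 < ℓ) {j : ℕ} {m : Fin d → ℕ}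
    {x : Fin d → ℝ} (hx : x ∈ cube a ℓ) : x ∈ gridCube a ℓ j m ↔ gridIndex a ℓ j x = m := by
  have hs : 0 < ℓ / 2 ^ j := by positivity
  rw [gridCube, mem_cube, funext_iff]
  refine forall_congr' fun i => ?_
  have hxi := (mem_cube.1 hx i).1
  rw [gridIndex, Nat.floor_eq_iff (div_nonneg (by linarith) hs.le), le_div_iff₀ hs, div_lt_iff₀ hs]
  constructor
  · rintro ⟨h1, h2⟩; constructor <;> linarith
  · rintro ⟨h1, h2⟩; constructor <;> linarith

theorem gridCube_subset {a : Fin d → ℝ} {ℓ : ℝ} (hℓ : 0 < ℓ) {j : ℕ} {m : Fin d → ℕ}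
    (hm : ∀ i, m i < 2 ^ j) : gridCube a ℓ j m ⊆ cube a ℓ := by
  intro x hx
  rw [gridCube, mem_cube] at hx
  refine mem_cube.2 fun i => ?_
  have hs : 0 < ℓ / 2 ^ j := by positivity
  have h1 : (m i : ℝ) + 1 ≤ 2 ^ j := by exact_mod_cast hm i
  have h2 : ((m i : ℝ) + 1) * (ℓ / 2 ^ j) ≤ ℓ := by
    calc _ ≤ 2 ^ j * (ℓ / 2 ^ j) := by gcongr
      _ = ℓ := by field_simp
  have h3 : 0 ≤ (m i : ℝ) * (ℓ / 2 ^ j) := by positivity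
  exact ⟨by linarith [(hx i).1], by linarith [(hx i).2]⟩

theorem gridIndex_lt {a : Fin d → ℝ} {ℓ : ℝ} (hℓ : 0 < ℓ) (j : ℕ) {x : Fin d → ℝ}
    (hx : x ∈ cube a ℓ) (i : Fin d) : gridIndex a ℓ j x i < 2 ^ j := by
  have hs : 0 < ℓ / 2 ^ j := by positivity
  have hxi := mem_cube.1 hx i
  rw [gridIndex, Nat.floor_lt (div_nonneg (by linarith) hs.le), div_lt_iff₀ hs]
  have : ((2 ^ j : ℕ) : ℝ) * (ℓ / 2 ^ j) = ℓ := by push_cast; field_simp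
  linarith

theorem mem_gridCube_gridIndex {a : Fin d → ℝ} {ℓ : ℝ} (hℓ : 0 < ℓ) (j : ℕ) {x : Fin d → ℝ}
    (hx : x ∈ cube a ℓ) : x ∈ gridCube a ℓ j (gridIndex a ℓ j x) :=
  (mem_gridCube_iff hℓ hx).2 rfl

/-- Coarsening the grid is integer division of the index. All nesting properties of dyadic cubes
follow from this, without any comparison of end points. -/
theorem gridIndex_div (a : Fin d → ℝ) (ℓ : ℝ) (j k : ℕ) (x : Fin d → ℝ) (i : Fin d) :
    gridIndex a ℓ j x i = gridIndex a ℓ (j + k) x i / 2 ^ k := by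
  have := Nat.floor_div_natCast ((x i - a i) / (ℓ / 2 ^ (j + k))) (2 ^ k)
  rw [gridIndex, gridIndex, ← this]
  congr 1
  push_cast
  rw [pow_add]
  field_simp

theorem gridCube_subset_of_mem {a : Fin d → ℝ} {ℓ : ℝ} (hℓ : 0 < ℓ) {j k : ℕ} {m m' : Fin d → ℕ}
    (hm' : ∀ i, m' i < 2 ^ (j + k)) {x : Fin d → ℝ} (hx : x ∈ gridCube a ℓ j m)
    (hx' : x ∈ gridCube a ℓ (j + k) m') : gridCube a ℓ (j + k) m' ⊆ gridCube a ℓ j m := by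
  intro y hy
  have hxQ := gridCube_subset hℓ hm' hx'
  have hyQ := gridCube_subset hℓ hm' hy
  rw [mem_gridCube_iff hℓ hxQ] at hx hx'
  rw [mem_gridCube_iff hℓ hyQ] at hy ⊢
  rw [← hx]
  funext i
  rw [gridIndex_div a ℓ j k, gridIndex_div a ℓ j k x, hy, hx']

theorem gridCube_nested {a : Fin d → ℝ} {ℓ : ℝ} (hℓ : 0 < ℓ) {j j' : ℕ} {m m' : Fin d → ℕ}
    (hm : ∀ i, m i < 2 ^ j) (hm' : ∀ i, m' i < 2 ^ j') :
    gridCube a ℓ j m ⊆ gridCube a ℓ j' m' ∨ gridCube a ℓ j' m' ⊆ gridCube a ℓ j m ∨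
      Disjoint (gridCube a ℓ j m) (gridCube a ℓ j' m') := by
  by_cases hdis : Disjoint (gridCube a ℓ j m) (gridCube a ℓ j' m')
  · exact Or.inr (Or.inr hdis)
  obtain ⟨x, hx, hx'⟩ := Set.not_disjoint_iff.1 hdis
  rcases le_total j j' with h | h
  · obtain ⟨k, rfl⟩ := Nat.exists_eq_add_of_le h
    exact Or.inr (Or.inl (gridCube_subset_of_mem hℓ hm' hx hx'))
  · obtain ⟨k, rfl⟩ := Nat.exists_eq_add_of_le h
    exact Or.inl (gridCube_subset_of_mem hℓ hm hx' hx)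

theorem IsDyadicLattice.exists_cube {𝒟 : Set (Set (Fin d → ℝ))} (h𝒟 : IsDyadicLattice 𝒟)
    {Q : Set (Fin d → ℝ)} (hQ : Q ∈ 𝒟) : ∃ (a : Fin d → ℝ) (ℓ : ℝ), 0 < ℓ ∧ Q = cube a ℓ := by
  obtain ⟨a, k, rfl⟩ := h𝒟.side_length Q hQ
  exact ⟨a, _, by positivity, rfl⟩

theorem IsDyadicLattice.mem_cubes {𝒟 : Set (Set (Fin d → ℝ))} (h𝒟 : IsDyadicLattice 𝒟)
    {Q : Set (Fin d → ℝ)} (hQ : Q ∈ 𝒟) : Q ∈ cubes d := h𝒟.exists_cube hQ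

theorem IsDyadicLattice.gridCube_mem {𝒟 : Set (Set (Fin d → ℝ))} (h𝒟 : IsDyadicLattice 𝒟)
    {a : Fin d → ℝ} {ℓ : ℝ} (hℓ : 0 < ℓ) (hQ : cube a ℓ ∈ 𝒟) {j : ℕ} {m : Fin d → ℕ}
    (hm : ∀ i, m i < 2 ^ j) : gridCube a ℓ j m ∈ 𝒟 :=
  h𝒟.subcube_mem _ hQ _ ⟨a, ℓ, j, m, hℓ, rfl, hm, rfl⟩

theorem IsDyadicLattice.isLaminar (hd : 0 < d) {𝒟 : Set (Set (Fin d → ℝ))}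
    (h𝒟 : IsDyadicLattice 𝒟) : IsLaminar volume 𝒟 where
  measurableSet S hS := by
    obtain ⟨a, ℓ, hℓ, rfl⟩ := h𝒟.exists_cube hS; exact measurableSet_cube a ℓ
  ne_zero S hS := by
    obtain ⟨a, ℓ, hℓ, rfl⟩ := h𝒟.exists_cube hS; exact volume_cube_ne_zero a hℓ
  ne_top S hS := by
    obtain ⟨a, ℓ, hℓ, rfl⟩ := h𝒟.exists_cube hS; exact volume_cube_ne_top a ℓ
  nested S hS S' hS' := by
    obtain ⟨Q, -, ⟨a, ℓ, j, m, hℓ, rfl, hm, rfl⟩, ⟨a', ℓ', j', m', hℓ', hQ, hm', rfl⟩⟩ :=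
      h𝒟.common_ancestor S hS S' hS'
    obtain ⟨rfl, rfl⟩ := cube_inj hd hℓ hℓ' hQ
    exact gridCube_nested hℓ hm hm'

open Classical in
/-- The dyadic subcubes of `cube a ℓ` of generation at most `k`. -/
def gridFamily (a : Fin d → ℝ) (ℓ : ℝ) (k : ℕ) : Finset (Set (Fin d → ℝ)) :=
  (Finset.range (k + 1)).biUnion fun j =>
    (Fintype.piFinset fun _ : Fin d => Finset.range (2 ^ j)).image (gridCube a ℓ j)

theorem mem_gridFamily {a : Fin d → ℝ} {ℓ : ℝ} {k : ℕ} {R : Set (Fin d → ℝ)} :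
    R ∈ gridFamily a ℓ k ↔ ∃ j ≤ k, ∃ m : Fin d → ℕ, (∀ i, m i < 2 ^ j) ∧ R = gridCube a ℓ j m := by
  simp only [gridFamily, Finset.mem_biUnion, Finset.mem_range, Finset.mem_image,
    Fintype.mem_piFinset, Nat.lt_succ_iff]
  refine exists_congr fun j => and_congr_right fun _ => exists_congr fun m => ?_
  rw [eq_comm]

theorem gridCube_mem_cubes (a : Fin d → ℝ) {ℓ : ℝ} (hℓ : 0 < ℓ) (j : ℕ) (m : Fin d → ℕ) :
    gridCube a ℓ j m ∈ cubes d := ⟨_, _, by positivity, rfl⟩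

theorem isLaminar_gridFamily (a : Fin d → ℝ) {ℓ : ℝ} (hℓ : 0 < ℓ) (k : ℕ) :
    IsLaminar volume (gridFamily a ℓ k : Set (Set (Fin d → ℝ))) where
  measurableSet S hS := by
    obtain ⟨j, -, m, -, rfl⟩ := mem_gridFamily.1 hS; exact measurableSet_cube _ _
  ne_zero S hS := by
    obtain ⟨j, -, m, -, rfl⟩ := mem_gridFamily.1 hS; exact volume_cube_ne_zero _ (by positivity)
  ne_top S hS := by
    obtain ⟨j, -, m, -, rfl⟩ := mem_gridFamily.1 hS; exact volume_cube_ne_top _ _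
  nested S hS S' hS' := by
    obtain ⟨j, -, m, hm, rfl⟩ := mem_gridFamily.1 hS
    obtain ⟨j', -, m', hm', rfl⟩ := mem_gridFamily.1 hS'
    exact gridCube_nested hℓ hm hm'

theorem gridCube_zero (a : Fin d → ℝ) (ℓ : ℝ) : gridCube a ℓ 0 0 = cube a ℓ := by
  simp [gridCube]

theorem exists_parent (hd : 0 < d) {a : Fin d → ℝ} {ℓ : ℝ} (hℓ : 0 < ℓ) {k : ℕ}
    {R : Set (Fin d → ℝ)} (hR : R ∈ gridFamily a ℓ k) (hne : R ≠ cube a ℓ) :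
    ∃ R' ∈ gridFamily a ℓ k, R ⊆ R' ∧ R' ≠ R ∧ volume R' = 2 ^ d * volume R := by
  obtain ⟨j, hj, m, hm, rfl⟩ := mem_gridFamily.1 hR
  rcases j with _ | j
  · refine absurd ?_ hne
    rw [← gridCube_zero]
    congr 1
    funext i
    simpa using hm i
  have hvol : volume (gridCube a ℓ j fun i => m i / 2) =
      2 ^ d * volume (gridCube a ℓ (j + 1) m) := by
    rw [gridCube, gridCube, volume_cube, volume_cube, ← mul_pow,
      show (2 : ℝ≥0∞) = ENNReal.ofReal 2 by simp, ← ENNReal.ofReal_mul (by norm_num)]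
    congr 2
    rw [pow_succ]; field_simp
  refine ⟨gridCube a ℓ j fun i => m i / 2, mem_gridFamily.2 ⟨j, by omega, _, fun i => ?_, rfl⟩,
    ?_, ?_, hvol⟩
  · have := hm i; rw [pow_succ] at this; omega
  · intro x hx
    have hxQ := gridCube_subset hℓ hm hx
    rw [mem_gridCube_iff hℓ hxQ] at hx ⊢
    funext i
    rw [gridIndex_div a ℓ j 1, hx, pow_one]
  -- Equality with the parent would force `2 ^ d = 1`.
  · intro heq
    rw [heq] at hvol
    have h0 : volume (gridCube a ℓ (j + 1) m) ≠ 0 := volume_cube_ne_zero _ (by positivity)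
    have ht : volume (gridCube a ℓ (j + 1) m) ≠ ∞ := volume_cube_ne_top _ _
    have h1 : (1 : ℝ≥0∞) = 2 ^ d := by
      rw [← ENNReal.mul_left_inj h0 ht, one_mul]; exact hvol
    have h2 : (1 : ℕ) = 2 ^ d := by exact_mod_cast h1
    have := Nat.one_lt_two_pow hd.ne'
    omega

/-! ### Lebesgue differentiation along dyadic cubes -/

/-- The centre of a grid cube. -/
def gridCenter (a : Fin d → ℝ) (ℓ : ℝ) (j : ℕ) (m : Fin d → ℕ) : Fin d → ℝ :=
  fun i => a i + (m i : ℝ) * (ℓ / 2 ^ j) + ℓ / 2 ^ j / 2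

theorem closedBall_gridCenter (a : Fin d → ℝ) {ℓ : ℝ} (hℓ : 0 < ℓ) (j : ℕ) (m : Fin d → ℕ) :
    Metric.closedBall (gridCenter a ℓ j m) (ℓ / 2 ^ j / 2) =
      Set.Icc (fun i => a i + (m i : ℝ) * (ℓ / 2 ^ j))
        (fun i => a i + (m i : ℝ) * (ℓ / 2 ^ j) + ℓ / 2 ^ j) := by
  rw [closedBall_pi _ (by positivity), ← Set.pi_univ_Icc]
  congr 1
  funext i
  rw [Real.closedBall_eq_Icc, gridCenter]
  congr 1 <;> ring

theorem gridCube_ae_eq_closedBall (a : Fin d → ℝ) {ℓ : ℝ} (hℓ : 0 < ℓ) (j : ℕ) (m : Fin d → ℕ) :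
    gridCube a ℓ j m =ᵐ[volume] Metric.closedBall (gridCenter a ℓ j m) (ℓ / 2 ^ j / 2) := by
  rw [closedBall_gridCenter a hℓ]
  exact Measure.univ_pi_Ico_ae_eq_Icc

theorem gridCube_subset_closedBall (a : Fin d → ℝ) {ℓ : ℝ} (hℓ : 0 < ℓ) (j : ℕ) (m : Fin d → ℕ) :
    gridCube a ℓ j m ⊆ Metric.closedBall (gridCenter a ℓ j m) (ℓ / 2 ^ j / 2) := by
  rw [closedBall_gridCenter a hℓ]
  intro x hx
  rw [gridCube, mem_cube] at hx
  exact ⟨fun i => (hx i).1, fun i => (hx i).2.le⟩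

theorem tendsto_side {ℓ : ℝ} (hℓ : 0 < ℓ) :
    Tendsto (fun j : ℕ => ℓ / 2 ^ j / 2) atTop (𝓝[>] 0) := by
  refine tendsto_nhdsWithin_iff.2 ⟨?_, Eventually.of_forall fun j => by
    simp only [Set.mem_Ioi]; positivity⟩
  have := (tendsto_pow_atTop_nhds_zero_of_lt_one (r := (1 / 2 : ℝ)) (by norm_num)
    (by norm_num)).const_mul (ℓ / 2)
  rw [mul_zero] at this
  refine this.congr fun j => ?_
  rw [div_pow, one_pow]
  ring

/-- The cubes shrinking to `x` are not centred at `x`, but up to null sets they are closed balls of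
the sup norm that contain `x`. Such balls belong to the Vitali family of the doubling measure, so
the differentiation theorem applies. -/
theorem ae_tendsto_laverage_gridCube (a : Fin d → ℝ) {ℓ : ℝ} (hℓ : 0 < ℓ)
    {f : (Fin d → ℝ) → ℝ≥0∞} (hf : AEMeasurable f volume) (hfin : ∫⁻ x in cube a ℓ, f x ≠ ∞) :
    ∀ᵐ x, x ∈ cube a ℓ → Tendsto
      (fun j => ⨍⁻ y in gridCube a ℓ j (gridIndex a ℓ j x), f y ∂volume) atTop (𝓝 (f x)) := by
  have hQ := measurableSet_cube a ℓ
  have h := (IsUnifLocDoublingMeasure.vitaliFamily (volume : Measure (Fin d → ℝ)) 1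
    ).ae_tendsto_lintegral_div (f := (cube a ℓ).indicator f) (hf.indicator hQ)
    (by rwa [lintegral_indicator hQ])
  filter_upwards [h] with x hx hxQ
  rw [Set.indicator_of_mem hxQ] at hx
  refine (hx.comp (IsUnifLocDoublingMeasure.tendsto_closedBall_filterAt volume
    (fun j => gridCenter a ℓ j (gridIndex a ℓ j x)) _ (tendsto_side hℓ)
    (Eventually.of_forall fun j => ?_))).congr fun j => ?_
  · rw [one_mul]
    exact gridCube_subset_closedBall a hℓ _ _ (mem_gridCube_gridIndex hℓ j hxQ)
  · simp only [Function.comp_apply]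
    have hae := gridCube_ae_eq_closedBall a hℓ j (gridIndex a ℓ j x)
    rw [← setLIntegral_congr hae, ← measure_congr hae, setLAverage_eq]
    congr 1
    refine setLIntegral_congr_fun (measurableSet_cube _ _) fun y hy => ?_
    exact Set.indicator_of_mem (gridCube_subset hℓ (gridIndex_lt hℓ j hxQ) hy) f

theorem ae_tendsto_average_gridCube (a : Fin d → ℝ) {ℓ : ℝ} (hℓ : 0 < ℓ)
    {f : (Fin d → ℝ) → ℝ} (hf : LocallyIntegrable f volume) :
    ∀ᵐ x, x ∈ cube a ℓ → Tendsto
      (fun j => ⨍ y in gridCube a ℓ j (gridIndex a ℓ j x), f y) atTop (𝓝 (f x)) := by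
  filter_upwards [IsUnifLocDoublingMeasure.ae_tendsto_average volume hf 1] with x hx hxQ
  refine (hx (fun j => gridCenter a ℓ j (gridIndex a ℓ j x)) _ (tendsto_side hℓ)
    (Eventually.of_forall fun j => ?_)).congr fun j => ?_
  · rw [one_mul]
    exact gridCube_subset_closedBall a hℓ _ _ (mem_gridCube_gridIndex hℓ j hxQ)
  · exact (setAverage_congr (gridCube_ae_eq_closedBall a hℓ j (gridIndex a ℓ j x))).symm

end Cubes

/-! ### A quantitative reverse Hölder inequality -/

section ReverseHolder

open Filter Topology

variable {d : ℕ}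

/-- The Fujii–Wilson form of the `A_∞` condition. By hypothesis the maximal function of `w` is at
most `K` times the square of that of `w^{1/2}`, and the latter is estimated in `L²`, where the
strong type constant is `2² · 2 = 8`. -/
theorem lintegral_maxFn_le {w : (Fin d → ℝ) → ℝ≥0∞} (hw : AEMeasurable w volume) {K : ℝ≥0}
    (hsq : ∀ R ∈ cubes d, ⨍⁻ x in R, w x ∂volume ≤ K * (⨍⁻ x in R, w x ^ (1 / 2 : ℝ) ∂volume) ^ 2)
    {𝒮 : Finset (Set (Fin d → ℝ))} (h𝒮 : IsLaminar volume (𝒮 : Set (Set (Fin d → ℝ))))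
    (hc : ∀ S ∈ 𝒮, S ∈ cubes d) {R : Set (Fin d → ℝ)} (hR : MeasurableSet R)
    (hsub : ∀ S ∈ 𝒮, S ⊆ R) :
    ∫⁻ x, maxFn volume 𝒮 w x ≤ 8 * K * ∫⁻ x in R, w x := by
  set g : (Fin d → ℝ) → ℝ≥0∞ := R.indicator fun x => w x ^ (1 / 2 : ℝ) with hg
  have hgm : AEMeasurable g volume := (hw.pow_const _).indicator hR
  have hpt : ∀ x, maxFn volume 𝒮 w x ≤ K * maxFn volume 𝒮 g x ^ (2 : ℝ) := by
    refine fun x => maxFn_le_iff.2 fun S hS hx => (hsq S (hc S hS)).trans ?_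
    rw [ENNReal.rpow_two]
    gcongr
    have : ⨍⁻ x in S, w x ^ (1 / 2 : ℝ) ∂volume = ⨍⁻ x in S, g x ∂volume := by
      rw [setLAverage_eq, setLAverage_eq]
      congr 1
      exact setLIntegral_congr_fun (h𝒮.measurableSet S hS) fun y hy => by
        rw [hg, Set.indicator_of_mem (hsub S hS hy)]
    rw [this]
    exact laverage_le_maxFn g hS hx
  calc ∫⁻ x, maxFn volume 𝒮 w x ≤ ∫⁻ x, K * maxFn volume 𝒮 g x ^ (2 : ℝ) := lintegral_mono hpt
    _ = K * ∫⁻ x, maxFn volume 𝒮 g x ^ (2 : ℝ) := lintegral_const_mul' _ _ (by simp)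
    _ ≤ K * (ENNReal.ofReal (2 ^ (2 : ℝ) * (2 / (2 - 1))) * ∫⁻ x, g x ^ (2 : ℝ)) := by
        gcongr; exact h𝒮.strong_type hgm (by norm_num)
    _ = 8 * K * ∫⁻ x in R, w x := by
        have h8 : ENNReal.ofReal (2 ^ (2 : ℝ) * (2 / (2 - 1))) = 8 := by
          rw [Real.rpow_two]; norm_num
        have hgw : ∫⁻ x, g x ^ (2 : ℝ) = ∫⁻ x in R, w x := by
          rw [← lintegral_indicator hR]
          refine lintegral_congr fun x => ?_
          by_cases hx : x ∈ R
          · rw [hg, Set.indicator_of_mem hx, Set.indicator_of_mem hx, ← ENNReal.rpow_mul]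
            norm_num
          · rw [hg, Set.indicator_of_notMem hx, Set.indicator_of_notMem hx]
            simp
        rw [h8, hgw]; ring

/-- The Calderón–Zygmund stopping argument. The level set is the union of the maximal cubes with
average above `t`. None of them is the top cube, so each has a parent, whose average is at most `t`;
hence `∫_R w ≤ 2^d t |R|`. The measure `ν` is kept general because it is used both for `M w dx` and
for `w dx`. -/
theorem level_estimate (hd : 0 < d) {w : (Fin d → ℝ) → ℝ≥0∞} {a : Fin d → ℝ} {ℓ : ℝ} (hℓ : 0 < ℓ)
    (k : ℕ) {c : ℝ≥0∞} {t : ℝ≥0∞} (ht : ⨍⁻ x in cube a ℓ, w x ∂volume ≤ t)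
    {ν : Measure (Fin d → ℝ)}
    (hν : ∀ R ∈ gridFamily a ℓ k, t < ⨍⁻ x in R, w x ∂volume →
      (∀ S ∈ gridFamily a ℓ k, R ⊆ S → t < ⨍⁻ x in S, w x ∂volume → S = R) →
      ν R ≤ c * ∫⁻ x in R, w x) :
    ν {x | t < maxFn volume (gridFamily a ℓ k) w x} ≤
      c * 2 ^ d * t * volume {x | t < maxFn volume (gridFamily a ℓ k) w x} := by
  classical
  have hlam := isLaminar_gridFamily a hℓ k
  set 𝒮 := gridFamily a ℓ k with h𝒮
  set 𝒯 := 𝒮.filter fun S => t < ⨍⁻ y in S, w y ∂volume with h𝒯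
  have hsub : (𝒯 : Set (Set (Fin d → ℝ))) ⊆ 𝒮 := fun S hS => (Finset.mem_filter.1 hS).1
  have hU : {x | t < maxFn volume 𝒮 w x} = ⋃ S ∈ 𝒯, S := by
    ext x
    simp only [Set.mem_ofPred_eq, lt_maxFn_iff, h𝒯, Set.mem_iUnion, Finset.mem_filter]
    constructor
    · rintro ⟨S, hS, hx, hc⟩; exact ⟨S, ⟨hS, hc⟩, hx⟩
    · rintro ⟨S, ⟨hS, hc⟩, hx⟩; exact ⟨S, hS, hx, hc⟩
  have := (hlam.mono hsub).measure_biUnion_le (ν := ν) (ν' := (c * 2 ^ d * t) • volume)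
    fun R hR hmax => by
      obtain ⟨hR1, hR2⟩ := Finset.mem_filter.1 hR
      refine (hν R hR1 hR2 fun S hS hRS hSt =>
        hmax S (Finset.mem_filter.2 ⟨hS, hSt⟩) hRS).trans ?_
      obtain ⟨R', hR', hRR', hne, hvol⟩ := exists_parent hd hℓ hR1 (by
        rintro rfl; exact absurd hR2 (not_lt.2 ht))
      have hR't : ⨍⁻ x in R', w x ∂volume ≤ t := by
        by_contra hcon
        exact hne (hmax R' (Finset.mem_filter.2 ⟨hR', not_le.1 hcon⟩) hRR')
      simp only [Measure.smul_apply, smul_eq_mul]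
      calc c * ∫⁻ x in R, w x ≤ c * ∫⁻ x in R', w x := by
            gcongr
        _ = c * ((⨍⁻ x in R', w x ∂volume) * volume R') := by rw [hlam.laverage_mul hR']
        _ ≤ c * (t * (2 ^ d * volume R)) := by rw [hvol]; gcongr
        _ = _ := by ring
  rw [hU]
  simpa using this

/-- Stopping at generation `k` makes the maximal function bounded. This is what gives finite
integrals, so that terms can later be absorbed. -/
theorem maxFn_gridFamily_ne_top (a : Fin d → ℝ) {ℓ : ℝ} (hℓ : 0 < ℓ) {w : (Fin d → ℝ) → ℝ≥0∞}
    (hfin : ∫⁻ x in cube a ℓ, w x ≠ ∞) (k : ℕ) :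
    ∃ B : ℝ≥0, ∀ x, maxFn volume (gridFamily a ℓ k) w x ≤ (cube a ℓ).indicator (fun _ => (B : ℝ≥0∞)) x := by
  have hlam := isLaminar_gridFamily a hℓ k
  have hsub : ∀ S ∈ gridFamily a ℓ k, S ⊆ cube a ℓ := fun S hS => by
    obtain ⟨j, -, m, hm, rfl⟩ := mem_gridFamily.1 hS
    exact gridCube_subset hℓ hm
  set B := (gridFamily a ℓ k).sup fun S => ⨍⁻ y in S, w y ∂volume with hB
  have hBt : B ≠ ∞ := by
    refine ((Finset.sup_lt_iff ENNReal.zero_lt_top).2 fun S hS => ?_).ne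
    rw [setLAverage_eq]
    refine ENNReal.div_lt_top (ne_top_of_le_ne_top hfin ?_) (hlam.ne_zero S hS)
    exact lintegral_mono_set (hsub S hS)
  refine ⟨B.toNNReal, fun x => maxFn_le_iff.2 fun S hS hx => ?_⟩
  rw [Set.indicator_of_mem (hsub S hS hx), ENNReal.coe_toNNReal hBt]
  exact Finset.le_sup (f := fun S => ⨍⁻ y in S, w y ∂volume) hS

/-- The level set estimate is used twice. For the measure `M dx` it bounds `∫ M^{1+ε}` by a lower
order term plus a multiple `8 K 2^d ε ≤ 1/2` of itself, which is absorbed. For the measure `w dx` it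
then bounds `∫ w M^ε` by means of `∫ M^{1+ε}`. -/
theorem maxFn_gridFamily_rpow_le (hd : 0 < d) {w : (Fin d → ℝ) → ℝ≥0∞}
    (hw : AEMeasurable w volume) {K : ℝ≥0}
    (hsq : ∀ R ∈ cubes d, ⨍⁻ x in R, w x ∂volume ≤ K * (⨍⁻ x in R, w x ^ (1 / 2 : ℝ) ∂volume) ^ 2)
    {a : Fin d → ℝ} {ℓ : ℝ} (hℓ : 0 < ℓ) (hfin : ∫⁻ x in cube a ℓ, w x ≠ ∞) {ε : ℝ} (hε : 0 < ε)
    (hεK : 16 * 2 ^ d * K * ε ≤ 1) (k : ℕ) :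
    ∫⁻ x in cube a ℓ, w x * maxFn volume (gridFamily a ℓ k) w x ^ ε ≤
      2 * ((⨍⁻ x in cube a ℓ, w x ∂volume) ^ ε * ∫⁻ x in cube a ℓ, w x) := by
  classical
  have hlam := isLaminar_gridFamily a hℓ k
  have hQm := measurableSet_cube a ℓ
  have hsub : ∀ S ∈ gridFamily a ℓ k, S ⊆ cube a ℓ := fun S hS => by
    obtain ⟨j, -, m, hm, rfl⟩ := mem_gridFamily.1 hS
    exact gridCube_subset hℓ hm
  have hcubes : ∀ S ∈ gridFamily a ℓ k, S ∈ cubes d := fun S hS => by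
    obtain ⟨j, -, m, hm, rfl⟩ := mem_gridFamily.1 hS
    exact gridCube_mem_cubes a hℓ j m
  set M := maxFn volume (gridFamily a ℓ k) w with hM
  have hMm : Measurable M := measurable_maxFn hlam w
  obtain ⟨B, hB⟩ := maxFn_gridFamily_ne_top a hℓ hfin k
  have hMt : ∀ x, M x ≠ ∞ := fun x => by
    refine ne_top_of_le_ne_top (b := (B : ℝ≥0∞)) (by simp) ((hB x).trans ?_)
    exact Set.indicator_le_self' (by simp) x
  set A := ⨍⁻ x in cube a ℓ, w x ∂volume with hA
  have hAt : A ≠ ∞ := by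
    rw [hA, setLAverage_eq]
    exact (ENNReal.div_lt_top hfin (volume_cube_ne_zero a hℓ)).ne
  have hAr : ENNReal.ofReal A.toReal = A := ENNReal.ofReal_toReal hAt
  have hle : ∀ t, A.toReal ≤ t → A ≤ ENNReal.ofReal t := fun t ht => by
    rw [← hAr]; exact ENNReal.ofReal_le_ofReal ht
  set W := ∫⁻ x in cube a ℓ, w x with hW
  -- the measure with density `M`
  have hI1 : ∫⁻ x, M x ^ (1 + ε) ≤ A ^ ε * (8 * K * W) +
      (8 * K * 2 ^ d) * ENNReal.ofReal ε * ∫⁻ x, M x ^ (1 + ε) := by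
    have h1 := lintegral_rpow_le_of_level (volume.withDensity M) volume hMm (A := A.toReal)
      (c := 8 * K * 2 ^ d)
      (Eventually.of_forall hMt) (Eventually.of_forall hMt) hε fun t _ htA => by
        refine level_estimate hd hℓ k (hle t htA) fun R hR hRt hmax => ?_
        have hRm := hlam.measurableSet R hR
        rw [withDensity_apply _ hRm]
        set 𝒮' := (gridFamily a ℓ k).filter (· ⊆ R) with h𝒮'
        have hs' : (𝒮' : Set (Set (Fin d → ℝ))) ⊆ gridFamily a ℓ k := fun S hS =>
          (Finset.mem_filter.1 hS).1
        refine le_trans ?_ (lintegral_maxFn_le hw hsq (hlam.mono hs')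
          (fun S hS => hcubes S (Finset.mem_filter.1 hS).1) hRm
          fun S hS => (Finset.mem_filter.1 hS).2)
        refine le_trans (setLIntegral_mono' hRm fun x hx => ?_) (setLIntegral_le_lintegral R _)
        have hR' : R ∈ 𝒮' := Finset.mem_filter.2 ⟨hR, subset_rfl⟩
        have hRx : ⨍⁻ x in R, w x ∂volume ≤ maxFn volume 𝒮' w x := laverage_le_maxFn w hR' hx
        -- Inside a maximal cube `R` only subcubes of `R` matter: a strictly larger cube is not
        -- selected, so its average is at most `t`, hence below the average over `R`.
        refine maxFn_le_iff.2 fun S hS hxS => ?_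
        rcases hlam.nested S hS R hR with hn | hn | hn
        · exact laverage_le_maxFn w (Finset.mem_filter.2 ⟨hS, hn⟩) hxS
        · by_cases hSt : ENNReal.ofReal t < ⨍⁻ x in S, w x ∂volume
          · rw [hmax S hS hn hSt]; exact hRx
          · exact (not_lt.1 hSt).trans (hRt.le.trans hRx)
        · exact absurd hx (Set.disjoint_left.1 hn hxS)
    rw [hAr] at h1
    have h2 : ∫⁻ x, M x ^ (1 + ε) = ∫⁻ x, M x ^ ε ∂(volume.withDensity M) := by
      rw [lintegral_withDensity_eq_lintegral_mul _ hMm (hMm.pow_const _)]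
      refine lintegral_congr fun x => ?_
      rw [Pi.mul_apply, ENNReal.rpow_add_of_nonneg _ _ (by norm_num) hε.le, ENNReal.rpow_one]
    rw [h2] at h1 ⊢
    refine h1.trans ?_
    gcongr
    rw [withDensity_apply _ MeasurableSet.univ, Measure.restrict_univ]
    exact lintegral_maxFn_le hw hsq hlam hcubes hQm hsub
  have hIt : ∫⁻ x, M x ^ (1 + ε) ≠ ∞ := by
    refine ne_top_of_le_ne_top
      (b := ∫⁻ x, (cube a ℓ).indicator (fun _ => (B : ℝ≥0∞) ^ (1 + ε)) x) ?_
      (lintegral_mono fun x => ?_)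
    · rw [lintegral_indicator hQm, setLIntegral_const]
      exact ENNReal.mul_ne_top (ENNReal.rpow_ne_top_of_nonneg (by linarith) (by simp))
        (volume_cube_ne_top a ℓ)
    · by_cases hx : x ∈ cube a ℓ
      · have := hB x
        rw [Set.indicator_of_mem hx] at this ⊢
        exact ENNReal.rpow_le_rpow this (by linarith)
      · have := hB x
        rw [Set.indicator_of_notMem hx] at this ⊢
        rw [hM, le_zero_iff.1 this, ENNReal.zero_rpow_of_pos (by linarith)]
  have hconst : (8 * K * 2 ^ d : ℝ≥0∞) * ENNReal.ofReal ε ≤ 2⁻¹ := by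
    have : (8 * K * 2 ^ d : ℝ≥0∞) * ENNReal.ofReal ε = ENNReal.ofReal (8 * K * 2 ^ d * ε) := by
      rw [ENNReal.ofReal_mul (by positivity), ENNReal.ofReal_mul (by positivity),
        ENNReal.ofReal_mul (by positivity), ENNReal.ofReal_pow (by positivity)]
      simp
    rw [this, show (2⁻¹ : ℝ≥0∞) = ENNReal.ofReal 2⁻¹ by
      rw [ENNReal.ofReal_inv_of_pos (by norm_num)]; simp]
    refine ENNReal.ofReal_le_ofReal ?_
    nlinarith
  have hI : ∫⁻ x, M x ^ (1 + ε) ≤ 2 * (A ^ ε * (8 * K * W)) := by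
    set I := ∫⁻ x, M x ^ (1 + ε)
    have h3 : 2⁻¹ * I + 2⁻¹ * I ≤ A ^ ε * (8 * K * W) + 2⁻¹ * I := by
      rw [← add_mul, ENNReal.inv_two_add_inv_two, one_mul]
      exact hI1.trans (by gcongr)
    have h4 := (ENNReal.add_le_add_iff_right (ENNReal.mul_ne_top (by simp) hIt)).1 h3
    calc I = 2 * (2⁻¹ * I) := by
          rw [← mul_assoc, ENNReal.mul_inv_cancel (by simp) (by simp), one_mul]
      _ ≤ _ := by gcongr
  have h5 := lintegral_rpow_le_of_level ((volume.restrict (cube a ℓ)).withDensity w) volume hMm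
    (A := A.toReal) (c := 2 ^ d)
    (Eventually.of_forall hMt) (Eventually.of_forall hMt) hε fun t _ htA => by
      have := level_estimate hd hℓ k (c := 1) (hle t htA)
        (ν := (volume.restrict (cube a ℓ)).withDensity w) fun R hR _ _ => by
          rw [withDensity_apply _ (hlam.measurableSet R hR), one_mul]
          exact lintegral_mono' (Measure.restrict_mono subset_rfl Measure.restrict_le_self) le_rfl
      rwa [one_mul] at this
  rw [lintegral_withDensity_eq_lintegral_mul₀ hw.restrict (hMm.pow_const _).aemeasurable,
    withDensity_apply _ MeasurableSet.univ, Measure.restrict_univ, hAr] at h5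
  calc ∫⁻ x in cube a ℓ, w x * M x ^ ε ≤ A ^ ε * W + 2 ^ d * ENNReal.ofReal ε *
        ∫⁻ x, M x ^ (1 + ε) := h5
    _ ≤ A ^ ε * W + 2 ^ d * ENNReal.ofReal ε * (2 * (A ^ ε * (8 * K * W))) := by gcongr
    _ = A ^ ε * W + 2 * ((8 * K * 2 ^ d) * ENNReal.ofReal ε) * (A ^ ε * W) := by ring
    _ ≤ A ^ ε * W + 2 * 2⁻¹ * (A ^ ε * W) := by gcongr
    _ = _ := by rw [ENNReal.mul_inv_cancel (by simp) (by simp), one_mul, two_mul]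

/-- The reverse Hölder inequality, with an exponent that depends linearly on `1 / K`. -/
theorem reverse_holder (hd : 0 < d) {w : (Fin d → ℝ) → ℝ≥0∞}
    (hw : AEMeasurable w volume) {K : ℝ≥0}
    (hsq : ∀ R ∈ cubes d, ⨍⁻ x in R, w x ∂volume ≤ K * (⨍⁻ x in R, w x ^ (1 / 2 : ℝ) ∂volume) ^ 2)
    {Q : Set (Fin d → ℝ)} (hQ : Q ∈ cubes d) (hfin : ∫⁻ x in Q, w x ≠ ∞) {ε : ℝ} (hε : 0 < ε)
    (hεK : 16 * 2 ^ d * K * ε ≤ 1) :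
    ⨍⁻ x in Q, w x ^ (1 + ε) ∂volume ≤ 2 * (⨍⁻ x in Q, w x ∂volume) ^ (1 + ε) := by
  obtain ⟨a, ℓ, hℓ, rfl⟩ := hQ
  have hQm := measurableSet_cube a ℓ
  have hmono : Monotone fun k => maxFn volume (gridFamily a ℓ k) w := by
    refine fun k k' hk x => maxFn_le_iff.2 fun S hS hx => laverage_le_maxFn w ?_ hx
    obtain ⟨j, hj, m, hm, rfl⟩ := mem_gridFamily.1 hS
    exact mem_gridFamily.2 ⟨j, hj.trans hk, m, hm, rfl⟩
  -- By Lebesgue differentiation `w ≤ sup_k M_k` almost everywhere on the cube, so one factor of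
  -- `w^{1+ε}` may be kept and `w^ε` replaced by `M_k^ε`; monotone convergence does the rest.
  have hae : ∀ᵐ x ∂volume.restrict (cube a ℓ), w x ≤ ⨆ k, maxFn volume (gridFamily a ℓ k) w x := by
    rw [ae_restrict_iff' hQm]
    filter_upwards [ae_tendsto_laverage_gridCube a hℓ hw hfin] with x hx hxQ
    refine le_of_tendsto (hx hxQ) (Eventually.of_forall fun j => ?_)
    refine le_trans ?_ (le_iSup _ j)
    exact laverage_le_maxFn w (mem_gridFamily.2 ⟨j, le_rfl, _, gridIndex_lt hℓ j hxQ, rfl⟩)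
      (mem_gridCube_gridIndex hℓ j hxQ)
  have hmain : ∫⁻ x in cube a ℓ, w x ^ (1 + ε) ≤
      2 * ((⨍⁻ x in cube a ℓ, w x ∂volume) ^ ε * ∫⁻ x in cube a ℓ, w x) := by
    calc ∫⁻ x in cube a ℓ, w x ^ (1 + ε)
        ≤ ∫⁻ x in cube a ℓ, ⨆ k, w x * maxFn volume (gridFamily a ℓ k) w x ^ ε := by
          refine lintegral_mono_ae ?_
          filter_upwards [hae] with x hx
          rw [ENNReal.rpow_add_of_nonneg _ _ (by norm_num) hε.le, ENNReal.rpow_one,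
            ← ENNReal.mul_iSup]
          gcongr
          refine (ENNReal.rpow_le_rpow hx hε.le).trans ?_
          exact ((ENNReal.orderIsoRpow ε hε).map_iSup _).le
      _ = ⨆ k, ∫⁻ x in cube a ℓ, w x * maxFn volume (gridFamily a ℓ k) w x ^ ε := by
          refine lintegral_iSup' (fun k => ?_) (Eventually.of_forall fun x k k' hk => ?_)
          · exact hw.restrict.mul
              ((measurable_maxFn (isLaminar_gridFamily a hℓ k) w).pow_const _).aemeasurable
          · exact mul_le_mul' le_rfl (ENNReal.rpow_le_rpow (hmono hk x) hε.le)
      _ ≤ _ := iSup_le fun k => maxFn_gridFamily_rpow_le hd hw hsq hℓ hfin hε hεK k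
  rw [setLAverage_eq]
  calc _ ≤ (2 * ((⨍⁻ x in cube a ℓ, w x ∂volume) ^ ε * ∫⁻ x in cube a ℓ, w x)) /
        volume (cube a ℓ) := by gcongr
    _ = 2 * ((⨍⁻ x in cube a ℓ, w x ∂volume) ^ ε * ⨍⁻ x in cube a ℓ, w x ∂volume) := by
        rw [setLAverage_eq volume w]
        simp only [div_eq_mul_inv]; ring
    _ = _ := by
        rw [ENNReal.rpow_add_of_nonneg _ _ (by norm_num) hε.le, ENNReal.rpow_one, mul_comm (_ ^ ε)]

end ReverseHolder

/-! ### Averages with a weight satisfying a reverse Hölder inequality -/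

section Bump

variable {d : ℕ}

theorem laverage_mul_rpow_le {Q : Set (Fin d → ℝ)} {a u v : ℝ} (ha : 0 < a) (hau : a < u)
    (huv : 1 / a = 1 / u + 1 / v) {f g : (Fin d → ℝ) → ℝ≥0∞} (hf : AEMeasurable f volume)
    (hg : AEMeasurable g volume) :
    (⨍⁻ x in Q, (f x * g x) ^ a ∂volume) ^ (1 / a) ≤
      (⨍⁻ x in Q, f x ^ u ∂volume) ^ (1 / u) * (⨍⁻ x in Q, g x ^ v ∂volume) ^ (1 / v) :=
  ENNReal.lintegral_Lp_mul_le_Lq_mul_Lr ha hau huv _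
    (hf.restrict.smul_measure _) (hg.restrict.smul_measure _)

/-- The exponent `κ < b` can be chosen so close to `b` that the weight is absorbed, with a loss
that is linear in `K`. -/
theorem exists_bump_exponent (hd : 0 < d) {a b m : ℝ} (ha : 1 ≤ a) (hab : a < b) (hm0 : 0 < m)
    (hm : 1 / a = 1 / m + 1 / b) :
    ∃ C : ℝ≥0, ∀ K : ℝ≥0, 1 ≤ K → ∃ κ : ℝ, 0 < κ ∧
      (∀ (𝒮 : Finset (Set (Fin d → ℝ))) (h : (Fin d → ℝ) → ℝ≥0∞),
        IsLaminar volume (𝒮 : Set (Set (Fin d → ℝ))) → AEMeasurable h volume →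
        ∫⁻ x, maxFn volume 𝒮 (fun y => h y ^ κ) x ^ (b / κ) ≤ C * K * ∫⁻ x, h x ^ b) ∧
      ∀ ω : (Fin d → ℝ) → ℝ≥0∞, AEMeasurable ω volume →
        (∀ R ∈ cubes d, ⨍⁻ x in R, ω x ^ m ∂volume ≤
          K * (⨍⁻ x in R, (ω x ^ m) ^ (1 / 2 : ℝ) ∂volume) ^ 2) →
        ∀ Q ∈ cubes d, ∫⁻ x in Q, ω x ^ m ≠ ∞ →
        ∀ h : (Fin d → ℝ) → ℝ≥0∞, AEMeasurable h volume →
        (⨍⁻ x in Q, (ω x * h x) ^ a ∂volume) ^ (1 / a) ≤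
          2 * (⨍⁻ x in Q, ω x ^ m ∂volume) ^ (1 / m) *
            (⨍⁻ x in Q, h x ^ κ ∂volume) ^ (1 / κ) := by
  have ha0 : 0 < a := by linarith
  have hb0 : 0 < b := by linarith
  have ham : a < m := by
    have : 1 / m < 1 / a := by rw [hm]; have : 0 < 1 / b := by positivity
                               linarith
    exact (one_div_lt_one_div hm0 ha0).1 this
  -- The factor `2 ^ b` bounds `2 ^ (b / κ)`, as `κ ≥ 1`. The other factor, times `K`, bounds the
  -- conjugate exponent of `b / κ`.
  refine ⟨Real.toNNReal (2 ^ b * (2 * m * (16 * 2 ^ d))), fun K hK => ?_⟩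
  have hK' : (1 : ℝ) ≤ K := by exact_mod_cast hK
  have hK0 : (0 : ℝ) < K := by linarith
  set ε : ℝ := 1 / (16 * 2 ^ d * K) with hε
  have hε0 : 0 < ε := by positivity
  have hε1 : ε ≤ 1 := by
    rw [hε, div_le_one (by positivity)]
    have : (1 : ℝ) ≤ 2 ^ d := one_le_pow₀ (by norm_num)
    nlinarith
  have hεK : 16 * 2 ^ d * K * ε ≤ 1 := by rw [hε]; field_simp; rfl
  have hmε : 1 / (m * (1 + ε)) < 1 / m := by
    apply one_div_lt_one_div_of_lt hm0; nlinarith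
  have hmε0 : 0 < 1 / (m * (1 + ε)) := by positivity
  -- Chosen so that Hölder applies with the improved exponent: `1/a = 1/(m(1+ε)) + 1/κ`. For `ε = 0`
  -- this would be `κ = b`.
  set κ : ℝ := 1 / (1 / a - 1 / (m * (1 + ε))) with hκ
  have hden : 1 / b < 1 / a - 1 / (m * (1 + ε)) := by linarith
  have hb1 : 0 < 1 / b := by positivity
  have hκ0 : 0 < κ := by rw [hκ]; exact one_div_pos.2 (by linarith)
  have hκinv : 1 / κ = 1 / a - 1 / (m * (1 + ε)) := by rw [hκ, one_div_one_div]
  have hκb : κ < b := by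
    rw [← one_div_lt_one_div hb0 hκ0, hκinv]; exact hden
  have hκa : a ≤ κ := by
    rw [← one_div_le_one_div hκ0 ha0, hκinv]; linarith
  refine ⟨κ, hκ0, fun 𝒮 h h𝒮 hh => ?_, fun ω hω hsq Q hQ hfin h hh => ?_⟩
  · have hβ : 1 < b / κ := by rwa [one_lt_div hκ0]
    have := h𝒮.strong_type (hh.pow_const κ) hβ
    refine this.trans ?_
    have h1 : ∀ x, (h x ^ κ) ^ (b / κ) = h x ^ b := fun x => by
      rw [← ENNReal.rpow_mul]; congr 1; field_simp
    simp only [h1]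
    gcongr
    rw [ENNReal.ofReal, ← ENNReal.coe_mul]
    norm_cast
    rw [Real.toNNReal_le_iff_le_coe, NNReal.coe_mul, Real.coe_toNNReal _ (by positivity)]
    have h2 : b / κ / (b / κ - 1) = 1 / (1 - κ / b) := by
      field_simp
    have h3 : 1 - κ / b = κ * (ε / (m * (1 + ε))) := by
      have h5 : 1 / b = 1 / a - 1 / m := by linarith
      calc 1 - κ / b = κ * (1 / κ - 1 / b) := by field_simp
        _ = κ * (1 / m - 1 / (m * (1 + ε))) := by rw [hκinv, h5]; ring
        _ = _ := by field_simp; ring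
    -- Here `κ ≥ a ≥ 1` and `1 + ε ≤ 2` enter.
    have h4 : 1 / (2 * m * (16 * 2 ^ d) * K) ≤ 1 - κ / b := by
      rw [h3]
      calc 1 / (2 * m * (16 * 2 ^ d) * K) = 1 * (ε / (m * 2)) := by rw [hε]; field_simp
        _ ≤ _ := by gcongr <;> linarith
    rw [h2, mul_assoc (2 ^ b)]
    have h6 : 1 / (1 - κ / b) ≤ 2 * m * (16 * 2 ^ d) * K := by
      rw [one_div_le (by rw [h3]; positivity) (by positivity)]; exact h4
    have h7 : (2 : ℝ) ^ (b / κ) ≤ 2 ^ b := by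
      refine Real.rpow_le_rpow_of_exponent_le (by norm_num) ?_
      rw [div_le_iff₀ hκ0]; nlinarith
    push_cast
    refine mul_le_mul h7 h6 ?_ (by positivity)
    rw [h3]; positivity
  · have hrh := reverse_holder hd (hω.pow_const m) hsq hQ hfin hε0 hεK
    have h1 : ∀ x, (ω x ^ m) ^ (1 + ε) = ω x ^ (m * (1 + ε)) := fun x => by
      rw [← ENNReal.rpow_mul]
    simp only [h1] at hrh
    have hmm : m < m * (1 + ε) := by nlinarith
    refine (laverage_mul_rpow_le ha0 (ham.trans hmm) (v := κ) (by rw [hκinv]; ring) hω hh).trans ?_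
    gcongr
    calc _ ≤ (2 * (⨍⁻ x in Q, ω x ^ m ∂volume) ^ (1 + ε)) ^ (1 / (m * (1 + ε))) := by gcongr
      _ = 2 ^ (1 / (m * (1 + ε))) * (⨍⁻ x in Q, ω x ^ m ∂volume) ^ (1 / m) := by
          rw [ENNReal.mul_rpow_of_nonneg _ _ hmε0.le, ← ENNReal.rpow_mul]
          congr 2
          field_simp
      _ ≤ 2 ^ (1 : ℝ) * (⨍⁻ x in Q, ω x ^ m ∂volume) ^ (1 / m) := by
          gcongr
          · norm_num
          · rw [div_le_one (by positivity)]; nlinarith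
      _ = _ := by rw [ENNReal.rpow_one]

end Bump

/-! ### Powers of positive definite matrices -/

section MatPow

open Filter Topology Matrix

variable {n : ℕ}

/-- All facts about matrix powers below are read off from this spectral sum. -/
theorem cfc_apply_eq_sum {A : Matrix (Fin n) (Fin n) ℝ} (hA : A.IsHermitian) (f : ℝ → ℝ)
    (i j : Fin n) : cfc f A i j =
      ∑ k, f (hA.eigenvalues k) * (hA.eigenvectorBasis k i * hA.eigenvectorBasis k j) := by
  rw [hA.cfc_eq, IsHermitian.cfc, Unitary.conjStarAlgAut_apply, Matrix.mul_apply]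
  refine Finset.sum_congr rfl fun k _ => ?_
  rw [Matrix.mul_diagonal, Matrix.star_apply, IsHermitian.eigenvectorUnitary_apply,
    IsHermitian.eigenvectorUnitary_apply]
  simp
  ring

theorem cfc_mul_cfc {A : Matrix (Fin n) (Fin n) ℝ} (hA : A.IsHermitian) (f g : ℝ → ℝ) :
    cfc f A * cfc g A = cfc (fun x => f x * g x) A := by
  rw [hA.cfc_eq, hA.cfc_eq, hA.cfc_eq, IsHermitian.cfc, IsHermitian.cfc, IsHermitian.cfc,
    ← map_mul, diagonal_mul_diagonal]
  rfl

theorem matPow_mul_matPow {A : Matrix (Fin n) (Fin n) ℝ} (hA : A.PosDef) (α β : ℝ) :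
    matPow A α * matPow A β = matPow A (α + β) := by
  ext i j
  rw [matPow, matPow, matPow, cfc_mul_cfc hA.1, cfc_apply_eq_sum hA.1, cfc_apply_eq_sum hA.1]
  refine Finset.sum_congr rfl fun k _ => ?_
  rw [Real.rpow_add (hA.eigenvalues_pos k)]

theorem matPow_zero {A : Matrix (Fin n) (Fin n) ℝ} (hA : A.PosDef) : matPow A 0 = 1 := by
  rw [matPow, hA.1.cfc_eq, IsHermitian.cfc]
  have : (RCLike.ofReal ∘ (fun x : ℝ => x ^ (0 : ℝ)) ∘ hA.1.eigenvalues : Fin n → ℝ) = 1 := by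
    ext k; simp
  rw [this]
  simp

theorem matPow_neg_mul_matPow {A : Matrix (Fin n) (Fin n) ℝ} (hA : A.PosDef) (α : ℝ) :
    matPow A (-α) * matPow A α = 1 := by
  rw [matPow_mul_matPow hA, neg_add_cancel, matPow_zero hA]

theorem matPow_symm {A : Matrix (Fin n) (Fin n) ℝ} (hA : A.PosDef) (α : ℝ) (i j : Fin n) :
    matPow A α i j = matPow A α j i := by
  rw [matPow, cfc_apply_eq_sum hA.1, cfc_apply_eq_sum hA.1]
  refine Finset.sum_congr rfl fun k _ => ?_
  ring

theorem toEuclideanCLM_apply_apply (M : Matrix (Fin n) (Fin n) ℝ) (e : EuclideanSpace ℝ (Fin n))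
    (i : Fin n) : toEuclideanCLM (n := Fin n) (𝕜 := ℝ) M e i = ∑ j, M i j * e j := by
  have := toEuclideanCLM_toLp (𝕜 := ℝ) M e.ofLp
  rw [WithLp.toLp_ofLp] at this
  rw [this]
  rfl

theorem toEuclideanCLM_matPow {A : Matrix (Fin n) (Fin n) ℝ} (hA : A.PosDef) (α : ℝ)
    (e : EuclideanSpace ℝ (Fin n)) : toEuclideanCLM (n := Fin n) (𝕜 := ℝ) (matPow A α) e =
      ∑ k, (hA.1.eigenvalues k ^ α * inner ℝ (hA.1.eigenvectorBasis k) e) •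
        hA.1.eigenvectorBasis k := by
  ext i
  rw [toEuclideanCLM_apply_apply]
  simp only [matPow, cfc_apply_eq_sum hA.1, Finset.sum_mul, WithLp.ofLp_sum, WithLp.ofLp_smul,
    Finset.sum_apply, Pi.smul_apply, smul_eq_mul]
  rw [Finset.sum_comm]
  refine Finset.sum_congr rfl fun k _ => ?_
  rw [PiLp.inner_apply, Finset.mul_sum, Finset.sum_mul]
  refine Finset.sum_congr rfl fun j _ => ?_
  simp
  ring

theorem norm_matPow_sq {A : Matrix (Fin n) (Fin n) ℝ} (hA : A.PosDef) (α : ℝ)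
    (e : EuclideanSpace ℝ (Fin n)) : ‖toEuclideanCLM (n := Fin n) (𝕜 := ℝ) (matPow A α) e‖ ^ 2 =
      ∑ k, (hA.1.eigenvalues k ^ α) ^ 2 * inner ℝ (hA.1.eigenvectorBasis k) e ^ 2 := by
  rw [toEuclideanCLM_matPow hA, ← real_inner_self_eq_norm_sq,
    hA.1.eigenvectorBasis.orthonormal.inner_sum]
  refine Finset.sum_congr rfl fun k _ => ?_
  simp
  ring

/-- Hölder's inequality in the eigenbasis. -/
theorem normMulVec_matPow_mul_le {A : Matrix (Fin n) (Fin n) ℝ} (hA : A.PosDef) (α : ℝ) {θ : ℝ}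
    (hθ0 : 0 < θ) (hθ : θ ≤ 1) {e : EuclideanSpace ℝ (Fin n)} (he : ‖e‖ = 1) :
    normMulVec (matPow A (α * θ)) e ≤ normMulVec (matPow A α) e ^ θ := by
  have key : ‖toEuclideanCLM (n := Fin n) (𝕜 := ℝ) (matPow A (α * θ)) e‖ ≤
      ‖toEuclideanCLM (n := Fin n) (𝕜 := ℝ) (matPow A α) e‖ ^ θ := by
    have hnn := norm_nonneg (toEuclideanCLM (n := Fin n) (𝕜 := ℝ) (matPow A α) e)
    rw [← sq_le_sq₀ (norm_nonneg _) (Real.rpow_nonneg hnn _), ← Real.rpow_mul_natCast hnn,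
      mul_comm θ, Real.rpow_natCast_mul hnn, norm_matPow_sq hA, norm_matPow_sq hA]
    have hw : ∑ k, inner ℝ (hA.1.eigenvectorBasis k) e ^ 2 = 1 := by
      rw [hA.1.eigenvectorBasis.sum_sq_inner_right, he, one_pow]
    -- The squared coordinates of a unit vector are probability weights, so this is Jensen for the
    -- concave function `x ↦ x ^ θ`.
    have hc := (Real.concaveOn_rpow hθ0.le hθ).le_map_sum (t := Finset.univ)
      (w := fun k => inner ℝ (hA.1.eigenvectorBasis k) e ^ 2)
      (p := fun k => (hA.1.eigenvalues k ^ α) ^ 2) (fun _ _ => sq_nonneg _) hw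
      (fun _ _ => Set.mem_Ici.2 (sq_nonneg _))
    simp only [smul_eq_mul] at hc
    calc _ = ∑ k, inner ℝ (hA.1.eigenvectorBasis k) e ^ 2 *
          ((hA.1.eigenvalues k ^ α) ^ 2) ^ θ := by
          refine Finset.sum_congr rfl fun k _ => ?_
          have hk := (hA.eigenvalues_pos k).le
          rw [mul_comm, Real.rpow_mul hk, ← Real.rpow_natCast_mul (Real.rpow_nonneg hk _),
            ← Real.rpow_mul_natCast (Real.rpow_nonneg hk _), mul_comm θ]
      _ ≤ _ := hc
      _ = _ := by simp only [mul_comm]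
  rw [normMulVec, normMulVec, ← ofReal_norm, ← ofReal_norm,
    ENNReal.ofReal_rpow_of_nonneg (norm_nonneg _) hθ0.le]
  exact ENNReal.ofReal_le_ofReal key

theorem normMulVec_ne_top (M : Matrix (Fin n) (Fin n) ℝ) (e : EuclideanSpace ℝ (Fin n)) :
    normMulVec M e ≠ ∞ := enorm_ne_top

theorem normMulVec_mul_le (M N : Matrix (Fin n) (Fin n) ℝ) (e : EuclideanSpace ℝ (Fin n)) :
    normMulVec (M * N) e ≤ opNorm M * normMulVec N e := by
  have h : toEuclideanCLM (n := Fin n) (𝕜 := ℝ) (M * N) e = toEuclideanCLM (n := Fin n) (𝕜 := ℝ) M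
      (toEuclideanCLM (n := Fin n) (𝕜 := ℝ) N e) := by rw [map_mul]; rfl
  rw [normMulVec, h]
  exact ContinuousLinearMap.le_opENorm (toEuclideanCLM (n := Fin n) (𝕜 := ℝ) M)
    (toEuclideanCLM (n := Fin n) (𝕜 := ℝ) N e)

theorem normMulVec_le_opNorm_mul {A : Matrix (Fin n) (Fin n) ℝ} (hA : A.PosDef) (α : ℝ)
    (M : Matrix (Fin n) (Fin n) ℝ) (e : EuclideanSpace ℝ (Fin n)) :
    normMulVec M e ≤ opNorm (M * matPow A (-α)) * normMulVec (matPow A α) e := by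
  conv_lhs => rw [← mul_one M, ← matPow_neg_mul_matPow hA α, ← mul_assoc]
  exact normMulVec_mul_le _ _ _

theorem normMulVec_one (e : EuclideanSpace ℝ (Fin n)) : normMulVec 1 e = ‖e‖ₑ := by
  rw [normMulVec, map_one]; rfl

theorem normMulVec_matPow_ne_zero {A : Matrix (Fin n) (Fin n) ℝ} (hA : A.PosDef) (α : ℝ)
    {e : EuclideanSpace ℝ (Fin n)} (he : e ≠ 0) : normMulVec (matPow A α) e ≠ 0 := by
  intro h
  have := normMulVec_le_opNorm_mul hA α 1 e
  rw [h, mul_zero, normMulVec_one, nonpos_iff_eq_zero, enorm_eq_zero] at this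
  exact he this

theorem normMulVec_eq_norm_sq (M : Matrix (Fin n) (Fin n) ℝ) (e : EuclideanSpace ℝ (Fin n)) :
    normMulVec M e = ENNReal.ofReal √(∑ i, (∑ j, M i j * e j) ^ 2) := by
  rw [normMulVec, ← ofReal_norm, EuclideanSpace.norm_eq]
  simp only [toEuclideanCLM_apply_apply, Real.norm_eq_abs, sq_abs]

/-! ### Measurability -/

/-- Weierstrass approximation on `[1/(m+1), m+1]` with error `1/(m+1)`. It makes `x ↦ W(x)^α` a
pointwise limit of polynomials in `W(x)`, so its measurability needs no measurable choice of
eigenvectors. -/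
theorem exists_polynomial_seq (α : ℝ) : ∃ P : ℕ → Polynomial ℝ, ∀ x : ℝ, 0 < x →
    Tendsto (fun m => (P m).eval x) atTop (𝓝 (x ^ α)) := by
  have hex : ∀ m : ℕ, ∃ P : Polynomial ℝ, ∀ x ∈ Set.Icc (1 / ((m : ℝ) + 1)) (m + 1),
      |P.eval x - x ^ α| < 1 / ((m : ℝ) + 1) := fun m =>
    exists_polynomial_near_of_continuousOn _ _ (fun x => x ^ α) (fun x hx => by
      refine (Real.continuousAt_rpow_const x α (Or.inl ?_)).continuousWithinAt
      have : 0 < 1 / ((m : ℝ) + 1) := by positivity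
      exact (this.trans_le hx.1).ne') _ (by positivity)
  choose P hP using hex
  refine ⟨P, fun x hx => tendsto_iff_dist_tendsto_zero.2 ?_⟩
  have h1 := tendsto_one_div_add_atTop_nhds_zero_nat (𝕜 := ℝ)
  refine squeeze_zero' (Eventually.of_forall fun _ => dist_nonneg) ?_ h1
  filter_upwards [h1.eventually (gt_mem_nhds hx), eventually_ge_atTop ⌈x⌉₊] with m hm hm'
  rw [Real.dist_eq]
  refine (hP m x ⟨hm.le, ?_⟩).le
  have := Nat.le_of_ceil_le hm'
  linarith

theorem aemeasurable_matPow {X : Type*} [MeasurableSpace X] {μ : Measure X}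
    {W : X → Matrix (Fin n) (Fin n) ℝ} (hW : ∀ i j, AEMeasurable (fun x => W x i j) μ)
    (hpos : ∀ᵐ x ∂μ, (W x).PosDef) (α : ℝ) (i j : Fin n) :
    AEMeasurable (fun x => matPow (W x) α i j) μ := by
  obtain ⟨P, hP⟩ := exists_polynomial_seq α
  have hW' : AEMeasurable (fun x => (fun i j => W x i j : Fin n → Fin n → ℝ)) μ :=
    aemeasurable_pi_lambda _ fun i => aemeasurable_pi_lambda _ fun j => hW i j
  have hm : ∀ m, AEMeasurable (fun x => (Polynomial.aeval (W x)) (P m) i j) μ := by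
    intro m
    have hc : Continuous fun A : Fin n → Fin n → ℝ =>
        (Polynomial.aeval (Matrix.of A)) (P m) i j := by
      have h1 : Continuous fun A : Matrix (Fin n) (Fin n) ℝ => (Polynomial.aeval A) (P m) :=
        Polynomial.continuous_aeval _
      exact (h1.matrix_elem i j)
    exact hc.measurable.comp_aemeasurable hW'
  refine aemeasurable_of_tendsto_metrizable_ae atTop hm ?_
  filter_upwards [hpos] with x hx
  have e1 : ∀ m, (Polynomial.aeval (W x)) (P m) i j =
      ∑ k, (P m).eval (hx.1.eigenvalues k) *
        (hx.1.eigenvectorBasis k i * hx.1.eigenvectorBasis k j) := fun m => by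
    rw [← cfc_apply_eq_sum hx.1 (fun y => (P m).eval y)]
    exact congrFun (congrFun (cfc_polynomial (P m) (W x) hx.1).symm i) j
  simp only [e1, matPow, cfc_apply_eq_sum hx.1]
  exact tendsto_finsetSum _ fun k _ => (hP _ (hx.eigenvalues_pos k)).mul_const _

theorem aemeasurable_normMulVec {X : Type*} [MeasurableSpace X] {μ : Measure X}
    {M : X → Matrix (Fin n) (Fin n) ℝ} (hM : ∀ i j, AEMeasurable (fun x => M x i j) μ)
    (e : EuclideanSpace ℝ (Fin n)) : AEMeasurable (fun x => normMulVec (M x) e) μ := by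
  simp only [normMulVec_eq_norm_sq]
  refine ENNReal.measurable_ofReal.comp_aemeasurable (Real.continuous_sqrt.measurable.comp_aemeasurable ?_)
  exact Finset.aemeasurable_fun_sum _ fun i _ => (Finset.aemeasurable_fun_sum _ fun j _ =>
    (hM i j).mul_const _).pow_const 2

/-! ### Vectors with entries in a Banach space -/

section Vector

variable {B : Type*} [NormedAddCommGroup B] [NormedSpace ℝ B]

theorem norm_sum_smul_le (c : EuclideanSpace ℝ (Fin n)) (v : PiLp 2 fun _ : Fin n => B) :
    ‖∑ j, c j • v j‖ ≤ ‖c‖ * ‖v‖ := by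
  calc ‖∑ j, c j • v j‖ ≤ ∑ j, ‖c j‖ * ‖v j‖ := by
        refine (norm_sum_le _ _).trans (Finset.sum_le_sum fun j _ => ?_)
        rw [norm_smul]
    _ ≤ √(∑ j, ‖c j‖ ^ 2) * √(∑ j, ‖v j‖ ^ 2) := Real.sum_mul_le_sqrt_mul_sqrt _ _ _
    _ = _ := by rw [EuclideanSpace.norm_eq, PiLp.norm_eq_of_L2]

/-- This is `e · v = (A^{-α} e) · (A^α v)`, by the symmetry of `A^{-α}`. -/
theorem sum_smul_eq_matPow {A : Matrix (Fin n) (Fin n) ℝ} (hA : A.PosDef) (α : ℝ)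
    (e : EuclideanSpace ℝ (Fin n)) (v : Fin n → B) :
    ∑ j, e j • v j =
      ∑ j, toEuclideanCLM (n := Fin n) (𝕜 := ℝ) (matPow A (-α)) e j • matAct (matPow A α) v j := by
  simp only [toEuclideanCLM_apply_apply, matAct, Finset.sum_smul, Finset.smul_sum]
  rw [Finset.sum_comm]
  refine Finset.sum_congr rfl fun k _ => ?_
  rw [Finset.sum_comm]
  have h1 : ∀ l, ∑ j, (matPow A (-α) j l * e l) • matPow A α j k • v k =
      ((1 : Matrix (Fin n) (Fin n) ℝ) l k * e l) • v k := fun l => by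
    rw [← matPow_neg_mul_matPow hA α, Matrix.mul_apply, Finset.sum_mul, Finset.sum_smul]
    refine Finset.sum_congr rfl fun j _ => ?_
    rw [smul_smul, matPow_symm hA (-α) l j]
    congr 1; ring
  rw [Finset.sum_congr rfl fun l _ => h1 l, Finset.sum_eq_single k]
  · simp
  · intro l _ hl; simp [Matrix.one_apply_ne hl]
  · simp

theorem enorm_sum_smul_le {A : Matrix (Fin n) (Fin n) ℝ} (hA : A.PosDef) (α : ℝ)
    (e : EuclideanSpace ℝ (Fin n)) (v : Fin n → B) :
    ‖∑ j, e j • v j‖ₑ ≤ normMulVec (matPow A (-α)) e * ‖matAct (matPow A α) v‖ₑ := by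
  rw [sum_smul_eq_matPow hA α, normMulVec, ← ofReal_norm, ← ofReal_norm,
    ← ofReal_norm, ← ENNReal.ofReal_mul (norm_nonneg _)]
  exact ENNReal.ofReal_le_ofReal (norm_sum_smul_le _ _)

end Vector

end MatPow

/-! ### Orthonormal bases adapted to a seminorm -/

section Basis

/-- Let `e` minimize `ρ` on the unit sphere; then `|⟨e, z⟩| ρ(e) ≤ ρ(e) ‖z‖ ≤ ρ(z)`. Consequently
removing the `e`-component at most doubles `ρ`, and induction on the orthogonal complement of `e`
costs one factor `2` per dimension. -/
theorem exists_orthonormal_of_seminorm (n : ℕ) : ∀ {E : Type*} [NormedAddCommGroup E]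
    [InnerProductSpace ℝ E] [FiniteDimensional ℝ E], Module.finrank ℝ E = n →
    ∀ ρ : Seminorm ℝ E, Continuous ρ → ∃ v : Fin n → E, Orthonormal ℝ v ∧
      ∀ i z, |inner ℝ (v i) z| * ρ (v i) ≤ 2 ^ n * ρ z := by
  induction n with
  | zero =>
    intro E _ _ _ _ ρ _
    exact ⟨Fin.elim0, ⟨fun i => i.elim0, fun i => i.elim0⟩, fun i => i.elim0⟩
  | succ n ih =>
    intro E _ _ _ hE ρ hρ
    have hnt : Nontrivial E := Module.nontrivial_of_finrank_pos (R := ℝ) (by omega)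
    obtain ⟨e, he, hmin⟩ := (isCompact_sphere (0 : E) 1).exists_isMinOn
      (NormedSpace.sphere_nonempty.2 zero_le_one) hρ.continuousOn
    have he1 : ‖e‖ = 1 := by simpa using he
    have hmin' : ∀ z, ρ e * ‖z‖ ≤ ρ z := by
      intro z
      rcases eq_or_ne z 0 with rfl | hz
      · simp
      have hz' : 0 < ‖z‖ := norm_pos_iff.2 hz
      have h1 : (‖z‖⁻¹ • z) ∈ Metric.sphere (0 : E) 1 := by
        simp [norm_smul, hz'.ne']
      have h2 : ρ e ≤ ρ (‖z‖⁻¹ • z) := hmin h1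
      rw [map_smul_eq_mul, norm_inv, norm_norm, ← div_eq_inv_mul, le_div_iff₀ hz'] at h2
      exact h2
    have hF : Module.finrank ℝ (ℝ ∙ e)ᗮ = n := by
      have := Fact.mk hE
      exact Submodule.finrank_orthogonal_span_singleton (by
        rintro rfl; simp at he1)
    obtain ⟨v, hv, hvρ⟩ := ih hF (ρ.comp (ℝ ∙ e)ᗮ.subtype) (hρ.comp continuous_subtype_val)
    have hev : ∀ x : (ℝ ∙ e)ᗮ, inner ℝ e (x : E) = 0 := fun x =>
      Submodule.mem_orthogonal_singleton_iff_inner_right.1 x.2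
    refine ⟨Fin.cons e fun i => (v i : E), ?_, ?_⟩
    · rw [orthonormal_iff_ite]
      rw [orthonormal_iff_ite] at hv
      refine Fin.cases (Fin.cases ?_ fun j => ?_) fun i => Fin.cases ?_ fun j => ?_
      · simp [he1]
      · simp [hev, (Fin.succ_ne_zero _).symm]
      · rw [Fin.cons_zero, Fin.cons_succ, real_inner_comm, hev, if_neg (Fin.succ_ne_zero _)]
      · rw [Fin.cons_succ, Fin.cons_succ]
        simpa using hv i j
    · have hz : ∀ z, |inner ℝ e z| * ρ e ≤ ρ z := fun z => by
        refine le_trans ?_ (hmin' z)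
        rw [mul_comm]
        gcongr
        simpa [he1] using abs_real_inner_le_norm e z
      refine fun i z => Fin.cases ?_ (fun i => ?_) i
      · rw [Fin.cons_zero]
        refine (hz z).trans (le_mul_of_one_le_left (apply_nonneg ρ z) ?_)
        exact one_le_pow₀ (by norm_num)
      · rw [Fin.cons_succ]
        set c := inner ℝ e z with hc
        have hw : z - c • e ∈ (ℝ ∙ e)ᗮ := by
          rw [Submodule.mem_orthogonal_singleton_iff_inner_right, inner_sub_right, inner_smul_right,
            real_inner_self_eq_norm_sq, he1]
          simp [hc]
        have h1 := hvρ i ⟨z - c • e, hw⟩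
        have h2 : inner ℝ (v i) ⟨z - c • e, hw⟩ = inner ℝ (v i : E) z := by
          rw [Submodule.coe_inner, inner_sub_right, inner_smul_right, real_inner_comm e, hev]
          simp
        rw [h2] at h1
        simp only [Seminorm.comp_apply, Submodule.coe_subtype] at h1
        refine h1.trans ?_
        have h3 : ρ (z - c • e) ≤ 2 * ρ z := by
          calc ρ (z - c • e) ≤ ρ z + ρ (c • e) := map_sub_le_add ρ _ _
            _ = ρ z + |c| * ρ e := by rw [map_smul_eq_mul, Real.norm_eq_abs]
            _ ≤ _ := by linarith [hz z]
        rw [pow_succ, mul_assoc]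
        gcongr

theorem exists_orthonormalBasis_of_enorm {n : ℕ} (N : EuclideanSpace ℝ (Fin n) → ℝ≥0∞)
    (htop : ∀ z, N z ≠ ∞) (hadd : ∀ z z', N (z + z') ≤ N z + N z')
    (hsmul : ∀ (c : ℝ) z, N (c • z) = ‖c‖ₑ * N z) :
    ∃ e : OrthonormalBasis (Fin n) ℝ (EuclideanSpace ℝ (Fin n)),
      ∀ i z, ‖inner ℝ (e i) z‖ₑ * N (e i) ≤ 2 ^ n * N z := by
  let ρ : Seminorm ℝ (EuclideanSpace ℝ (Fin n)) := Seminorm.of (fun z => (N z).toReal)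
    (fun z z' => by
      rw [← ENNReal.toReal_add (htop _) (htop _)]
      exact ENNReal.toReal_mono (ENNReal.add_ne_top.2 ⟨htop _, htop _⟩) (hadd z z'))
    (fun c z => by rw [hsmul, ENNReal.toReal_mul, toReal_enorm])
  -- A finite convex function on a finite-dimensional space is continuous.
  have hρ : Continuous ρ := by
    have := (ρ.convexOn.continuousOn isOpen_univ)
    exact continuousOn_univ.1 this
  obtain ⟨v, hv, h⟩ := exists_orthonormal_of_seminorm n (by simp) ρ hρ
  have hspan : ⊤ ≤ Submodule.span ℝ (Set.range v) :=
    (hv.linearIndependent.span_eq_top_of_card_eq_finrank' (by simp)).ge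
  refine ⟨OrthonormalBasis.mk hv hspan, fun i z => ?_⟩
  have hi := h i z
  simp only [OrthonormalBasis.coe_mk]
  rw [← ENNReal.toReal_le_toReal (ENNReal.mul_ne_top enorm_ne_top (htop _))
    (ENNReal.mul_ne_top (by simp) (htop _)), ENNReal.toReal_mul, ENNReal.toReal_mul, toReal_enorm,
    Real.norm_eq_abs]
  have h2 : ((2 : ℝ≥0∞) ^ n).toReal = 2 ^ n := by simp
  rw [h2]
  exact hi

end Basis

/-! ### Averages -/

section Average

variable {d : ℕ}

theorem laverage_eq_lintegral_avgMeasure (Q : Set (Fin d → ℝ)) (f : (Fin d → ℝ) → ℝ≥0∞) :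
    ⨍⁻ x in Q, f x ∂volume = ∫⁻ x, f x ∂avgMeasure Q := by
  rw [laverage, avgMeasure, ProbabilityTheory.cond, Measure.restrict_apply_univ]

theorem isProbabilityMeasure_avgMeasure {Q : Set (Fin d → ℝ)} (hQ : Q ∈ cubes d) :
    IsProbabilityMeasure (avgMeasure Q) := by
  obtain ⟨a, ℓ, hℓ, rfl⟩ := hQ
  exact ProbabilityTheory.cond_isProbabilityMeasure_of_finite (volume_cube_ne_zero a hℓ)
    (volume_cube_ne_top a ℓ)

theorem avgMeasure_absolutelyContinuous (Q : Set (Fin d → ℝ)) : avgMeasure Q ≪ volume :=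
  ProbabilityTheory.cond_absolutelyContinuous

theorem setLIntegral_ne_top_of_avg {Q : Set (Fin d → ℝ)} (hQ : Q ∈ cubes d)
    {f : (Fin d → ℝ) → ℝ≥0∞} (h : ∫⁻ x, f x ∂avgMeasure Q ≠ ∞) : ∫⁻ x in Q, f x ≠ ∞ := by
  obtain ⟨a, ℓ, hℓ, rfl⟩ := hQ
  rw [← laverage_eq_lintegral_avgMeasure, setLAverage_eq] at h
  intro h'
  rw [h', ENNReal.top_div_of_ne_top (volume_cube_ne_top a ℓ)] at h
  exact h rfl

variable {X : Type*} [MeasurableSpace X] {μ : Measure X} [IsProbabilityMeasure μ]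

/-- Hölder applied to `1 = v⁻¹ v`. It trades the negative moment in an `A_t` condition for an
arbitrarily small positive moment. -/
theorem one_le_lintegral_rpow_mul {v : X → ℝ≥0∞} (hv : AEMeasurable v μ)
    (h0 : ∀ᵐ x ∂μ, v x ≠ 0) (htop : ∀ᵐ x ∂μ, v x ≠ ∞) {α δ : ℝ} (hα : 0 < α) (hδ : 0 < δ) :
    1 ≤ (∫⁻ x, (v x)⁻¹ ^ α ∂μ) ^ (1 / α) * (∫⁻ x, v x ^ δ ∂μ) ^ (1 / δ) := by
  set p : ℝ := 1 / (1 / α + 1 / δ) with hp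
  have h1 : 0 < 1 / α := by positivity
  have h2 : 0 < 1 / δ := by positivity
  have hp0 : 0 < p := by positivity
  have hpα : p < α := by
    rw [hp, one_div_lt (by positivity) hα]; linarith
  refine le_trans (le_of_eq ?_) (ENNReal.lintegral_Lp_mul_le_Lq_mul_Lr hp0 hpα
    (by rw [hp, one_div_one_div]) μ hv.inv hv)
  rw [lintegral_congr_ae (g := fun _ => 1), lintegral_one, measure_univ, ENNReal.one_rpow]
  filter_upwards [h0, htop] with x hx hx'
  rw [Pi.mul_apply, ENNReal.inv_mul_cancel hx hx', ENNReal.one_rpow]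

/-- By Cauchy–Schwarz the square of the average of `w^{1/2}` is at most the average of `w`. This
supplies the condition `1 ≤ K` of `exists_bump_exponent`. -/
theorem one_le_of_sq_bound {w : X → ℝ≥0∞} (hw : AEMeasurable w μ) (h0 : ∫⁻ x, w x ∂μ ≠ 0)
    (htop : ∫⁻ x, w x ∂μ ≠ ∞) {K : ℝ≥0∞}
    (h : ∫⁻ x, w x ∂μ ≤ K * (∫⁻ x, w x ^ (1 / 2 : ℝ) ∂μ) ^ 2) : 1 ≤ K := by
  have h1 : ∫⁻ x, w x ^ (1 / 2 : ℝ) ∂μ ≤ (∫⁻ x, w x ∂μ) ^ (1 / 2 : ℝ) := by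
    have := ENNReal.lintegral_mul_le_Lp_mul_Lq μ Real.HolderConjugate.two_two
      (hw.pow_const (1 / 2 : ℝ)) (aemeasurable_const (b := (1 : ℝ≥0∞)))
    have h2 : ∀ x, (w x ^ (1 / 2 : ℝ)) ^ (2 : ℝ) = w x := fun x => by
      rw [← ENNReal.rpow_mul]; norm_num
    simp only [Pi.mul_apply, mul_one, h2, ENNReal.one_rpow, lintegral_one, measure_univ] at this
    exact this
  have h2 : (∫⁻ x, w x ^ (1 / 2 : ℝ) ∂μ) ^ 2 ≤ ∫⁻ x, w x ∂μ := by
    calc (∫⁻ x, w x ^ (1 / 2 : ℝ) ∂μ) ^ 2 ≤ ((∫⁻ x, w x ∂μ) ^ (1 / 2 : ℝ)) ^ 2 := by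
          gcongr
      _ = _ := by
          rw [← ENNReal.rpow_two, ← ENNReal.rpow_mul]; norm_num
  have h3 : 1 * ∫⁻ x, w x ∂μ ≤ K * ∫⁻ x, w x ∂μ := by
    rw [one_mul]; exact h.trans (by gcongr)
  exact (ENNReal.mul_le_mul_iff_left h0 htop).1 h3

end Average

/-! ### Scalar consequences of the matrix weight conditions -/

section Weights

open Filter Matrix

variable {d n : ℕ}

theorem opNorm_mul_comm {A B : Matrix (Fin n) (Fin n) ℝ} (hA : A.PosDef) (hB : B.PosDef)
    (α β : ℝ) : opNorm (matPow A α * matPow B β) = opNorm (matPow B β * matPow A α) := by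
  have hs : ∀ {A : Matrix (Fin n) (Fin n) ℝ}, A.PosDef → ∀ α, star (matPow A α) = matPow A α := by
    intro A hA α
    ext i j
    rw [Matrix.star_apply, star_trivial, matPow_symm hA]
  have h : star (matPow A α * matPow B β) = matPow B β * matPow A α := by
    rw [star_mul, hs hA, hs hB]
  rw [← h, opNorm, opNorm, map_star, ← ofReal_norm, ← ofReal_norm,
    ContinuousLinearMap.star_eq_adjoint, LinearIsometryEquiv.norm_map]

theorem lintegral_ne_zero_of_ae {X : Type*} [MeasurableSpace X] {μ : Measure X}
    [IsProbabilityMeasure μ] {f : X → ℝ≥0∞} (hf : AEMeasurable f μ) (h : ∀ᵐ x ∂μ, f x ≠ 0) :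
    ∫⁻ x, f x ∂μ ≠ 0 := by
  rw [Ne, lintegral_eq_zero_iff' hf]
  intro h0
  obtain ⟨x, hx, hx'⟩ := (h.and h0).exists
  exact hx hx'

variable {W : (Fin d → ℝ) → Matrix (Fin n) (Fin n) ℝ}

theorem IsMatrixWeight.aemeasurable_matPow (hW : IsMatrixWeight W) (α : ℝ) (i j : Fin n) :
    AEMeasurable (fun x => matPow (W x) α i j) volume :=
  ConvexBody.aemeasurable_matPow
    (fun i j => (hW.locallyIntegrable i j).aestronglyMeasurable.aemeasurable) hW.posDef α i j

theorem IsMatrixWeight.aemeasurable_normMulVec (hW : IsMatrixWeight W) (α : ℝ)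
    (e : EuclideanSpace ℝ (Fin n)) :
    AEMeasurable (fun x => normMulVec (matPow (W x) α) e) volume :=
  ConvexBody.aemeasurable_normMulVec (hW.aemeasurable_matPow α) e

theorem IsMatrixWeight.aemeasurable_normMulVec_avg (hW : IsMatrixWeight W) (α : ℝ)
    (e : EuclideanSpace ℝ (Fin n)) (Q : Set (Fin d → ℝ)) :
    AEMeasurable (fun x => normMulVec (matPow (W x) α) e) (avgMeasure Q) :=
  (hW.aemeasurable_normMulVec α e).mono_ac (avgMeasure_absolutelyContinuous Q)

theorem IsMatrixWeight.posDef_avg (hW : IsMatrixWeight W) (Q : Set (Fin d → ℝ)) :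
    ∀ᵐ x ∂avgMeasure Q, (W x).PosDef := (avgMeasure_absolutelyContinuous Q).ae_le hW.posDef

theorem IsMatrixWeight.normMulVec_ne_zero_avg (hW : IsMatrixWeight W) (α : ℝ)
    {e : EuclideanSpace ℝ (Fin n)} (he : e ≠ 0) (Q : Set (Fin d → ℝ)) :
    ∀ᵐ x ∂avgMeasure Q, normMulVec (matPow (W x) α) e ≠ 0 :=
  (hW.posDef_avg Q).mono fun _ hx => normMulVec_matPow_ne_zero hx α he

theorem IsMatrixWeight.lintegral_normMulVec_ne_zero (hW : IsMatrixWeight W) (α : ℝ)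
    {e : EuclideanSpace ℝ (Fin n)} (he : e ≠ 0) {Q : Set (Fin d → ℝ)} (hQ : Q ∈ cubes d) {β : ℝ}
    (hβ : 0 < β) : ∫⁻ x, normMulVec (matPow (W x) α) e ^ β ∂avgMeasure Q ≠ 0 := by
  have := isProbabilityMeasure_avgMeasure hQ
  refine lintegral_ne_zero_of_ae ((hW.aemeasurable_normMulVec_avg α e Q).pow_const β) ?_
  filter_upwards [hW.normMulVec_ne_zero_avg α he Q] with x hx
  rw [Ne, ENNReal.rpow_eq_zero_iff_of_pos hβ]
  exact hx

theorem IsMatrixWeight.lintegral_inv_normMulVec_ne_zero (hW : IsMatrixWeight W) (α : ℝ)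
    (e : EuclideanSpace ℝ (Fin n)) {Q : Set (Fin d → ℝ)} (hQ : Q ∈ cubes d) {β : ℝ}
    (hβ : 0 < β) : ∫⁻ x, (normMulVec (matPow (W x) α) e)⁻¹ ^ β ∂avgMeasure Q ≠ 0 := by
  have := isProbabilityMeasure_avgMeasure hQ
  refine lintegral_ne_zero_of_ae ((hW.aemeasurable_normMulVec_avg α e Q).inv.pow_const β) ?_
  refine Eventually.of_forall fun x => ?_
  rw [Ne, ENNReal.rpow_eq_zero_iff_of_pos hβ, ENNReal.inv_eq_zero]
  exact normMulVec_ne_top _ _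

theorem lintegral_le_ApConst (W : (Fin d → ℝ) → Matrix (Fin n) (Fin n) ℝ) (t : ℝ)
    {Q : Set (Fin d → ℝ)} (hQ : Q ∈ cubes d) :
    ∫⁻ x, (∫⁻ y, opNorm (matPow (W x) (1 / t) * matPow (W y) (-(1 / t))) ^ t.conjExponent
      ∂avgMeasure Q) ^ (t / t.conjExponent) ∂avgMeasure Q ≤ ApConst W t := by
  simp only [← laverage_eq_lintegral_avgMeasure]
  exact le_iSup₂ (f := fun Q (_ : Q ∈ cubes d) => ⨍⁻ x in Q, (⨍⁻ y in Q,
    opNorm (matPow (W x) (1 / t) * matPow (W y) (-(1 / t))) ^ t.conjExponent ∂volume)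
      ^ (t / t.conjExponent) ∂volume) Q hQ

variable {t : ℝ}

/-- The scalar `A_t` condition for `|W^{1/t} e|^t`. It follows by integrating `|W^{1/t}(x) e| /
|W^{1/t}(y) e| ≤ |W^{1/t}(x) W^{-1/t}(y)|_op`. -/
theorem IsMatrixWeight.direct_bound (hW : IsMatrixWeight W) (ht : 1 < t) {Q : Set (Fin d → ℝ)}
    (hQ : Q ∈ cubes d) (e : EuclideanSpace ℝ (Fin n)) :
    (∫⁻ x, normMulVec (matPow (W x) (1 / t)) e ^ t ∂avgMeasure Q) *
      (∫⁻ y, (normMulVec (matPow (W y) (1 / t)) e)⁻¹ ^ t.conjExponent ∂avgMeasure Q) ^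
        (t / t.conjExponent) ≤ ApConst W t := by
  have hc := Real.HolderConjugate.conjExponent ht
  have ht' := hc.symm.pos
  have ht0 := hc.pos
  refine (lintegral_mul_const_le _ _).trans ((lintegral_mono fun x => ?_).trans
    (lintegral_le_ApConst W t hQ))
  simp only
  have h1 : normMulVec (matPow (W x) (1 / t)) e ^ t =
      (normMulVec (matPow (W x) (1 / t)) e ^ t.conjExponent) ^ (t / t.conjExponent) := by
    rw [← ENNReal.rpow_mul]; congr 1; field_simp
  rw [h1, ← ENNReal.mul_rpow_of_nonneg _ _ (by positivity)]
  refine ENNReal.rpow_le_rpow ?_ (by positivity)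
  refine (lintegral_const_mul_le _ _).trans (lintegral_mono_ae ?_)
  filter_upwards [hW.posDef_avg Q] with y hy
  rw [← ENNReal.mul_rpow_of_nonneg _ _ ht'.le]
  refine ENNReal.rpow_le_rpow (ENNReal.div_le_of_le_mul ?_) ht'.le
  exact normMulVec_le_opNorm_mul hy _ _ _

/-- The same argument for `W^{-1/t}`; passing to the adjoint exchanges the roles of `x` and `y` in
the operator norm. -/
theorem IsMatrixWeight.dual_bound (hW : IsMatrixWeight W) (ht : 1 < t) {Q : Set (Fin d → ℝ)}
    (hQ : Q ∈ cubes d) (e : EuclideanSpace ℝ (Fin n)) :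
    (∫⁻ y, normMulVec (matPow (W y) (-(1 / t))) e ^ t.conjExponent ∂avgMeasure Q) ^
        (t / t.conjExponent) *
      ∫⁻ x, (normMulVec (matPow (W x) (-(1 / t))) e)⁻¹ ^ t ∂avgMeasure Q ≤ ApConst W t := by
  have hc := Real.HolderConjugate.conjExponent ht
  have ht' := hc.symm.pos
  have ht0 := hc.pos
  refine (lintegral_const_mul_le _ _).trans ((lintegral_mono_ae ?_).trans
    (lintegral_le_ApConst W t hQ))
  filter_upwards [hW.posDef_avg Q] with x hx
  have h1 : (normMulVec (matPow (W x) (-(1 / t))) e)⁻¹ ^ t =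
      ((normMulVec (matPow (W x) (-(1 / t))) e)⁻¹ ^ t.conjExponent) ^ (t / t.conjExponent) := by
    rw [← ENNReal.rpow_mul]; congr 1; field_simp
  rw [h1, ← ENNReal.mul_rpow_of_nonneg _ _ (by positivity)]
  refine ENNReal.rpow_le_rpow ?_ (by positivity)
  refine (lintegral_mul_const_le _ _).trans (lintegral_mono_ae ?_)
  filter_upwards [hW.posDef_avg Q] with y hy
  rw [← ENNReal.mul_rpow_of_nonneg _ _ ht'.le]
  refine ENNReal.rpow_le_rpow (ENNReal.div_le_of_le_mul ?_) ht'.le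
  rw [opNorm_mul_comm hx hy]
  have := normMulVec_le_opNorm_mul hx (-(1 / t)) (matPow (W y) (-(1 / t))) e
  rwa [neg_neg] at this

theorem ne_top_of_mul_le {a b c : ℝ≥0∞} (h : a * b ≤ c) (hc : c < ∞) (hb : b ≠ 0) : a ≠ ∞ := by
  rintro rfl
  rw [ENNReal.top_mul hb] at h
  exact (h.trans_lt hc).ne rfl

theorem IsMatrixWeight.lintegral_direct_ne_top (hW : IsMatrixWeight W) (ht : 1 < t)
    (hA : ApConst W t < ∞) {Q : Set (Fin d → ℝ)} (hQ : Q ∈ cubes d)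
    (e : EuclideanSpace ℝ (Fin n)) :
    ∫⁻ x, normMulVec (matPow (W x) (1 / t)) e ^ t ∂avgMeasure Q ≠ ∞ := by
  have hc := Real.HolderConjugate.conjExponent ht
  have ht0 := hc.pos
  have ht' := hc.symm.pos
  refine ne_top_of_mul_le (hW.direct_bound ht hQ e) hA ?_
  rw [Ne, ENNReal.rpow_eq_zero_iff_of_pos (by positivity)]
  exact hW.lintegral_inv_normMulVec_ne_zero _ _ hQ hc.symm.pos

theorem IsMatrixWeight.lintegral_dual_ne_top (hW : IsMatrixWeight W) (ht : 1 < t)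
    (hA : ApConst W t < ∞) {Q : Set (Fin d → ℝ)} (hQ : Q ∈ cubes d)
    (e : EuclideanSpace ℝ (Fin n)) :
    ∫⁻ x, normMulVec (matPow (W x) (-(1 / t))) e ^ t.conjExponent ∂avgMeasure Q ≠ ∞ := by
  have hc := Real.HolderConjugate.conjExponent ht
  have ht0 := hc.pos
  have ht' := hc.symm.pos
  have := ne_top_of_mul_le (hW.dual_bound ht hQ e) hA
    (hW.lintegral_inv_normMulVec_ne_zero _ _ hQ hc.pos)
  intro h
  rw [h, ENNReal.top_rpow_of_pos (by positivity)] at this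
  exact this rfl

theorem IsMatrixWeight.direct_le (hW : IsMatrixWeight W) (ht : 1 < t) {Q : Set (Fin d → ℝ)}
    (hQ : Q ∈ cubes d) {e : EuclideanSpace ℝ (Fin n)} (he : e ≠ 0) {δ : ℝ} (hδ : 0 < δ) :
    ∫⁻ x, normMulVec (matPow (W x) (1 / t)) e ^ t ∂avgMeasure Q ≤
      ApConst W t * (∫⁻ x, normMulVec (matPow (W x) (1 / t)) e ^ δ ∂avgMeasure Q) ^ (t / δ) := by
  have hc := Real.HolderConjugate.conjExponent ht
  have ht' := hc.symm.pos
  have ht0 := hc.pos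
  have := isProbabilityMeasure_avgMeasure hQ
  have h1 := one_le_lintegral_rpow_mul (hW.aemeasurable_normMulVec_avg (1 / t) e Q)
    (hW.normMulVec_ne_zero_avg (1 / t) he Q) (Eventually.of_forall fun x => normMulVec_ne_top _ _)
    ht' hδ
  have h2 := ENNReal.rpow_le_rpow h1 ht0.le
  rw [ENNReal.one_rpow, ENNReal.mul_rpow_of_nonneg _ _ ht0.le, ← ENNReal.rpow_mul,
    ← ENNReal.rpow_mul, one_div_mul_eq_div, one_div_mul_eq_div] at h2
  calc _ ≤ (∫⁻ x, normMulVec (matPow (W x) (1 / t)) e ^ t ∂avgMeasure Q) * _ :=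
        le_mul_of_one_le_right zero_le h2
    _ ≤ _ := by
        rw [← mul_assoc]
        exact mul_le_mul' (hW.direct_bound ht hQ e) le_rfl

theorem IsMatrixWeight.dual_le (hW : IsMatrixWeight W) (ht : 1 < t) {Q : Set (Fin d → ℝ)}
    (hQ : Q ∈ cubes d) {e : EuclideanSpace ℝ (Fin n)} (he : e ≠ 0) {δ : ℝ} (hδ : 0 < δ) :
    ∫⁻ x, normMulVec (matPow (W x) (-(1 / t))) e ^ t.conjExponent ∂avgMeasure Q ≤
      ApConst W t ^ (t.conjExponent - 1) *
        (∫⁻ x, normMulVec (matPow (W x) (-(1 / t))) e ^ δ ∂avgMeasure Q) ^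
          (t.conjExponent / δ) := by
  have hc := Real.HolderConjugate.conjExponent ht
  have ht' := hc.symm.pos
  have ht0 := hc.pos
  have := isProbabilityMeasure_avgMeasure hQ
  have h1 := one_le_lintegral_rpow_mul (hW.aemeasurable_normMulVec_avg (-(1 / t)) e Q)
    (hW.normMulVec_ne_zero_avg (-(1 / t)) he Q)
    (Eventually.of_forall fun x => normMulVec_ne_top _ _) ht0 hδ
  have h2 := ENNReal.rpow_le_rpow h1 ht0.le
  rw [ENNReal.one_rpow, ENNReal.mul_rpow_of_nonneg _ _ ht0.le, ← ENNReal.rpow_mul,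
    ← ENNReal.rpow_mul, one_div_mul_eq_div, one_div_mul_eq_div, div_self ht0.ne',
    ENNReal.rpow_one] at h2
  set U := ∫⁻ x, normMulVec (matPow (W x) (-(1 / t))) e ^ t.conjExponent ∂avgMeasure Q
  set D := ∫⁻ x, normMulVec (matPow (W x) (-(1 / t))) e ^ δ ∂avgMeasure Q
  have h3 : U ^ (t / t.conjExponent) ≤ ApConst W t * D ^ (t / δ) := by
    calc _ ≤ U ^ (t / t.conjExponent) * _ := le_mul_of_one_le_right zero_le h2
      _ ≤ _ := by
          rw [← mul_assoc]
          exact mul_le_mul' (hW.dual_bound ht hQ e) le_rfl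
  -- The power of the `A_t` constant comes from taking the root of order `t / t'`.
  have h4 : t.conjExponent / t = t.conjExponent - 1 := by
    have := hc.symm.sub_one_mul_conj
    field_simp; linarith
  have h5 := ENNReal.rpow_le_rpow h3 (z := t.conjExponent / t) (by positivity)
  rw [ENNReal.mul_rpow_of_nonneg _ _ (by positivity), ← ENNReal.rpow_mul, ← ENNReal.rpow_mul,
    h4] at h5
  have e1 : t / t.conjExponent * (t.conjExponent - 1) = 1 := by rw [← h4]; field_simp
  have e2 : t / δ * (t.conjExponent - 1) = t.conjExponent / δ := by rw [← h4]; field_simp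
  rwa [e1, e2, ENNReal.rpow_one] at h5

theorem IsMatrixWeight.reverseHolder_le (hW : IsMatrixWeight W) (ht : 1 < t) {s : ℝ} (hs : 0 < s)
    (hA : ApConst W t < ∞) {Q : Set (Fin d → ℝ)}
    (hQ : Q ∈ cubes d) {e : EuclideanSpace ℝ (Fin n)} (he : e ≠ 0) :
    ∫⁻ x, normMulVec (matPow (W x) (1 / t)) e ^ (t * s) ∂avgMeasure Q ≤
      (RHConst W t s * ∫⁻ x, normMulVec (matPow (W x) (1 / t)) e ^ t ∂avgMeasure Q) ^ s := by
  have hV0 := hW.lintegral_normMulVec_ne_zero (1 / t) he hQ (β := t) (by linarith)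
  have hVt := hW.lintegral_direct_ne_top ht hA hQ e
  have h1 : (∫⁻ x, normMulVec (matPow (W x) (1 / t)) e ^ (t * s) ∂avgMeasure Q) ^ (1 / s) *
      (∫⁻ x, normMulVec (matPow (W x) (1 / t)) e ^ t ∂avgMeasure Q)⁻¹ ≤ RHConst W t s := by
    simp only [← laverage_eq_lintegral_avgMeasure]
    refine le_trans ?_ (le_iSup _ e)
    exact le_iSup₂ (f := fun Q (_ : Q ∈ cubes d) =>
      (⨍⁻ x in Q, normMulVec (matPow (W x) (1 / t)) e ^ (t * s) ∂volume) ^ (1 / s) *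
      (⨍⁻ x in Q, normMulVec (matPow (W x) (1 / t)) e ^ t ∂volume)⁻¹) Q hQ
  rw [← div_eq_mul_inv, ENNReal.div_le_iff hV0 hVt] at h1
  have h2 := ENNReal.rpow_le_rpow h1 hs.le
  rwa [← ENNReal.rpow_mul, one_div_mul_cancel hs.ne', ENNReal.rpow_one] at h2

theorem IsMatrixWeight.dual_sq_le (hW : IsMatrixWeight W) (ht : 1 < t) {Q : Set (Fin d → ℝ)}
    (hQ : Q ∈ cubes d) {e : EuclideanSpace ℝ (Fin n)} (he : e ≠ 0) :
    ∫⁻ x, normMulVec (matPow (W x) (-(1 / t))) e ^ t.conjExponent ∂avgMeasure Q ≤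
      ApConst W t ^ (t.conjExponent - 1) *
        (∫⁻ x, (normMulVec (matPow (W x) (-(1 / t))) e ^ t.conjExponent) ^ (1 / 2 : ℝ)
          ∂avgMeasure Q) ^ 2 := by
  have ht' := (Real.HolderConjugate.conjExponent ht).symm.pos
  have := hW.dual_le ht hQ he (δ := t.conjExponent * (1 / 2)) (by positivity)
  have h2 : t.conjExponent / (t.conjExponent * (1 / 2)) = 2 := by field_simp
  simpa only [h2, ENNReal.rpow_two, ENNReal.rpow_mul] using this

/-- The reverse Hölder condition lowers the exponent from `ts` to `t`, and the scalar `A_t`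
condition lowers it further to `ts/2`. -/
theorem IsMatrixWeight.direct_sq_le (hW : IsMatrixWeight W) (ht : 1 < t) {s : ℝ} (hs : 0 < s)
    (hA : ApConst W t < ∞) {Q : Set (Fin d → ℝ)}
    (hQ : Q ∈ cubes d) {e : EuclideanSpace ℝ (Fin n)} (he : e ≠ 0) :
    ∫⁻ x, normMulVec (matPow (W x) (1 / t)) e ^ (t * s) ∂avgMeasure Q ≤
      (ApConst W t * RHConst W t s) ^ s *
        (∫⁻ x, (normMulVec (matPow (W x) (1 / t)) e ^ (t * s)) ^ (1 / 2 : ℝ)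
          ∂avgMeasure Q) ^ 2 := by
  have ht0 : 0 < t := by linarith
  have h1 := hW.direct_le ht hQ he (δ := t * s * (1 / 2)) (by positivity)
  refine (hW.reverseHolder_le ht hs hA hQ he).trans ?_
  refine (ENNReal.rpow_le_rpow (mul_le_mul' le_rfl h1) hs.le).trans (le_of_eq ?_)
  rw [← mul_assoc, ENNReal.mul_rpow_of_nonneg _ _ hs.le, mul_comm (RHConst W t s),
    ← ENNReal.rpow_mul, show t / (t * s * (1 / 2)) * s = 2 by field_simp, ENNReal.rpow_two]
  simp only [ENNReal.rpow_mul]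

theorem IsMatrixWeight.lintegral_dual_rpow_add_le (hW : IsMatrixWeight W) {β : ℝ} (hβ : 1 ≤ β)
    (α : ℝ) {Q : Set (Fin d → ℝ)} (z z' : EuclideanSpace ℝ (Fin n)) :
    (∫⁻ y, normMulVec (matPow (W y) α) (z + z') ^ β ∂avgMeasure Q) ^ (1 / β) ≤
      (∫⁻ y, normMulVec (matPow (W y) α) z ^ β ∂avgMeasure Q) ^ (1 / β) +
      (∫⁻ y, normMulVec (matPow (W y) α) z' ^ β ∂avgMeasure Q) ^ (1 / β) := by
  refine le_trans (ENNReal.rpow_le_rpow (lintegral_mono fun y => ?_) (by positivity))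
    (ENNReal.lintegral_Lp_add_le (hW.aemeasurable_normMulVec_avg α z Q)
      (hW.aemeasurable_normMulVec_avg α z' Q) hβ)
  refine ENNReal.rpow_le_rpow ?_ (by linarith)
  simp only [normMulVec, map_add, Pi.add_apply]
  exact enorm_add_le _ _

/-- In a suitable orthonormal basis the `A_t` condition holds with averages taken separately. -/
theorem IsMatrixWeight.exists_basis (hW : IsMatrixWeight W) (ht : 1 < t)
    (hA : ApConst W t < ∞) {Q : Set (Fin d → ℝ)} (hQ : Q ∈ cubes d) :
    ∃ e : OrthonormalBasis (Fin n) ℝ (EuclideanSpace ℝ (Fin n)), ∀ i,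
      (∫⁻ y, normMulVec (matPow (W y) (-(1 / t))) (e i) ^ t.conjExponent ∂avgMeasure Q) ^
          (t / t.conjExponent) *
        ∫⁻ x, normMulVec (matPow (W x) (1 / t)) (e i) ^ t ∂avgMeasure Q ≤
      ((2 : ℝ≥0∞) ^ n) ^ t * ApConst W t := by
  have hc := Real.HolderConjugate.conjExponent ht
  have ht' := hc.symm.pos
  have ht0 := hc.pos
  obtain ⟨e, he⟩ := exists_orthonormalBasis_of_enorm
    (fun z => (∫⁻ y, normMulVec (matPow (W y) (-(1 / t))) z ^ t.conjExponent ∂avgMeasure Q) ^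
      (1 / t.conjExponent))
    (fun z => ENNReal.rpow_ne_top_of_nonneg (by positivity) (hW.lintegral_dual_ne_top ht hA hQ z))
    (hW.lintegral_dual_rpow_add_le hc.symm.lt.le _)
    (fun c z => by
      have h1 : ∀ y, normMulVec (matPow (W y) (-(1 / t))) (c • z) ^ t.conjExponent =
          ‖c‖ₑ ^ t.conjExponent * normMulVec (matPow (W y) (-(1 / t))) z ^ t.conjExponent := by
        intro y
        rw [normMulVec, map_smul, enorm_smul, ENNReal.mul_rpow_of_nonneg _ _ ht'.le, normMulVec]
      simp only [h1]
      rw [lintegral_const_mul' _ _ (ENNReal.rpow_ne_top_of_nonneg ht'.le enorm_ne_top),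
        ENNReal.mul_rpow_of_nonneg _ _ (by positivity), ← ENNReal.rpow_mul,
        mul_one_div_cancel ht'.ne', ENNReal.rpow_one])
  refine ⟨e, fun i => ?_⟩
  refine (lintegral_const_mul_le _ _).trans ?_
  refine le_trans (lintegral_mono_ae ?_) ((lintegral_const_mul' _ _ (by
    exact ENNReal.rpow_ne_top_of_nonneg ht0.le (by simp))).le.trans
      (mul_le_mul' le_rfl (lintegral_le_ApConst W t hQ)))
  filter_upwards [hW.posDef_avg Q] with x hx
  set T := toEuclideanCLM (n := Fin n) (𝕜 := ℝ) (matPow (W x) (1 / t)) with hT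
  set z := T (e i) with hz
  have hei : e i ≠ 0 := by
    intro h0
    have := e.orthonormal.1 i
    rw [h0, norm_zero] at this
    exact zero_ne_one this
  have hnz : normMulVec (matPow (W x) (1 / t)) (e i) = ‖z‖ₑ := rfl
  have hz0 : ‖z‖ₑ ≠ 0 := hnz ▸ normMulVec_matPow_ne_zero hx _ hei
  have hinner : inner ℝ (e i) (T z) = ‖z‖ ^ 2 := by
    rw [← real_inner_self_eq_norm_sq]
    have hadj : ∀ u v, inner ℝ u (T v) = inner ℝ (T u) v := by
      intro u v
      simp only [PiLp.inner_apply, hT, toEuclideanCLM_apply_apply, RCLike.inner_apply,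
        conj_trivial, Finset.sum_mul, Finset.mul_sum]
      rw [Finset.sum_comm]
      refine Finset.sum_congr rfl fun k _ => Finset.sum_congr rfl fun l _ => ?_
      rw [matPow_symm hx]; ring
    rw [hadj]
  -- With `T = W^{1/t}(x)` and `z = T eᵢ`, the test vector `T z` satisfies `⟨eᵢ, T z⟩ = |T eᵢ|²`,
  -- while its averaged norm is at most `|z|` times an average of `|W^{1/t}(x) W^{-1/t}(y)|_op`.
  -- Cancelling one factor `|z|` leaves the integrand of the `A_t` constant.
  have h1 := he i (T z)
  set U := ∫⁻ y, normMulVec (matPow (W y) (-(1 / t))) (e i) ^ t.conjExponent ∂avgMeasure Q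
  set P := ∫⁻ y, opNorm (matPow (W x) (1 / t) * matPow (W y) (-(1 / t))) ^ t.conjExponent
    ∂avgMeasure Q
  have h2 : (∫⁻ y, normMulVec (matPow (W y) (-(1 / t))) (T z) ^ t.conjExponent ∂avgMeasure Q) ^
      (1 / t.conjExponent) ≤ P ^ (1 / t.conjExponent) * ‖z‖ₑ := by
    have h3 : ∫⁻ y, normMulVec (matPow (W y) (-(1 / t))) (T z) ^ t.conjExponent ∂avgMeasure Q ≤
        P * ‖z‖ₑ ^ t.conjExponent := by
      rw [← lintegral_mul_const' _ _ (ENNReal.rpow_ne_top_of_nonneg ht'.le enorm_ne_top)]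
      refine lintegral_mono_ae ?_
      filter_upwards [hW.posDef_avg Q] with y hy
      rw [← ENNReal.mul_rpow_of_nonneg _ _ ht'.le]
      refine ENNReal.rpow_le_rpow ?_ ht'.le
      rw [opNorm_mul_comm hx hy]
      have h4 : normMulVec (matPow (W y) (-(1 / t))) (T z) =
          normMulVec (matPow (W y) (-(1 / t)) * matPow (W x) (1 / t)) z := by
        rw [normMulVec, normMulVec, map_mul]; rfl
      rw [h4]
      exact ContinuousLinearMap.le_opENorm (toEuclideanCLM (n := Fin n) (𝕜 := ℝ)
        (matPow (W y) (-(1 / t)) * matPow (W x) (1 / t))) z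
    refine (ENNReal.rpow_le_rpow h3 (by positivity)).trans (le_of_eq ?_)
    rw [ENNReal.mul_rpow_of_nonneg _ _ (by positivity), ← ENNReal.rpow_mul,
        mul_one_div_cancel ht'.ne', ENNReal.rpow_one]
  have h5 : ‖z‖ₑ * U ^ (1 / t.conjExponent) ≤ 2 ^ n * P ^ (1 / t.conjExponent) := by
    have h6 : ‖inner ℝ (e i) (T z)‖ₑ = ‖z‖ₑ * ‖z‖ₑ := by
      rw [hinner, enorm_pow, enorm_norm, sq]
    rw [h6] at h1
    have h7 : ‖z‖ₑ * U ^ (1 / t.conjExponent) * ‖z‖ₑ ≤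
        2 ^ n * P ^ (1 / t.conjExponent) * ‖z‖ₑ := by
      calc _ = ‖z‖ₑ * ‖z‖ₑ * U ^ (1 / t.conjExponent) := by ring
        _ ≤ _ := h1
        _ ≤ 2 ^ n * (P ^ (1 / t.conjExponent) * ‖z‖ₑ) := by gcongr
        _ = _ := by ring
    exact (ENNReal.mul_le_mul_iff_left hz0 enorm_ne_top).1 h7
  have h8 := ENNReal.rpow_le_rpow h5 ht0.le
  rw [ENNReal.mul_rpow_of_nonneg _ _ ht0.le, ENNReal.mul_rpow_of_nonneg _ _ ht0.le,
    ← ENNReal.rpow_mul, ← ENNReal.rpow_mul, one_div_mul_eq_div] at h8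
  rw [hnz, mul_comm]
  exact h8

end Weights

/-! ### Convex bodies of weighted functions -/

section Bodies

open Filter Matrix

variable {d n : ℕ}

theorem aestronglyMeasurable_toLp {X : Type*} [MeasurableSpace X] {μ : Measure X} {B : Type*}
    [NormedAddCommGroup B] {v : Fin n → X → B} (hv : ∀ i, AEStronglyMeasurable (v i) μ) :
    AEStronglyMeasurable (fun x => (WithLp.toLp 2 fun i => v i x : PiLp 2 fun _ : Fin n => B)) μ := by
  have h1 : (fun x => (WithLp.toLp 2 fun i => v i x : PiLp 2 fun _ : Fin n => B)) =
      fun x => ∑ i, (WithLp.toLp 2 (Pi.single i (v i x)) : PiLp 2 fun _ : Fin n => B) := by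
    funext x
    rw [← WithLp.toLp_sum, Finset.univ_sum_single]
  rw [h1]
  refine Finset.aestronglyMeasurable_fun_sum _ fun i _ => ?_
  exact Continuous.comp_aestronglyMeasurable
    (g := fun b : B => (WithLp.toLp 2 (Pi.single i b) : PiLp 2 fun _ : Fin n => B))
    ((PiLp.continuous_toLp 2 fun _ : Fin n => B).comp (continuous_pi fun j => by
      by_cases h : j = i
      · subst h; simpa using continuous_id'
      · simpa [h] using continuous_const)) (hv i)

theorem IsMatrixWeight.aestronglyMeasurable_matAct {W : (Fin d → ℝ) → Matrix (Fin n) (Fin n) ℝ}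
    (hW : IsMatrixWeight W) (α : ℝ) {B : Type*} [NormedAddCommGroup B] [NormedSpace ℝ B]
    {f : Fin n → (Fin d → ℝ) → B} (hf : ∀ i, AEStronglyMeasurable (f i) volume) :
    AEStronglyMeasurable (fun x => matAct (matPow (W x) α) fun i => f i x) volume := by
  refine aestronglyMeasurable_toLp fun i => ?_
  exact Finset.aestronglyMeasurable_fun_sum _ fun j _ =>
    (hW.aemeasurable_matPow α i j).aestronglyMeasurable.smul (hf j)

theorem norm_sum_smul_toLp_le {X : Type*} [MeasurableSpace X] {μ : Measure X} {B : Type*}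
    [NormedAddCommGroup B] [NormedSpace ℝ B] {p : ℝ≥0∞} [Fact (1 ≤ p)] {f : Fin n → X → B}
    (hf : ∀ i, MemLp (f i) p μ) (c : Fin n → ℝ) :
    ‖∑ j, c j • (hf j).toLp (f j)‖ₑ = eLpNorm (fun x => ∑ j, c j • f j x) p μ := by
  have h1 : ∀ s : Finset (Fin n), (∑ j ∈ s, c j • (hf j).toLp (f j) : Lp B p μ) =ᵐ[μ]
      fun x => ∑ j ∈ s, c j • f j x := by
    intro s
    induction s using Finset.induction_on with
    | empty =>
      simp only [Finset.sum_empty]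
      exact Lp.coeFn_zero B p μ
    | insert a s ha ih =>
      rw [Finset.sum_insert ha]
      filter_upwards [Lp.coeFn_add (c a • (hf a).toLp (f a)) (∑ j ∈ s, c j • (hf j).toLp (f j)),
        Lp.coeFn_smul (c a) ((hf a).toLp (f a)), (hf a).coeFn_toLp, ih] with x h1 h2 h3 h4
      rw [h1, Pi.add_apply, h2, Pi.smul_apply, h3, h4, Finset.sum_insert ha]
  rw [Lp.enorm_def]
  exact eLpNorm_congr_ae (h1 _)

/-- Expand `a · b` in the basis: the `i`-th coordinate of a point of the body of `f` is a functional
of norm at most one applied to the scalar combination `eᵢ · f`. The basis is free and is later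
adapted to the cube. -/
theorem ofReal_bodyDot_le {X : Type*} [MeasurableSpace X] {μ : Measure X}
    {B₁ B₂ : Type*} [NormedAddCommGroup B₁] [NormedSpace ℝ B₁] [NormedAddCommGroup B₂]
    [NormedSpace ℝ B₂] {p q : ℝ≥0∞} [Fact (1 ≤ p)] [Fact (1 ≤ q)] {f : Fin n → X → B₁}
    {g : Fin n → X → B₂} (hf : ∀ i, MemLp (f i) p μ) (hg : ∀ i, MemLp (g i) q μ)
    (e : OrthonormalBasis (Fin n) ℝ (EuclideanSpace ℝ (Fin n))) :
    ENNReal.ofReal (bodyDot (convexBody fun i => (hf i).toLp (f i))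
      (convexBody fun i => (hg i).toLp (g i))) ≤
      ∑ i, eLpNorm (fun x => ∑ j, e i j • f j x) p μ *
        eLpNorm (fun x => ∑ j, e i j • g j x) q μ := by
  have h1 : ∀ i, eLpNorm (fun x => ∑ j, e i j • f j x) p μ =
      ENNReal.ofReal ‖∑ j, e i j • (hf j).toLp (f j)‖ := fun i => by
    rw [← norm_sum_smul_toLp_le hf, ofReal_norm]
  have h2 : ∀ i, eLpNorm (fun x => ∑ j, e i j • g j x) q μ =
      ENNReal.ofReal ‖∑ j, e i j • (hg j).toLp (g j)‖ := fun i => by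
    rw [← norm_sum_smul_toLp_le hg, ofReal_norm]
  simp only [h1, h2, ← ENNReal.ofReal_mul (norm_nonneg _)]
  rw [← ENNReal.ofReal_sum_of_nonneg fun i _ => by positivity]
  refine ENNReal.ofReal_le_ofReal (Real.sSup_le ?_ (by positivity))
  rintro c ⟨a, ⟨φ, hφ, rfl⟩, b, ⟨ψ, hψ, rfl⟩, rfl⟩
  have h3 := e.sum_inner_mul_inner (WithLp.toLp 2 fun i => φ ((hf i).toLp (f i)))
    (WithLp.toLp 2 fun i => ψ ((hg i).toLp (g i)))
  have h4 : (fun i => φ ((hf i).toLp (f i))) ⬝ᵥ (fun i => ψ ((hg i).toLp (g i))) =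
      inner ℝ (WithLp.toLp 2 fun i => φ ((hf i).toLp (f i)) : EuclideanSpace ℝ (Fin n))
        (WithLp.toLp 2 fun i => ψ ((hg i).toLp (g i))) := by
    simp [PiLp.inner_apply, dotProduct, mul_comm]
  rw [h4, ← h3]
  refine Finset.sum_le_sum fun i _ => ?_
  have h5 : inner ℝ (WithLp.toLp 2 fun i => φ ((hf i).toLp (f i)) : EuclideanSpace ℝ (Fin n)) (e i)
      = φ (∑ j, e i j • (hf j).toLp (f j)) := by
    simp [PiLp.inner_apply]
  have h6 : inner ℝ (e i) (WithLp.toLp 2 fun i => ψ ((hg i).toLp (g i)) : EuclideanSpace ℝ (Fin n))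
      = ψ (∑ j, e i j • (hg j).toLp (g j)) := by
    simp [PiLp.inner_apply, mul_comm]
  rw [h5, h6]
  refine (le_abs_self _).trans ?_
  rw [abs_mul]
  gcongr
  · simpa using φ.le_of_opNorm_le hφ (∑ j, e i j • (hf j).toLp (f j))
  · simpa using ψ.le_of_opNorm_le hψ (∑ j, e i j • (hg j).toLp (g j))

/-- The local norm of a component of `f` in terms of the scalar functions
`|W^{-α}e|^{1/p}` and `|W^{α/p} f|`. -/
theorem IsMatrixWeight.eLpNorm_component_le {W : (Fin d → ℝ) → Matrix (Fin n) (Fin n) ℝ}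
    (hW : IsMatrixWeight W) {B : Type*} [NormedAddCommGroup B] [NormedSpace ℝ B] {p : ℝ≥0∞}
    [Fact (1 ≤ p)] (hp : p ≠ ∞) (α : ℝ) {θ : ℝ} (hθ0 : 0 < θ) (hθ : θ ≤ 1)
    (f : Fin n → (Fin d → ℝ) → B) {e : EuclideanSpace ℝ (Fin n)} (he : ‖e‖ = 1)
    (Q : Set (Fin d → ℝ)) :
    eLpNorm (fun x => ∑ j, e j • f j x) p (avgMeasure Q) ≤
      (∫⁻ x, (normMulVec (matPow (W x) (-α)) e ^ θ *
        ‖matAct (matPow (W x) (α * θ)) fun i => f i x‖ₑ) ^ p.toReal ∂avgMeasure Q) ^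
          (1 / p.toReal) := by
  have hp1 : 1 ≤ p := Fact.out
  have hp0 : p ≠ 0 := (zero_lt_one.trans_le hp1).ne'
  rw [eLpNorm_eq_lintegral_rpow_enorm_toReal hp0 hp]
  refine ENNReal.rpow_le_rpow (lintegral_mono_ae ?_) (by positivity)
  filter_upwards [hW.posDef_avg Q] with x hx
  refine ENNReal.rpow_le_rpow ?_ ENNReal.toReal_nonneg
  refine (enorm_sum_smul_le hx (α * θ) e fun i => f i x).trans ?_
  gcongr
  rw [← neg_mul]
  exact normMulVec_matPow_mul_le hx (-α) hθ0 hθ he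

end Bodies

/-! ### Sums over sparse collections -/

section Sparse

variable {d : ℕ}

/-- Replace `|Q|` by `γ⁻¹ |E_Q|` and integrate `c_Q ≤ Φ` over the disjoint sets `E_Q`. -/
theorem sum_sparse_le {γ : ℝ} (hγ : 0 < γ) {𝒮 : Finset (Set (Fin d → ℝ))}
    {E : Set (Fin d → ℝ) → Set (Fin d → ℝ)}
    (hE : ∀ Q ∈ 𝒮, E Q ⊆ Q ∧ MeasurableSet (E Q) ∧ ENNReal.ofReal γ * volume Q ≤ volume (E Q))
    (hdis : (𝒮 : Set (Set (Fin d → ℝ))).PairwiseDisjoint E)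
    {c : Set (Fin d → ℝ) → ℝ≥0∞} {Φ : (Fin d → ℝ) → ℝ≥0∞}
    (hc : ∀ Q ∈ 𝒮, ∀ x ∈ Q, c Q ≤ Φ x) :
    ∑ Q ∈ 𝒮, volume Q * c Q ≤ (ENNReal.ofReal γ)⁻¹ * ∫⁻ x, Φ x := by
  have hγ0 : ENNReal.ofReal γ ≠ 0 := by simpa using hγ
  calc ∑ Q ∈ 𝒮, volume Q * c Q
      ≤ ∑ Q ∈ 𝒮, (ENNReal.ofReal γ)⁻¹ * ∫⁻ x in E Q, Φ x := by
        refine Finset.sum_le_sum fun Q hQ => ?_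
        obtain ⟨h1, h2, h3⟩ := hE Q hQ
        calc volume Q * c Q = (ENNReal.ofReal γ)⁻¹ * (ENNReal.ofReal γ * volume Q * c Q) := by
              rw [← mul_assoc, ← mul_assoc, ENNReal.inv_mul_cancel hγ0 ENNReal.ofReal_ne_top,
                one_mul]
          _ ≤ (ENNReal.ofReal γ)⁻¹ * (c Q * volume (E Q)) := by
              rw [mul_comm (c Q)]; gcongr
          _ ≤ _ := by
              gcongr
              rw [← setLIntegral_const]
              exact setLIntegral_mono' h2 fun x hx => hc Q hQ x (h1 hx)
    _ = (ENNReal.ofReal γ)⁻¹ * ∫⁻ x in ⋃ Q ∈ 𝒮, E Q, Φ x := by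
        rw [← Finset.mul_sum, lintegral_biUnion_finset hdis fun Q hQ => (hE Q hQ).2.1]
    _ ≤ _ := by
        gcongr
        exact Measure.restrict_le_self

end Sparse

/-! ### The weighted bound for the sparse form -/

section Form

open Filter Matrix

variable {d n : ℕ}

/-- One factor of the sparse form: the local norm is controlled by the average of the scalar
weight and a power average of the weighted function. -/
theorem IsMatrixWeight.local_norm_le {W : (Fin d → ℝ) → Matrix (Fin n) (Fin n) ℝ}
    (hW : IsMatrixWeight W) {B : Type*} [NormedAddCommGroup B] [NormedSpace ℝ B] {a : ℝ≥0∞}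
    [Fact (1 ≤ a)] (ha : a ≠ ∞) {m κ : ℝ} {K : ℝ≥0}
    (hbump : ∀ ω : (Fin d → ℝ) → ℝ≥0∞, AEMeasurable ω volume →
        (∀ R ∈ cubes d, ⨍⁻ x in R, ω x ^ m ∂volume ≤
          K * (⨍⁻ x in R, (ω x ^ m) ^ (1 / 2 : ℝ) ∂volume) ^ 2) →
        ∀ Q ∈ cubes d, ∫⁻ x in Q, ω x ^ m ≠ ∞ →
        ∀ h : (Fin d → ℝ) → ℝ≥0∞, AEMeasurable h volume →
        (⨍⁻ x in Q, (ω x * h x) ^ a.toReal ∂volume) ^ (1 / a.toReal) ≤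
          2 * (⨍⁻ x in Q, ω x ^ m ∂volume) ^ (1 / m) *
            (⨍⁻ x in Q, h x ^ κ ∂volume) ^ (1 / κ))
    (α : ℝ) {θ : ℝ} (hθ0 : 0 < θ) (hθ : θ ≤ 1)
    {f : Fin n → (Fin d → ℝ) → B} (hf : ∀ i, AEStronglyMeasurable (f i) volume)
    {e : EuclideanSpace ℝ (Fin n)} (he : ‖e‖ = 1)
    (hsq : ∀ R ∈ cubes d, ∫⁻ x, normMulVec (matPow (W x) (-α)) e ^ (θ * m) ∂avgMeasure R ≤
      K * (∫⁻ x, (normMulVec (matPow (W x) (-α)) e ^ (θ * m)) ^ (1 / 2 : ℝ) ∂avgMeasure R) ^ 2)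
    {Q : Set (Fin d → ℝ)} (hQ : Q ∈ cubes d)
    (hfin : ∫⁻ x, normMulVec (matPow (W x) (-α)) e ^ (θ * m) ∂avgMeasure Q ≠ ∞) :
    eLpNorm (fun x => ∑ j, e j • f j x) a (avgMeasure Q) ≤
      2 * (∫⁻ x, normMulVec (matPow (W x) (-α)) e ^ (θ * m) ∂avgMeasure Q) ^ (1 / m) *
        (⨍⁻ x in Q, ‖matAct (matPow (W x) (α * θ)) fun i => f i x‖ₑ ^ κ ∂volume) ^ (1 / κ) := by
  refine (hW.eLpNorm_component_le ha α hθ0 hθ f he Q).trans ?_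
  simp only [← laverage_eq_lintegral_avgMeasure, ENNReal.rpow_mul] at hsq ⊢
  refine hbump (fun x => normMulVec (matPow (W x) (-α)) e ^ θ)
    ((hW.aemeasurable_normMulVec (-α) e).pow_const θ) hsq Q hQ ?_
    _ (hW.aestronglyMeasurable_matAct (α * θ) hf).enorm
  simp only [← ENNReal.rpow_mul]
  exact setLIntegral_ne_top_of_avg hQ hfin

theorem lintegral_rpow_mul_rpow_le {r r' κ κ' : ℝ} (hr : r.HolderConjugate r')
    {F G : (Fin d → ℝ) → ℝ≥0∞} (hF : Measurable F) (hG : Measurable G) :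
    ∫⁻ x, F x ^ (1 / κ) * G x ^ (1 / κ') ≤
      (∫⁻ x, F x ^ (r / κ)) ^ (1 / r) * (∫⁻ x, G x ^ (r' / κ')) ^ (1 / r') := by
  refine (ENNReal.lintegral_mul_le_Lp_mul_Lq volume hr (hF.pow_const _).aemeasurable
    (hG.pow_const _).aemeasurable).trans (le_of_eq ?_)
  simp only [← ENNReal.rpow_mul, one_div_mul_eq_div]

/-- The weighted estimate for the sparse form, with constants depending only on the indicated
parameters. -/
theorem exists_sparse_form_bound (hd : 0 < d) (n : ℕ) {p q' : ℝ≥0∞} [Fact (1 ≤ p)] [Fact (1 ≤ q')]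
    (hp : p ≠ ∞) (hq' : q' ≠ ∞) {r r' t s γ : ℝ} (hr : r.HolderConjugate r')
    (hpr : p.toReal < r) (hqr : q'.toReal < r') (ht : t = r / p.toReal) (hs : 0 < s)
    (hqs : 1 / q'.toReal = 1 / (r * s) + 1 / r') (hγ : 0 < γ) :
    ∃ C : ℝ≥0, ∀ {B₁ B₂ : Type*} [NormedAddCommGroup B₁] [NormedSpace ℝ B₁]
      [NormedAddCommGroup B₂] [NormedSpace ℝ B₂] {𝒟 : Set (Set (Fin d → ℝ))}
      (_ : IsDyadicLattice 𝒟) {W : (Fin d → ℝ) → Matrix (Fin n) (Fin n) ℝ}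
      (_ : IsMatrixWeight W) (_ : ApConst W t < ∞) (_ : RHConst W t s < ∞)
      {f : Fin n → ((Fin d → ℝ) →ₘ[volume] B₁)} {g : Fin n → ((Fin d → ℝ) →ₘ[volume] B₂)}
      {𝒬 : Set (Set (Fin d → ℝ))} (_ : 𝒬 ⊆ 𝒟) (_ : IsSparse γ 𝒬)
      (hf : ∀ Q : 𝒬, ∀ i, MemLp (f i) p (avgMeasure (Q : Set (Fin d → ℝ))))
      (hg : ∀ Q : 𝒬, ∀ i, MemLp (g i) q' (avgMeasure (Q : Set (Fin d → ℝ)))),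
      ∑' Q : 𝒬, volume (Q : Set (Fin d → ℝ)) * ENNReal.ofReal (bodyDot
        (localBody p (Q : Set (Fin d → ℝ)) f (hf Q)) (localBody q' (Q : Set (Fin d → ℝ)) g (hg Q)))
      ≤ C * (ApConst W t ^ (t.conjExponent / r + s / r') * RHConst W t s ^ (1 / r + s / r')) *
        ((∫⁻ x, ‖matAct (matPow (W x) (1 / r)) fun i => f i x‖ₑ ^ r) ^ (1 / r) *
          (∫⁻ x, ‖matAct (matPow (W x) (-(1 / r))) fun i => g i x‖ₑ ^ r') ^ (1 / r')) := by
  have hr0 := hr.pos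
  have hr'0 := hr.symm.pos
  have hp1 : 1 ≤ p.toReal := by
    have : 1 ≤ p := Fact.out
    simpa using ENNReal.toReal_mono hp this
  have hq1 : 1 ≤ q'.toReal := by
    have : 1 ≤ q' := Fact.out
    simpa using ENNReal.toReal_mono hq' this
  have hp0 : 0 < p.toReal := by linarith
  have ht1 : 1 < t := by rw [ht, one_lt_div hp0]; exact hpr
  have ht0 : 0 < t := by linarith
  have hc := Real.HolderConjugate.conjExponent ht1
  have ht' := hc.symm.pos
  set t' := t.conjExponent with ht'def
  have htr : t * p.toReal = r := by rw [ht]; field_simp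
  set θ := 1 / p.toReal with hθ
  have hθ0 : 0 < θ := by positivity
  have hθ1 : θ ≤ 1 := by rw [hθ, div_le_one hp0]; exact hp1
  set m₁ := p.toReal * t' with hm₁
  have hm₁0 : 0 < m₁ := by positivity
  have hθm₁ : θ * m₁ = t' := by rw [hθ, hm₁]; field_simp
  have hθm₂ : θ * (r * s) = t * s := by rw [hθ, ← htr]; field_simp
  have htθ : 1 / t * θ = 1 / r := by rw [hθ, ← htr]; field_simp
  obtain ⟨C₁, hC₁⟩ := exists_bump_exponent hd hp1 hpr hm₁0 (by
    have := hc.inv_add_inv_eq_one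
    rw [hm₁, ← htr]
    field_simp at this ⊢
    linarith)
  obtain ⟨C₂, hC₂⟩ := exists_bump_exponent hd hq1 hqr (m := r * s) (by positivity) hqs
  -- The factor `n` counts basis vectors, `4` is the product of the two bump constants, `2 ^ n`
  -- comes from the adapted basis, and `C₁`, `C₂` from the maximal functions.
  refine ⟨(Real.toNNReal γ)⁻¹ * n * 4 * ((2 ^ n) ^ t) ^ (1 / r) * C₁ ^ (1 / r) * C₂ ^ (1 / r'), ?_⟩
  intro B₁ B₂ _ _ _ _ 𝒟 h𝒟 W hW hA hRH f g 𝒬 h𝒬 hsp hf hg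
  -- For `n = 0` there is no unit vector from which to derive `1 ≤ K₁` and `1 ≤ K₂`, but the form
  -- vanishes.
  rcases Nat.eq_zero_or_pos n with rfl | hn
  · refine le_trans (le_of_eq ?_) zero_le
    refine ENNReal.tsum_eq_zero.2 fun Q => ?_
    have := ofReal_bodyDot_le (hf Q) (hg Q) (EuclideanSpace.basisFun (Fin 0) ℝ)
    rw [Finset.univ_eq_empty, Finset.sum_empty, nonpos_iff_eq_zero] at this
    rw [localBody, localBody, this, mul_zero]
  -- the constants are at least `1`
  have hne : ∀ {e : EuclideanSpace ℝ (Fin n)}, ‖e‖ = 1 → e ≠ 0 := by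
    rintro e he rfl; simp at he
  set A := ApConst W t
  set R := RHConst W t s
  set e₀ : EuclideanSpace ℝ (Fin n) := EuclideanSpace.single ⟨0, hn⟩ 1
  have he₀ : e₀ ≠ 0 := hne (by simp [e₀])
  have hQ₀ : cube (0 : Fin d → ℝ) 1 ∈ cubes d := ⟨0, 1, one_pos, rfl⟩
  have := isProbabilityMeasure_avgMeasure hQ₀
  have hdfin : ∀ Q ∈ cubes d, ∀ {e : EuclideanSpace ℝ (Fin n)}, e ≠ 0 →
      ∫⁻ x, normMulVec (matPow (W x) (1 / t)) e ^ (t * s) ∂avgMeasure Q ≠ ∞ := by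
    intro Q hQ e he
    refine ne_top_of_le_ne_top ?_ (hW.reverseHolder_le ht1 hs hA hQ he)
    exact ENNReal.rpow_ne_top_of_nonneg hs.le
      (ENNReal.mul_ne_top hRH.ne (hW.lintegral_direct_ne_top ht1 hA hQ e))
  set K₁ : ℝ≥0 := (A ^ (t' - 1)).toNNReal with hK₁
  set K₂ : ℝ≥0 := ((A * R) ^ s).toNNReal with hK₂
  have hK₁' : (K₁ : ℝ≥0∞) = A ^ (t' - 1) := ENNReal.coe_toNNReal
    (ENNReal.rpow_ne_top_of_nonneg hc.symm.sub_one_pos.le hA.ne)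
  have hK₂' : (K₂ : ℝ≥0∞) = (A * R) ^ s := ENNReal.coe_toNNReal
    (ENNReal.rpow_ne_top_of_nonneg hs.le (ENNReal.mul_ne_top hA.ne hRH.ne))
  have hK₁1 : 1 ≤ K₁ := by
    have := one_le_of_sq_bound ((hW.aemeasurable_normMulVec_avg (-(1 / t)) e₀ _).pow_const t')
      (hW.lintegral_normMulVec_ne_zero _ he₀ hQ₀ ht') (hW.lintegral_dual_ne_top ht1 hA hQ₀ e₀)
      (hW.dual_sq_le ht1 hQ₀ he₀)
    rw [← ht'def, ← hK₁'] at this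
    exact_mod_cast this
  have hK₂1 : 1 ≤ K₂ := by
    have := one_le_of_sq_bound ((hW.aemeasurable_normMulVec_avg (1 / t) e₀ _).pow_const (t * s))
      (hW.lintegral_normMulVec_ne_zero _ he₀ hQ₀ (by positivity)) (hdfin _ hQ₀ he₀)
      (hW.direct_sq_le ht1 hs hA hQ₀ he₀)
    rw [← hK₂'] at this
    exact_mod_cast this
  obtain ⟨κ₁, hκ₁, hmax₁, hbump₁⟩ := hC₁ K₁ hK₁1
  obtain ⟨κ₂, hκ₂, hmax₂, hbump₂⟩ := hC₂ K₂ hK₂1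
  have hfm : ∀ i, AEStronglyMeasurable (f i) volume := fun i => (f i).aestronglyMeasurable
  have hgm : ∀ i, AEStronglyMeasurable (g i) volume := fun i => (g i).aestronglyMeasurable
  set h : (Fin d → ℝ) → ℝ≥0∞ := fun x => ‖matAct (matPow (W x) (1 / r)) fun i => f i x‖ₑ with hh
  set k : (Fin d → ℝ) → ℝ≥0∞ := fun x => ‖matAct (matPow (W x) (-(1 / r))) fun i => g i x‖ₑ with hk
  have hhm : AEMeasurable h volume := (hW.aestronglyMeasurable_matAct (1 / r) hfm).enorm
  have hkm : AEMeasurable k volume := (hW.aestronglyMeasurable_matAct (-(1 / r)) hgm).enorm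
  set D : ℝ≥0∞ := n * (4 * (((2 : ℝ≥0∞) ^ n) ^ t * (A * R)) ^ (1 / r)) with hD
  -- the estimate on a single cube
  have hloc : ∀ Q : 𝒬, ENNReal.ofReal (bodyDot (localBody p (Q : Set (Fin d → ℝ)) f (hf Q))
      (localBody q' (Q : Set (Fin d → ℝ)) g (hg Q))) ≤
      D * ((⨍⁻ x in Q, h x ^ κ₁ ∂volume) ^ (1 / κ₁) *
        (⨍⁻ x in Q, k x ^ κ₂ ∂volume) ^ (1 / κ₂)) := by
    intro Q
    have hQ : (Q : Set (Fin d → ℝ)) ∈ cubes d := h𝒟.mem_cubes (h𝒬 Q.2)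
    obtain ⟨e, he⟩ := hW.exists_basis ht1 hA hQ
    have hei : ∀ i, ‖e i‖ = 1 := e.orthonormal.1
    refine (ofReal_bodyDot_le (hf Q) (hg Q) e).trans ?_
    refine (Finset.sum_le_card_nsmul _ _ (4 * (((2 : ℝ≥0∞) ^ n) ^ t * (A * R)) ^ (1 / r) *
      ((⨍⁻ x in Q, h x ^ κ₁ ∂volume) ^ (1 / κ₁) *
        (⨍⁻ x in Q, k x ^ κ₂ ∂volume) ^ (1 / κ₂))) fun i _ => ?_).trans (le_of_eq ?_)
    swap
    · rw [Finset.card_univ, Fintype.card_fin, nsmul_eq_mul, hD]; ring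
    have b1 := hW.local_norm_le hp hbump₁ (1 / t) hθ0 hθ1 hfm (hei i) (fun S hS => by
      rw [hθm₁, hK₁']; exact hW.dual_sq_le ht1 hS (hne (hei i))) hQ (by
      rw [hθm₁]; exact hW.lintegral_dual_ne_top ht1 hA hQ (e i))
    have b2 := hW.local_norm_le hq' hbump₂ (-(1 / t)) hθ0 hθ1 hgm (hei i) (fun S hS => by
      rw [hθm₂, hK₂', neg_neg]; exact hW.direct_sq_le ht1 hs hA hS (hne (hei i))) hQ (by
      rw [hθm₂, neg_neg]; exact hdfin _ hQ (hne (hei i)))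
    rw [hθm₁, htθ] at b1
    rw [hθm₂, neg_neg, neg_mul, htθ] at b2
    refine (mul_le_mul' b1 b2).trans ?_
    set U := ∫⁻ y, normMulVec (matPow (W y) (-(1 / t))) (e i) ^ t' ∂avgMeasure (Q : Set (Fin d → ℝ))
    set V := ∫⁻ y, normMulVec (matPow (W y) (1 / t)) (e i) ^ t ∂avgMeasure (Q : Set (Fin d → ℝ))
    have hV : (∫⁻ x, normMulVec (matPow (W x) (1 / t)) (e i) ^ (t * s)
        ∂avgMeasure (Q : Set (Fin d → ℝ))) ^ (1 / (r * s)) ≤ (R * V) ^ (1 / r) := by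
      refine (ENNReal.rpow_le_rpow (hW.reverseHolder_le ht1 hs hA hQ (hne (hei i)))
        (by positivity)).trans (le_of_eq ?_)
      rw [← ENNReal.rpow_mul]; congr 1; field_simp
    have hU : U ^ (1 / m₁) = (U ^ (t / t')) ^ (1 / r) := by
      rw [← ENNReal.rpow_mul, hm₁, ← htr]; congr 1; field_simp
    have hUV : U ^ (1 / m₁) * (R * V) ^ (1 / r) ≤ (((2 : ℝ≥0∞) ^ n) ^ t * (A * R)) ^ (1 / r) := by
      rw [hU, ← ENNReal.mul_rpow_of_nonneg _ _ (by positivity)]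
      refine ENNReal.rpow_le_rpow ?_ (by positivity)
      calc U ^ (t / t') * (R * V) = U ^ (t / t') * V * R := by ring
        _ ≤ ((2 : ℝ≥0∞) ^ n) ^ t * A * R := mul_le_mul' (he i) le_rfl
        _ = _ := by ring
    calc _ ≤ 2 * U ^ (1 / m₁) * (⨍⁻ x in Q, h x ^ κ₁ ∂volume) ^ (1 / κ₁) *
          (2 * (R * V) ^ (1 / r) * (⨍⁻ x in Q, k x ^ κ₂ ∂volume) ^ (1 / κ₂)) := by
          exact mul_le_mul' le_rfl (mul_le_mul' (mul_le_mul' le_rfl hV) le_rfl)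
      _ = 4 * (U ^ (1 / m₁) * (R * V) ^ (1 / r)) * ((⨍⁻ x in Q, h x ^ κ₁ ∂volume) ^ (1 / κ₁) *
          (⨍⁻ x in Q, k x ^ κ₂ ∂volume) ^ (1 / κ₂)) := by ring
      _ ≤ _ := by gcongr
  set X := ∫⁻ x, h x ^ r with hX
  set Y := ∫⁻ x, k x ^ r' with hY
  have hmain : ∑' Q : 𝒬, volume (Q : Set (Fin d → ℝ)) * ENNReal.ofReal (bodyDot
        (localBody p (Q : Set (Fin d → ℝ)) f (hf Q)) (localBody q' (Q : Set (Fin d → ℝ)) g (hg Q)))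
      ≤ (ENNReal.ofReal γ)⁻¹ * (D * ((C₁ * K₁ * X) ^ (1 / r) * (C₂ * K₂ * Y) ^ (1 / r'))) := by
    classical
    -- Finite subfamilies suffice, and the maximal functions are taken over the same finite
    -- subfamily.
    rw [ENNReal.tsum_eq_iSup_sum]
    refine iSup_le fun 𝒮 => ?_
    obtain ⟨E, hE, hEd⟩ := hsp
    set 𝒮' : Finset (Set (Fin d → ℝ)) := 𝒮.map (Function.Embedding.subtype _) with h𝒮'
    have hsub : (𝒮' : Set (Set (Fin d → ℝ))) ⊆ 𝒬 := by
      intro Q hQ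
      obtain ⟨Q', -, rfl⟩ := Finset.mem_map.1 (Finset.mem_coe.1 hQ)
      exact Q'.2
    have hlam := (h𝒟.isLaminar hd).mono (hsub.trans h𝒬)
    set F := maxFn volume 𝒮' fun y => h y ^ κ₁
    set G := maxFn volume 𝒮' fun y => k y ^ κ₂
    have hFm : Measurable F := measurable_maxFn hlam _
    have hGm : Measurable G := measurable_maxFn hlam _
    calc _ ≤ ∑ Q ∈ 𝒮, volume (Q : Set (Fin d → ℝ)) *
          (D * ((⨍⁻ x in Q, h x ^ κ₁ ∂volume) ^ (1 / κ₁) *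
            (⨍⁻ x in Q, k x ^ κ₂ ∂volume) ^ (1 / κ₂))) :=
          Finset.sum_le_sum fun Q _ => mul_le_mul' le_rfl (hloc Q)
      _ = ∑ Q ∈ 𝒮', volume Q * (D * ((⨍⁻ x in Q, h x ^ κ₁ ∂volume) ^ (1 / κ₁) *
            (⨍⁻ x in Q, k x ^ κ₂ ∂volume) ^ (1 / κ₂))) := by
          rw [h𝒮', Finset.sum_map]; rfl
      _ ≤ (ENNReal.ofReal γ)⁻¹ * ∫⁻ x, D * (F x ^ (1 / κ₁) * G x ^ (1 / κ₂)) := by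
          refine sum_sparse_le hγ (fun Q hQ => hE Q (hsub hQ)) (hEd.subset hsub) fun Q hQ x hx => ?_
          gcongr
          · exact laverage_le_maxFn (fun y => h y ^ κ₁) hQ hx
          · exact laverage_le_maxFn (fun y => k y ^ κ₂) hQ hx
      _ = (ENNReal.ofReal γ)⁻¹ * (D * ∫⁻ x, F x ^ (1 / κ₁) * G x ^ (1 / κ₂)) := by
          rw [lintegral_const_mul _ (by exact (hFm.pow_const _).mul (hGm.pow_const _))]
      _ ≤ _ := by
          gcongr
          refine (lintegral_rpow_mul_rpow_le hr hFm hGm).trans ?_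
          gcongr
          · exact hmax₁ 𝒮' h hlam hhm
          · exact hmax₂ 𝒮' k hlam hkm
  refine hmain.trans (le_of_eq ?_)
  have i1 : 0 ≤ 1 / r := by positivity
  have i2 : 0 ≤ 1 / r' := by positivity
  have eA : A ^ (t' / r + s / r') = A ^ (1 / r) * A ^ ((t' - 1) * (1 / r)) * A ^ (s * (1 / r')) := by
    have := hc.symm.sub_one_pos.le
    rw [← ENNReal.rpow_add_of_nonneg _ _ i1 (by positivity),
      ← ENNReal.rpow_add_of_nonneg _ _ (by positivity) (by positivity)]
    congr 1; ring
  have eR : R ^ (1 / r + s / r') = R ^ (1 / r) * R ^ (s * (1 / r')) := by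
    rw [← ENNReal.rpow_add_of_nonneg _ _ i1 (by positivity)]
    congr 1; ring
  have eγ : ((Real.toNNReal γ)⁻¹ : ℝ≥0∞) = (ENNReal.ofReal γ)⁻¹ := rfl
  have hγN : Real.toNNReal γ ≠ 0 := by simpa using hγ
  rw [hD, eA, eR, hK₁', hK₂']
  push_cast
  rw [ENNReal.coe_inv hγN, eγ]
  rw [ENNReal.coe_rpow_of_nonneg _ i1, ENNReal.coe_rpow_of_nonneg _ i1,
    ENNReal.coe_rpow_of_nonneg _ i2, ENNReal.coe_rpow_of_nonneg _ ht0.le]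
  push_cast
  simp only [ENNReal.mul_rpow_of_nonneg _ _ i1, ENNReal.mul_rpow_of_nonneg _ _ i2,
    ENNReal.mul_rpow_of_nonneg _ _ hs.le, ← ENNReal.rpow_mul]
  ring

end Form

/-! ### Approximation by dyadic step functions -/

section Step

open Filter Topology

variable {d : ℕ}

open Classical in
/-- The average of `b` over the cubes of generation `m`. -/
def stepAvg (a : Fin d → ℝ) (ℓ : ℝ) (m : ℕ) (b : (Fin d → ℝ) → ℝ) (x : Fin d → ℝ) : ℝ :=
  ∑ k ∈ Fintype.piFinset fun _ : Fin d => Finset.range (2 ^ m),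
    (gridCube a ℓ m k).indicator (fun _ => ⨍ y in gridCube a ℓ m k, b y) x

theorem stepAvg_of_mem {a : Fin d → ℝ} {ℓ : ℝ} (hℓ : 0 < ℓ) (m : ℕ) (b : (Fin d → ℝ) → ℝ)
    {x : Fin d → ℝ} (hx : x ∈ cube a ℓ) :
    stepAvg a ℓ m b x = ⨍ y in gridCube a ℓ m (gridIndex a ℓ m x), b y := by
  classical
  rw [stepAvg, Finset.sum_eq_single (gridIndex a ℓ m x)]
  · rw [Set.indicator_of_mem (mem_gridCube_gridIndex hℓ m hx)]
  · intro k _ hk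
    refine Set.indicator_of_notMem (fun h => hk ?_) _
    exact ((mem_gridCube_iff hℓ hx).1 h).symm
  · intro h
    refine absurd ?_ h
    simpa [Fintype.mem_piFinset] using gridIndex_lt hℓ m hx

theorem stepAvg_of_notMem {a : Fin d → ℝ} {ℓ : ℝ} (hℓ : 0 < ℓ) (m : ℕ) (b : (Fin d → ℝ) → ℝ)
    {x : Fin d → ℝ} (hx : x ∉ cube a ℓ) : stepAvg a ℓ m b x = 0 := by
  refine Finset.sum_eq_zero fun k hk => Set.indicator_of_notMem (fun h => hx ?_) _
  exact gridCube_subset hℓ (by simpa [Fintype.mem_piFinset] using hk) h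

theorem measurable_stepAvg (a : Fin d → ℝ) (ℓ : ℝ) (m : ℕ) (b : (Fin d → ℝ) → ℝ) :
    Measurable (stepAvg a ℓ m b) :=
  Finset.measurable_fun_sum _ fun _ _ => measurable_const.indicator (measurableSet_cube _ _)

theorem abs_stepAvg_le {a : Fin d → ℝ} {ℓ : ℝ} (hℓ : 0 < ℓ) (m : ℕ) {b : (Fin d → ℝ) → ℝ} {M : ℝ}
    (hb : ∀ x, |b x| ≤ M) (x : Fin d → ℝ) : |stepAvg a ℓ m b x| ≤ M := by
  by_cases hx : x ∈ cube a ℓ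
  · rw [stepAvg_of_mem hℓ m b hx, setAverage_eq, smul_eq_mul, abs_mul]
    set R := gridCube a ℓ m (gridIndex a ℓ m x)
    have h0 : volume R ≠ 0 := volume_cube_ne_zero _ (by positivity)
    have ht : volume R ≠ ∞ := volume_cube_ne_top _ _
    have hR : 0 < volume.real R := ENNReal.toReal_pos h0 ht
    have h1 := norm_setIntegral_le_of_norm_le_const (f := b) (C := M) ht.lt_top fun y _ => hb y
    rw [Real.norm_eq_abs] at h1
    rw [abs_of_pos (inv_pos.2 hR), inv_mul_le_iff₀ hR, mul_comm]
    exact h1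
  · rw [stepAvg_of_notMem hℓ m b hx, abs_zero]
    exact (abs_nonneg _).trans (hb x)

theorem ae_tendsto_stepAvg {a : Fin d → ℝ} {ℓ : ℝ} (hℓ : 0 < ℓ) {b : (Fin d → ℝ) → ℝ}
    (hb : Measurable b) {M : ℝ} (hM : ∀ x, |b x| ≤ M) (hsupp : ∀ x ∉ cube a ℓ, b x = 0) :
    ∀ᵐ x, Tendsto (fun m => stepAvg a ℓ m b x) atTop (𝓝 (b x)) := by
  have hint : LocallyIntegrable b volume := by
    have h1 : LocallyIntegrable (fun _ : Fin d → ℝ => M) volume := locallyIntegrable_const M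
    refine h1.mono hb.aestronglyMeasurable (Eventually.of_forall fun x => ?_)
    exact (hM x).trans (le_abs_self M)
  filter_upwards [ae_tendsto_average_gridCube a hℓ hint] with x hx
  by_cases hxQ : x ∈ cube a ℓ
  · simp only [stepAvg_of_mem hℓ _ b hxQ]
    exact hx hxQ
  · simp only [stepAvg_of_notMem hℓ _ b hxQ, hsupp x hxQ]
    exact tendsto_const_nhds

theorem exists_stepFunction {𝒟 : Set (Set (Fin d → ℝ))} (h𝒟 : ∀ Q ∈ 𝒟, MeasurableSet Q)
    {B : Type*} [NormedAddCommGroup B] [NormedSpace ℝ B] {ι : Type*} (s : Finset ι)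
    (R : ι → Set (Fin d → ℝ)) (hR : ∀ i ∈ s, R i ∈ 𝒟) (c : ι → B) :
    ∃ g ∈ stepFunctions 𝒟 B, ⇑g =ᵐ[volume] fun x => ∑ i ∈ s, (R i).indicator (fun _ => c i) x := by
  classical
  induction s using Finset.induction_on with
  | empty =>
    refine ⟨0, Submodule.zero_mem _, ?_⟩
    simp only [Finset.sum_empty]
    exact AEEqFun.coeFn_zero
  | insert i s hi ih =>
    obtain ⟨g, hg, hg'⟩ := ih fun i hi => hR i (Finset.mem_insert_of_mem hi)
    have hRi := hR i (Finset.mem_insert_self i s)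
    have hm : AEStronglyMeasurable ((R i).indicator fun _ => c i) volume :=
      (stronglyMeasurable_const.indicator (h𝒟 _ hRi)).aestronglyMeasurable
    have hmem : AEEqFun.mk _ hm ∈ stepFunctions 𝒟 B :=
      Submodule.subset_span ⟨R i, hRi, c i, AEEqFun.coeFn_mk _ hm⟩
    refine ⟨AEEqFun.mk _ hm + g, Submodule.add_mem _ hmem hg, ?_⟩
    filter_upwards [AEEqFun.coeFn_add (AEEqFun.mk _ hm) g, AEEqFun.coeFn_mk _ hm, hg'] with x h1 h2 h3
    rw [h1, Pi.add_apply, h2, h3, Finset.sum_insert hi]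

theorem exists_stepFunction_stepAvg {𝒟 : Set (Set (Fin d → ℝ))} (hd : 0 < d)
    (h𝒟 : IsDyadicLattice 𝒟) {a : Fin d → ℝ} {ℓ : ℝ} (hℓ : 0 < ℓ) (hQ : cube a ℓ ∈ 𝒟)
    {B : Type*} [NormedAddCommGroup B] [NormedSpace ℝ B] {ι : Type*} [Fintype ι]
    (c : ι → B) (b : ι → (Fin d → ℝ) → ℝ) (m : ℕ) :
    ∃ g ∈ stepFunctions 𝒟 B, ⇑g =ᵐ[volume] fun x => ∑ j, stepAvg a ℓ m (b j) x • c j := by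
  classical
  obtain ⟨g, hg, hg'⟩ := exists_stepFunction (h𝒟.isLaminar hd).measurableSet
    ((Finset.univ : Finset ι) ×ˢ Fintype.piFinset fun _ : Fin d => Finset.range (2 ^ m))
    (fun z => gridCube a ℓ m z.2) (fun z hz => h𝒟.gridCube_mem hℓ hQ (by
      simpa [Fintype.mem_piFinset] using hz))
    (fun z => (⨍ y in gridCube a ℓ m z.2, b z.1 y) • c z.1)
  refine ⟨g, hg, hg'.trans (Eventually.of_forall fun x => ?_)⟩
  simp only [Finset.sum_product, stepAvg, Finset.sum_smul]
  refine Finset.sum_congr rfl fun j _ => Finset.sum_congr rfl fun k _ => ?_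
  by_cases hx : x ∈ gridCube a ℓ m k <;> simp [hx]

end Step

/-! ### Extending a bound from step functions -/

section Extension

open Filter Topology

variable {d n : ℕ} {B : Type*} [NormedAddCommGroup B] [NormedSpace ℝ B]

theorem enorm_matAct_le (A : Matrix (Fin n) (Fin n) ℝ) (v : Fin n → B) {M : ℝ≥0∞}
    (hv : ∀ i, ‖v i‖ₑ ≤ M) : ‖matAct A v‖ₑ ≤ ∑ i, ∑ j, ‖A i j‖ₑ * M := by
  have h1 : matAct A v = ∑ i, PiLp.single 2 i (∑ j, A i j • v j) := by
    simp only [PiLp.single, matAct, ← WithLp.toLp_sum, Finset.univ_sum_single]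
  rw [h1]
  refine (enorm_sum_le _ _).trans (Finset.sum_le_sum fun i _ => ?_)
  rw [← ofReal_norm, PiLp.norm_single, ofReal_norm]
  refine (enorm_sum_le _ _).trans (Finset.sum_le_sum fun j _ => ?_)
  rw [enorm_smul]
  gcongr
  exact hv j

theorem continuous_matAct (A : Matrix (Fin n) (Fin n) ℝ) :
    Continuous fun v : Fin n → B => matAct A v := by
  refine (PiLp.continuous_toLp 2 fun _ : Fin n => B).comp (continuous_pi fun i => ?_)
  exact continuous_finsetSum _ fun j _ => (continuous_apply j).const_smul _

/-- The coefficients `b i j` are replaced by their averages over dyadic cubes of generation `m`,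
which gives admissible step functions; as `m → ∞` both sides converge by dominated convergence. The
functionals `α j` stay fixed, so only scalar Lebesgue differentiation is needed. -/
theorem bound_of_stepFunctions (hd : 0 < d) {𝒟 : Set (Set (Fin d → ℝ))}
    (h𝒟 : IsDyadicLattice 𝒟) {A : (Fin d → ℝ) → Matrix (Fin n) (Fin n) ℝ}
    (hA : ∀ i j, AEMeasurable (fun x => A x i j) volume) {q : ℝ} (hq : 0 < q)
    (hAloc : ∀ Q ∈ cubes d, ∀ M : ℝ≥0,
      ∫⁻ x in Q, (∑ i, ∑ j, ‖A x i j‖ₑ * M) ^ q ≠ ∞)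
    {F : Fin n → ((Fin d → ℝ) →ₘ[volume] B)} {N : ℝ≥0∞} (hN : N ≠ ∞)
    (hint : ∀ i, ∀ g ∈ stepFunctions 𝒟 (StrongDual ℝ B), Integrable (pairing (F i) g) volume)
    (hbound : ∀ g : Fin n → ((Fin d → ℝ) →ₘ[volume] StrongDual ℝ B),
      (∀ i, g i ∈ stepFunctions 𝒟 (StrongDual ℝ B)) →
      ENNReal.ofReal |∑ i, ∫ x, pairing (F i) (g i) x| ≤
        N * (∫⁻ x, ‖matAct (A x) fun i => g i x‖ₑ ^ q) ^ (1 / q))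
    {a : Fin d → ℝ} {ℓ : ℝ} (hℓ : 0 < ℓ) (hQ : cube a ℓ ∈ 𝒟) {ι : Type*} [Fintype ι]
    (α : ι → StrongDual ℝ B) {b : Fin n → ι → (Fin d → ℝ) → ℝ} (hb : ∀ i j, Measurable (b i j))
    {M : ℝ} (hM : ∀ i j x, |b i j x| ≤ M) (hsupp : ∀ i j, ∀ x ∉ cube a ℓ, b i j x = 0) :
    ENNReal.ofReal |∫ x, ∑ i, ∑ j, b i j x * α j (F i x)| ≤
      N * (∫⁻ x, ‖matAct (A x) fun i => ∑ j, b i j x • α j‖ₑ ^ q) ^ (1 / q) := by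
  have hQm := measurableSet_cube a ℓ
  have hG : ∀ m i, ∃ g ∈ stepFunctions 𝒟 (StrongDual ℝ B), ⇑g =ᵐ[volume]
      fun x => ∑ j, stepAvg a ℓ m (b i j) x • α j := fun m i =>
    exists_stepFunction_stepAvg hd h𝒟 hℓ hQ α (b i) m
  choose G hGs hGe using hG
  have htend : ∀ᵐ x, ∀ i j, Tendsto (fun m => stepAvg a ℓ m (b i j) x) atTop (𝓝 (b i j x)) :=
    ae_all_iff.2 fun i => ae_all_iff.2 fun j => ae_tendsto_stepAvg hℓ (hb i j) (hM i j) (hsupp i j)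
  -- The function `α j • 1_Q` is itself a step function, so its pairing with `F i` is integrable.
  -- This is the dominating function on the left.
  have hloc : ∀ i j, Integrable ((cube a ℓ).indicator fun x => α j (F i x)) volume := by
    intro i j
    obtain ⟨g, hg, hg'⟩ := exists_stepFunction (h𝒟.isLaminar hd).measurableSet
      (Finset.univ : Finset Unit) (fun _ => cube a ℓ) (fun _ _ => hQ) fun _ => α j
    refine (hint i g hg).congr ?_
    filter_upwards [hg'] with x hx
    rw [pairing, hx]
    by_cases hxQ : x ∈ cube a ℓ <;> simp [hxQ]
  have hFm : ∀ i j, AEStronglyMeasurable (fun x => α j (F i x)) volume := fun i j =>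
    (α j).continuous.comp_aestronglyMeasurable (F i).aestronglyMeasurable
  have hbint : ∀ i j, Integrable (fun x => b i j x * α j (F i x)) volume := by
    intro i j
    refine ((hloc i j).norm.const_mul M).mono' ((hb i j).aestronglyMeasurable.mul (hFm i j))
      (Eventually.of_forall fun x => ?_)
    by_cases hx : x ∈ cube a ℓ
    · rw [Set.indicator_of_mem hx, norm_mul]
      gcongr
      exact hM i j x
    · simp [hsupp i j x hx, hx]
  rw [integral_finsetSum _ fun i _ => integrable_finsetSum _ fun j _ => hbint i j]
  have hL : Tendsto (fun m => ENNReal.ofReal |∑ i, ∫ x, pairing (F i) (G m i) x|) atTop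
      (𝓝 (ENNReal.ofReal |∑ i, ∫ x, ∑ j, b i j x * α j (F i x)|)) := by
    refine ENNReal.tendsto_ofReal (Tendsto.abs (tendsto_finsetSum _ fun i _ => ?_))
    have e1 : ∀ m, ∫ x, pairing (F i) (G m i) x =
        ∫ x, ∑ j, stepAvg a ℓ m (b i j) x * α j (F i x) := fun m => by
      refine integral_congr_ae ?_
      filter_upwards [hGe m i] with x hx
      rw [pairing, hx]
      simp
    simp only [e1]
    refine tendsto_integral_of_dominated_convergence
      (fun x => ∑ j, M * ‖(cube a ℓ).indicator (fun x => α j (F i x)) x‖) (fun m => ?_)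
      (integrable_finsetSum _ fun j _ => (hloc i j).norm.const_mul M)
      (fun m => Eventually.of_forall fun x => ?_) ?_
    · exact Finset.aestronglyMeasurable_fun_sum _ fun j _ =>
        (measurable_stepAvg a ℓ m (b i j)).aestronglyMeasurable.mul (hFm i j)
    · refine (norm_sum_le _ _).trans (Finset.sum_le_sum fun j _ => ?_)
      by_cases hx : x ∈ cube a ℓ
      · rw [Set.indicator_of_mem hx, norm_mul]
        gcongr
        exact abs_stepAvg_le hℓ m (hM i j) x
      · rw [stepAvg_of_notMem hℓ m _ hx, Set.indicator_of_notMem hx]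
        simp
    · filter_upwards [htend] with x hx
      exact tendsto_finsetSum _ fun j _ => (hx i j).mul_const _
  set M' : ℝ≥0 := Real.toNNReal M * ∑ j, ‖α j‖₊ with hM'
  have hMle : ∀ {c : ι → ℝ}, (∀ j, |c j| ≤ M) → ‖∑ j, c j • α j‖ₑ ≤ M' := by
    intro c hc
    refine (enorm_sum_le Finset.univ fun j => c j • α j).trans ?_
    rw [hM']
    push_cast
    rw [Finset.mul_sum]
    refine Finset.sum_le_sum fun j _ => ?_
    rw [enorm_smul]
    refine mul_le_mul' ?_ le_rfl
    rw [← ofReal_norm, Real.norm_eq_abs]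
    exact ENNReal.ofReal_le_ofReal (hc j)
  have hR : Tendsto (fun m => ∫⁻ x, ‖matAct (A x) fun i => G m i x‖ₑ ^ q) atTop
      (𝓝 (∫⁻ x, ‖matAct (A x) fun i => ∑ j, b i j x • α j‖ₑ ^ q)) := by
    have e2 : ∀ m, ∫⁻ x, ‖matAct (A x) fun i => G m i x‖ₑ ^ q =
        ∫⁻ x, ‖matAct (A x) fun i => ∑ j, stepAvg a ℓ m (b i j) x • α j‖ₑ ^ q := fun m => by
      refine lintegral_congr_ae ?_
      filter_upwards [ae_all_iff.2 fun i => hGe m i] with x hx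
      simp only [hx]
    simp only [e2]
    refine tendsto_lintegral_of_dominated_convergence'
      ((cube a ℓ).indicator fun x => (∑ i, ∑ j, ‖A x i j‖ₑ * M') ^ q) (fun m => ?_)
      (fun m => Eventually.of_forall fun x => ?_) ?_ ?_
    · refine AEMeasurable.pow_const (AEStronglyMeasurable.enorm ?_) _
      refine aestronglyMeasurable_toLp fun i => ?_
      refine Finset.aestronglyMeasurable_fun_sum _ fun l _ => ?_
      refine (hA i l).aestronglyMeasurable.smul ?_
      exact Finset.aestronglyMeasurable_fun_sum _ fun j _ =>
        (measurable_stepAvg a ℓ m (b l j)).aestronglyMeasurable.smul_const (α j)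
    · by_cases hx : x ∈ cube a ℓ
      · rw [Set.indicator_of_mem hx]
        refine ENNReal.rpow_le_rpow (enorm_matAct_le _ _ fun i => hMle fun j => ?_) hq.le
        exact abs_stepAvg_le hℓ m (hM i j) x
      · simp only [stepAvg_of_notMem hℓ m _ hx, zero_smul, Finset.sum_const_zero]
        have h0 : ‖matAct (A x) fun _ : Fin n => (0 : StrongDual ℝ B)‖ₑ = 0 := by
          refine le_antisymm ((enorm_matAct_le (M := 0) (A x) _ fun i => ?_).trans ?_) zero_le
          · simp
          · simp
        rw [h0, ENNReal.zero_rpow_of_pos hq]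
        exact zero_le
    · rw [lintegral_indicator hQm]
      exact hAloc _ (h𝒟.mem_cubes hQ) M'
    · filter_upwards [htend] with x hx
      refine (ENNReal.continuous_rpow_const.tendsto _).comp ?_
      refine (continuous_enorm.tendsto _).comp ?_
      refine ((continuous_matAct (A x)).tendsto _).comp ?_
      exact tendsto_pi_nhds.2 fun i => tendsto_finsetSum _ fun j _ => (hx i j).smul_const _
  refine le_of_tendsto_of_tendsto' hL
    (ENNReal.Tendsto.const_mul ((ENNReal.continuous_rpow_const.tendsto _).comp hR) (Or.inr hN))
    fun m => hbound (G m) (hGs m)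

end Extension

/-! ### Duality -/

section Duality

open Filter Topology

/-- Take norming functionals of a dense sequence. The zero functional is put in front so that the
maximum of the first few values is never negative. -/
theorem exists_norming_sequence {B : Type*} [NormedAddCommGroup B] [NormedSpace ℝ B] {S : Set B}
    (hS : TopologicalSpace.IsSeparable S) :
    ∃ α : ℕ → StrongDual ℝ B, α 0 = 0 ∧ (∀ j, ‖α j‖ ≤ 1) ∧
      ∀ w ∈ S, ∀ c < ‖w‖, ∃ j, c < α j w := by
  obtain ⟨D, hD, hSD⟩ := hS
  obtain ⟨u, hu⟩ := (hD.insert 0).exists_eq_range (Set.insert_nonempty _ _)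
  choose φ hφ1 hφ2 using fun m => exists_dual_vector'' ℝ (u m)
  refine ⟨fun j => Nat.casesOn j 0 φ, rfl, fun j => ?_, fun w hw c hc => ?_⟩
  · cases j with
    | zero => simp
    | succ j => exact hφ1 j
  · obtain ⟨z, hz, hwz⟩ := Metric.mem_closure_iff.1 (hSD hw) ((‖w‖ - c) / 2) (by linarith)
    obtain ⟨m, rfl⟩ : z ∈ Set.range u := hu ▸ Set.mem_insert_of_mem _ hz
    refine ⟨m + 1, ?_⟩
    change c < φ m w
    rw [dist_eq_norm] at hwz
    have h1 : φ m (u m) = ‖u m‖ := hφ2 m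
    have h2 : |φ m (w - u m)| ≤ ‖w - u m‖ := by
      simpa using (φ m).le_of_opNorm_le (hφ1 m) (w - u m)
    have h3 : φ m w = φ m (u m) + φ m (w - u m) := by rw [map_sub]; ring
    have h4 : ‖w‖ ≤ ‖u m‖ + ‖w - u m‖ := by
      simpa using norm_add_le (u m) (w - u m)
    have h5 := neg_le_of_abs_le h2
    linarith

theorem exists_measurable_argmax {X : Type*} [MeasurableSpace X] {ψ : ℕ → X → ℝ}
    (hψ : ∀ j, Measurable (ψ j)) (m : ℕ) :
    ∃ J : X → ℕ, Measurable J ∧ (Measurable fun x => ψ (J x) x) ∧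
      ∀ x, J x ≤ m ∧ ∀ j ≤ m, ψ j x ≤ ψ (J x) x := by
  classical
  induction m with
  | zero => exact ⟨fun _ => 0, measurable_const, hψ 0, fun x => ⟨le_rfl, by simp⟩⟩
  | succ m ih =>
    obtain ⟨J, hJ, hJψ, hmax⟩ := ih
    have hset : MeasurableSet {x | ψ (J x) x < ψ (m + 1) x} := measurableSet_lt hJψ (hψ _)
    refine ⟨fun x => if ψ (J x) x < ψ (m + 1) x then m + 1 else J x,
      Measurable.ite hset measurable_const hJ, ?_, fun x => ?_⟩
    · have h1 : (fun x => ψ (if ψ (J x) x < ψ (m + 1) x then m + 1 else J x) x) =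
          fun x => if ψ (J x) x < ψ (m + 1) x then ψ (m + 1) x else ψ (J x) x := by
        funext x
        split_ifs <;> rfl
      rw [h1]
      exact Measurable.ite hset (hψ _) hJψ
    · obtain ⟨h1, h2⟩ := hmax x
      dsimp only
      split_ifs with h
      · refine ⟨le_rfl, fun j hj => ?_⟩
        rcases hj.lt_or_eq with hj | rfl
        · exact (h2 j (by omega)).trans h.le
        · exact le_rfl
      · refine ⟨by omega, fun j hj => ?_⟩
        rcases hj.lt_or_eq with hj | rfl
        · exact h2 j (by omega)
        · exact not_lt.1 h

/-- Division by `I^{1/r'}` is legitimate because `I` is finite; this is why the test functions are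
truncated. -/
theorem le_rpow_of_le_mul_rpow {r r' : ℝ} (hr : r.HolderConjugate r') {I N : ℝ≥0∞} (hI : I ≠ ∞)
    (h : I ≤ N * I ^ (1 / r')) : I ≤ N ^ r := by
  rcases eq_or_ne I 0 with rfl | h0
  · exact zero_le
  have h1 : I = I ^ (1 / r) * I ^ (1 / r') := by
    rw [← ENNReal.rpow_add _ _ h0 hI, one_div, one_div, hr.inv_add_inv_eq_one, ENNReal.rpow_one]
  have h2 : I ^ (1 / r) ≤ N := by
    have h3 : I ^ (1 / r') ≠ 0 := (ENNReal.rpow_pos (pos_iff_ne_zero.2 h0) hI).ne'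
    have h4 : I ^ (1 / r') ≠ ∞ := ENNReal.rpow_ne_top_of_nonneg hr.symm.one_div_nonneg hI
    exact (ENNReal.mul_le_mul_iff_left h3 h4).1 (h1.symm.le.trans h)
  calc I = (I ^ (1 / r)) ^ r := by
        rw [← ENNReal.rpow_mul, one_div_mul_cancel hr.ne_zero, ENNReal.rpow_one]
    _ ≤ N ^ r := ENNReal.rpow_le_rpow h2 hr.nonneg

section Bound

variable {d n : ℕ} {B : Type*} [NormedAddCommGroup B] [NormedSpace ℝ B]

theorem enorm_matAct_smul_le {A w : Matrix (Fin n) (Fin n) ℝ} (hAw : A * w = 1) (k : Fin n)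
    (φ : ℝ) {α : B} (hα : ‖α‖ ≤ 1) :
    ‖matAct A fun i => (φ * w i k) • α‖ₑ ≤ ENNReal.ofReal |φ| := by
  have h1 : (matAct A fun i => (φ * w i k) • α) = PiLp.single 2 k (φ • α) := by
    ext l
    have h2 : ∑ i, A l i • (φ * w i k) • α = ((A * w) l k * φ) • α := by
      rw [Matrix.mul_apply, Finset.sum_mul, Finset.sum_smul]
      refine Finset.sum_congr rfl fun i _ => ?_
      rw [smul_smul]
      congr 1; ring
    change ∑ i, A l i • (φ * w i k) • α = _
    rw [h2, hAw]
    by_cases h : l = k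
    · subst h; simp
    · simp [h, Matrix.one_apply_ne h]
  rw [h1, ← ofReal_norm, PiLp.norm_single, norm_smul, Real.norm_eq_abs]
  exact ENNReal.ofReal_le_ofReal (mul_le_of_le_one_right (abs_nonneg _) hα)

/-- The dual estimate on a bounded piece, for finitely many functionals. -/
theorem setLIntegral_max_rpow_le (hd : 0 < d) {𝒟 : Set (Set (Fin d → ℝ))}
    (h𝒟 : IsDyadicLattice 𝒟) {r r' : ℝ} (hr : r.HolderConjugate r')
    {A w : (Fin d → ℝ) → Matrix (Fin n) (Fin n) ℝ}
    (hA : ∀ i j, AEMeasurable (fun x => A x i j) volume)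
    (hw : ∀ i j, Measurable fun x => w x i j) (hAw : ∀ᵐ x, A x * w x = 1)
    (hAloc : ∀ Q ∈ cubes d, ∀ M : ℝ≥0,
      ∫⁻ x in Q, (∑ i, ∑ j, ‖A x i j‖ₑ * M) ^ r' ≠ ∞)
    {F : Fin n → ((Fin d → ℝ) →ₘ[volume] B)} {N : ℝ≥0∞} (hN : N ≠ ∞)
    (hint : ∀ i, ∀ g ∈ stepFunctions 𝒟 (StrongDual ℝ B), Integrable (pairing (F i) g) volume)
    (hbound : ∀ g : Fin n → ((Fin d → ℝ) →ₘ[volume] StrongDual ℝ B),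
      (∀ i, g i ∈ stepFunctions 𝒟 (StrongDual ℝ B)) →
      ENNReal.ofReal |∑ i, ∫ x, pairing (F i) (g i) x| ≤
        N * (∫⁻ x, ‖matAct (A x) fun i => g i x‖ₑ ^ r') ^ (1 / r'))
    (k : Fin n) {Q : Set (Fin d → ℝ)} (hQ : Q ∈ 𝒟) {α : ℕ → StrongDual ℝ B} (hα : ∀ j, ‖α j‖ ≤ 1)
    {J : (Fin d → ℝ) → ℕ} (hJ : Measurable J) {m : ℕ} (hJm : ∀ x, J x ≤ m)
    {S : (Fin d → ℝ) → ℝ} (hSm : Measurable S)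
    (hS : ∀ x, S x = α (J x) (∑ i, w x i k • F i x)) (hS0 : ∀ x, 0 ≤ S x) :
    ∫⁻ x in Q ∩ {x | S x ≤ m ∧ ∀ i, |w x i k| ≤ m}, ENNReal.ofReal (S x) ^ r ≤ N ^ r := by
  obtain ⟨a, ℓ, hℓ, rfl⟩ := h𝒟.mem_cubes hQ
  set Z := cube a ℓ ∩ {x | S x ≤ m ∧ ∀ i, |w x i k| ≤ m} with hZ
  have hr0 := hr.pos
  have hr'0 := hr.symm.pos
  have hr1 : 0 < r - 1 := sub_pos.2 hr.lt
  have hZm : MeasurableSet Z := by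
    refine (measurableSet_cube a ℓ).inter ((measurableSet_le hSm measurable_const).inter ?_)
    have : {x | ∀ i, |w x i k| ≤ (m : ℝ)} = ⋂ i, {x | |w x i k| ≤ (m : ℝ)} := by
      ext x; simp
    change MeasurableSet {x | ∀ i, |w x i k| ≤ (m : ℝ)}
    rw [this]
    exact MeasurableSet.iInter fun i => measurableSet_le (hw i k).abs measurable_const
  have hZfin : volume Z ≠ ∞ :=
    ne_top_of_le_ne_top (volume_cube_ne_top a ℓ) (measure_mono Set.inter_subset_left)
  -- The extremal test function is `gᵢ = S^{r-1} w_{ik} α_J` on `Z`, split according to the value of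
  -- `J` so that only finitely many functionals occur. Paired with `F` it gives `S^r`. Since `A w =
  -- 1`, `A g` has the single nonzero entry `S^{r-1} α_J`, in place `k`, whose norm to the power
  -- `r'` is at most `S^r`.
  let b : Fin n → Fin (m + 1) → (Fin d → ℝ) → ℝ := fun i j =>
    (Z ∩ J ⁻¹' {(j : ℕ)}).indicator fun x => S x ^ (r - 1) * w x i k
  have hbm : ∀ i j, Measurable (b i j) := fun i j =>
    ((hSm.pow_const _).mul (hw i k)).indicator (hZm.inter (hJ (measurableSet_singleton _)))
  have hM0 : (0 : ℝ) ≤ (m : ℝ) ^ (r - 1) * m := by positivity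
  have hbM : ∀ i j x, |b i j x| ≤ (m : ℝ) ^ (r - 1) * m := by
    intro i j x
    by_cases hx : x ∈ Z ∩ J ⁻¹' {(j : ℕ)}
    · have h1 : b i j x = S x ^ (r - 1) * w x i k := Set.indicator_of_mem hx _
      rw [h1, abs_mul, abs_of_nonneg (Real.rpow_nonneg (hS0 x) _)]
      exact mul_le_mul (Real.rpow_le_rpow (hS0 x) hx.1.2.1 hr1.le) (hx.1.2.2 i) (abs_nonneg _)
        (by positivity)
    · have h1 : b i j x = 0 := Set.indicator_of_notMem hx _
      rw [h1, abs_zero]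
      exact hM0
  have hbs : ∀ i j, ∀ x ∉ cube a ℓ, b i j x = 0 := fun i j x hx =>
    Set.indicator_of_notMem (fun h => hx h.1.1) _
  have hb1 : ∀ i x, x ∈ Z → ∀ c : StrongDual ℝ B → ℝ, ∑ j, b i j x * c (α j) =
      S x ^ (r - 1) * w x i k * c (α (J x)) := by
    intro i x hx c
    rw [Finset.sum_eq_single (⟨J x, Nat.lt_succ_of_le (hJm x)⟩ : Fin (m + 1))]
    · have h1 : b i ⟨J x, Nat.lt_succ_of_le (hJm x)⟩ x = S x ^ (r - 1) * w x i k :=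
        Set.indicator_of_mem (show x ∈ Z ∩ J ⁻¹' {J x} from ⟨hx, rfl⟩) _
      rw [h1]
    · intro j _ hj
      have h1 : b i j x = 0 :=
        Set.indicator_of_notMem (fun h => hj (Fin.ext (by simpa using h.2.symm))) _
      rw [h1, zero_mul]
    · simp
  have hb2 : ∀ i x, x ∈ Z → ∑ j, b i j x • α j = (S x ^ (r - 1) * w x i k) • α (J x) := by
    intro i x hx
    ext v
    simpa using hb1 i x hx fun β => β v
  have hb0 : ∀ i j x, x ∉ Z → b i j x = 0 := fun i j x hx =>
    Set.indicator_of_notMem (fun h => hx h.1) _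
  have hmain := bound_of_stepFunctions hd h𝒟 hA hr'0 hAloc hN hint hbound hℓ hQ
    (fun j : Fin (m + 1) => α j) hbm hbM hbs
  have hL : ∫ x, ∑ i, ∑ j, b i j x * α j (F i x) = ∫ x, Z.indicator (fun x => S x ^ r) x := by
    congr 1
    funext x
    by_cases hx : x ∈ Z
    · rw [Set.indicator_of_mem hx]
      have h1 : ∀ i, ∑ j, b i j x * α j (F i x) = S x ^ (r - 1) * (w x i k * α (J x) (F i x)) := by
        intro i
        rw [hb1 i x hx fun β => β (F i x), mul_assoc]
      simp only [h1]
      have h2 : ∑ i, w x i k * α (J x) (F i x) = S x := by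
        rw [hS x]; simp
      rw [← Finset.mul_sum, h2]
      rcases (hS0 x).eq_or_lt with h | h
      · rw [← h, Real.zero_rpow hr0.ne', mul_zero]
      · rw [← Real.rpow_add_one h.ne', sub_add_cancel]
    · rw [Set.indicator_of_notMem hx]
      exact Finset.sum_eq_zero fun i _ => Finset.sum_eq_zero fun j _ => by
        rw [hb0 i j x hx, zero_mul]
  set I := ∫⁻ x in Z, ENNReal.ofReal (S x) ^ r with hI
  have hIfin : I ≠ ∞ := by
    refine (setLIntegral_lt_top_of_le_nnreal hZfin ⟨(m : ℝ≥0) ^ r, fun x hx => ?_⟩).ne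
    rw [ENNReal.coe_rpow_of_nonneg _ hr0.le]
    refine ENNReal.rpow_le_rpow ?_ hr0.le
    exact (ENNReal.ofReal_le_ofReal hx.2.1).trans (by simp)
  have hLI : ENNReal.ofReal |∫ x, Z.indicator (fun x => S x ^ r) x| = I := by
    rw [integral_indicator hZm, abs_of_nonneg (integral_nonneg fun x => Real.rpow_nonneg (hS0 x) _),
      integral_eq_lintegral_of_nonneg_ae (Eventually.of_forall fun x => Real.rpow_nonneg (hS0 x) _)
        (hSm.pow_const _).aestronglyMeasurable]
    simp only [← ENNReal.ofReal_rpow_of_nonneg (hS0 _) hr0.le]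
    exact ENNReal.ofReal_toReal hIfin
  have hR : ∫⁻ x, ‖matAct (A x) fun i => ∑ j, b i j x • α j‖ₑ ^ r' ≤ I := by
    rw [hI, ← lintegral_indicator hZm]
    refine lintegral_mono_ae ?_
    filter_upwards [hAw] with x hx
    by_cases hxZ : x ∈ Z
    · rw [Set.indicator_of_mem hxZ]
      simp only [hb2 _ x hxZ]
      refine (ENNReal.rpow_le_rpow (enorm_matAct_smul_le hx k _ (hα _)) hr'0.le).trans ?_
      rw [abs_of_nonneg (Real.rpow_nonneg (hS0 x) _),
        ← ENNReal.ofReal_rpow_of_nonneg (hS0 x) hr1.le, ← ENNReal.rpow_mul, hr.sub_one_mul_conj]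
    · have h0 : ‖matAct (A x) fun i => ∑ j, b i j x • α j‖ₑ = 0 := by
        refine le_antisymm ((enorm_matAct_le (M := 0) (A x) _ fun i => ?_).trans ?_) zero_le
        · simp [hb0 i _ x hxZ]
        · simp
      rw [h0, ENNReal.zero_rpow_of_pos hr'0]
      exact zero_le
  rw [hL, hLI] at hmain
  exact le_rpow_of_le_mul_rpow hr hIfin (hmain.trans
    (mul_le_mul' le_rfl (ENNReal.rpow_le_rpow hR hr.symm.one_div_nonneg)))

/-- Strongly measurable functions have separable range, so countably many functionals norm all
values of the component. With `m` bounding at once the number of functionals, the region and the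
height, the truncations converge pointwise; Fatou removes them without any monotonicity in `m`. -/
theorem lintegral_component_rpow_le (hd : 0 < d) {𝒟 : Set (Set (Fin d → ℝ))}
    (h𝒟 : IsDyadicLattice 𝒟) {r r' : ℝ} (hr : r.HolderConjugate r')
    {A w : (Fin d → ℝ) → Matrix (Fin n) (Fin n) ℝ}
    (hA : ∀ i j, AEMeasurable (fun x => A x i j) volume)
    (hw : ∀ i j, Measurable fun x => w x i j) (hAw : ∀ᵐ x, A x * w x = 1)
    (hAloc : ∀ Q ∈ cubes d, ∀ M : ℝ≥0,
      ∫⁻ x in Q, (∑ i, ∑ j, ‖A x i j‖ₑ * M) ^ r' ≠ ∞)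
    {F : Fin n → ((Fin d → ℝ) →ₘ[volume] B)} {N : ℝ≥0∞} (hN : N ≠ ∞)
    (hint : ∀ i, ∀ g ∈ stepFunctions 𝒟 (StrongDual ℝ B), Integrable (pairing (F i) g) volume)
    (hbound : ∀ g : Fin n → ((Fin d → ℝ) →ₘ[volume] StrongDual ℝ B),
      (∀ i, g i ∈ stepFunctions 𝒟 (StrongDual ℝ B)) →
      ENNReal.ofReal |∑ i, ∫ x, pairing (F i) (g i) x| ≤
        N * (∫⁻ x, ‖matAct (A x) fun i => g i x‖ₑ ^ r') ^ (1 / r'))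
    (k : Fin n) : ∫⁻ x, ‖∑ i, w x i k • F i x‖ₑ ^ r ≤ N ^ r := by
  have hsep : TopologicalSpace.IsSeparable (⋃ i, Set.range (F i)) :=
    TopologicalSpace.IsSeparable.iUnion fun i => (F i).stronglyMeasurable.isSeparable_range
  obtain ⟨α, hα0, hα1, hα⟩ := exists_norming_sequence (hsep.span (R := ℝ))
  set v : (Fin d → ℝ) → B := fun x => ∑ i, w x i k • F i x with hv
  have hvS : ∀ x, v x ∈ (Submodule.span ℝ (⋃ i, Set.range (F i)) : Set B) := fun x =>
    Submodule.sum_mem _ fun i _ => Submodule.smul_mem _ _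
      (Submodule.subset_span (Set.mem_iUnion.2 ⟨i, x, rfl⟩))
  have hvm : StronglyMeasurable v := Finset.stronglyMeasurable_fun_sum _ fun i _ =>
    (hw i k).stronglyMeasurable.smul (F i).stronglyMeasurable
  have hψ : ∀ j, Measurable fun x => α j (v x) := fun j =>
    ((α j).continuous.comp_stronglyMeasurable hvm).measurable
  choose J hJ hS hmax using fun m => exists_measurable_argmax hψ m
  choose Q hQ hQsub using fun m : ℕ =>
    h𝒟.compact_subset _ (isCompact_closedBall (0 : Fin d → ℝ) m)
  have hS0 : ∀ m x, 0 ≤ α (J m x) (v x) := fun m x => by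
    simpa [hα0] using (hmax m x).2 0 (Nat.zero_le m)
  let Z : ℕ → Set (Fin d → ℝ) := fun m =>
    Q m ∩ {x | α (J m x) (v x) ≤ m ∧ ∀ i, |w x i k| ≤ m}
  have hZm : ∀ m, MeasurableSet (Z m) := fun m => by
    refine ((h𝒟.isLaminar hd).measurableSet _ (hQ m)).inter
      ((measurableSet_le (hS m) measurable_const).inter ?_)
    have : {x | ∀ i, |w x i k| ≤ (m : ℝ)} = ⋂ i, {x | |w x i k| ≤ (m : ℝ)} := by
      ext x; simp
    change MeasurableSet {x | ∀ i, |w x i k| ≤ (m : ℝ)}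
    rw [this]
    exact MeasurableSet.iInter fun i => measurableSet_le (hw i k).abs measurable_const
  let Φ : ℕ → (Fin d → ℝ) → ℝ≥0∞ := fun m =>
    (Z m).indicator fun x => ENNReal.ofReal (α (J m x) (v x)) ^ r
  have hΦm : ∀ m, Measurable (Φ m) := fun m =>
    ((hS m).ennreal_ofReal.pow_const _).indicator (hZm m)
  have hΦle : ∀ m, ∫⁻ x, Φ m x ≤ N ^ r := fun m => by
    rw [lintegral_indicator (hZm m)]
    exact setLIntegral_max_rpow_le hd h𝒟 hr hA hw hAw hAloc hN hint hbound k (hQ m) hα1 (hJ m)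
      (fun x => (hmax m x).1) (hS m) (fun _ => rfl) (hS0 m)
  have hlim : ∀ x, Tendsto (fun m => Φ m x) atTop (𝓝 (‖v x‖ₑ ^ r)) := by
    intro x
    have hub : ∀ m, α (J m x) (v x) ≤ ‖v x‖ := fun m =>
      (le_abs_self _).trans (by simpa using (α (J m x)).le_of_opNorm_le (hα1 _) (v x))
    have h1 : Tendsto (fun m => α (J m x) (v x)) atTop (𝓝 ‖v x‖) := by
      refine tendsto_order.2 ⟨fun c hc => ?_, fun c hc => Eventually.of_forall fun m =>
        (hub m).trans_lt hc⟩
      obtain ⟨j, hj⟩ := hα _ (hvS x) c hc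
      filter_upwards [eventually_ge_atTop j] with m hm
      exact hj.trans_le ((hmax m x).2 j hm)
    have h2 : Tendsto (fun m => ENNReal.ofReal (α (J m x) (v x)) ^ r) atTop (𝓝 (‖v x‖ₑ ^ r)) := by
      rw [← ofReal_norm]
      exact (ENNReal.continuous_rpow_const.tendsto _).comp (ENNReal.tendsto_ofReal h1)
    refine h2.congr' ?_
    filter_upwards [tendsto_natCast_atTop_atTop.eventually_ge_atTop ‖x‖,
      tendsto_natCast_atTop_atTop.eventually_ge_atTop ‖v x‖,
      eventually_all.2 fun i => tendsto_natCast_atTop_atTop.eventually_ge_atTop |w x i k|]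
      with m hm1 hm2 hm3
    exact (Set.indicator_of_mem (show x ∈ Z m from
      ⟨hQsub m (by simpa using hm1), (hub m).trans hm2, hm3⟩)
      fun x => ENNReal.ofReal (α (J m x) (v x)) ^ r).symm
  calc ∫⁻ x, ‖v x‖ₑ ^ r = ∫⁻ x, liminf (fun m => Φ m x) atTop :=
        lintegral_congr fun x => (hlim x).liminf_eq.symm
    _ ≤ liminf (fun m => ∫⁻ x, Φ m x) atTop := lintegral_liminf_le hΦm
    _ ≤ N ^ r := liminf_le_of_frequently_le' (Eventually.of_forall hΦle).frequently

/-- Duality for matrix weighted spaces, tested on dyadic step functions. -/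
theorem eLpNorm_matAct_le (hd : 0 < d) {𝒟 : Set (Set (Fin d → ℝ))}
    (h𝒟 : IsDyadicLattice 𝒟) {r r' : ℝ} (hr : r.HolderConjugate r')
    {A w : (Fin d → ℝ) → Matrix (Fin n) (Fin n) ℝ}
    (hA : ∀ i j, AEMeasurable (fun x => A x i j) volume)
    (hw : ∀ i j, AEMeasurable (fun x => w x i j) volume) (hAw : ∀ᵐ x, A x * w x = 1)
    (hsymm : ∀ᵐ x, ∀ i j, w x i j = w x j i)
    (hAloc : ∀ Q ∈ cubes d, ∀ M : ℝ≥0,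
      ∫⁻ x in Q, (∑ i, ∑ j, ‖A x i j‖ₑ * M) ^ r' ≠ ∞)
    {F : Fin n → ((Fin d → ℝ) →ₘ[volume] B)} {N : ℝ≥0∞} (hN : N ≠ ∞)
    (hint : ∀ i, ∀ g ∈ stepFunctions 𝒟 (StrongDual ℝ B), Integrable (pairing (F i) g) volume)
    (hbound : ∀ g : Fin n → ((Fin d → ℝ) →ₘ[volume] StrongDual ℝ B),
      (∀ i, g i ∈ stepFunctions 𝒟 (StrongDual ℝ B)) →
      ENNReal.ofReal |∑ i, ∫ x, pairing (F i) (g i) x| ≤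
        N * (∫⁻ x, ‖matAct (A x) fun i => g i x‖ₑ ^ r') ^ (1 / r')) :
    eLpNorm (fun x => matAct (w x) fun i => F i x) (ENNReal.ofReal r) volume ≤ n * N := by
  have hr0 := hr.pos
  let w' : (Fin d → ℝ) → Matrix (Fin n) (Fin n) ℝ := fun x => Matrix.of fun i j => (hw i j).mk _ x
  have hww' : ∀ᵐ x, w x = w' x := by
    filter_upwards [ae_all_iff.2 fun i => ae_all_iff.2 fun j => (hw i j).ae_eq_mk] with x hx
    ext i j
    exact hx i j
  have hcomp : ∀ k, eLpNorm (fun x => ∑ i, w' x i k • F i x) (ENNReal.ofReal r) volume ≤ N := by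
    intro k
    have h1 := lintegral_component_rpow_le hd h𝒟 hr hA (w := w')
      (fun i j => (hw i j).measurable_mk) (by
        filter_upwards [hAw, hww'] with x h1 h2
        rw [← h2, h1]) hAloc hN hint hbound k
    rw [eLpNorm_eq_lintegral_rpow_enorm_toReal (by simpa using hr0) ENNReal.ofReal_ne_top,
      ENNReal.toReal_ofReal hr0.le]
    refine (ENNReal.rpow_le_rpow h1 hr.one_div_nonneg).trans (le_of_eq ?_)
    rw [← ENNReal.rpow_mul, mul_one_div_cancel hr.ne_zero, ENNReal.rpow_one]
  have hm : ∀ k, AEStronglyMeasurable (fun x => ∑ i, w' x i k • F i x) volume := fun k =>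
    Finset.aestronglyMeasurable_fun_sum _ fun i _ =>
      (hw i k).measurable_mk.aestronglyMeasurable.smul (F i).aestronglyMeasurable
  -- The components were estimated along columns of `w`; symmetry turns them into the rows that
  -- occur in the action. Adding up the coordinates by the triangle inequality costs the factor `n`.
  have h1 : (fun x => matAct (w x) fun i => F i x) =ᵐ[volume]
      ∑ k, fun x => PiLp.single 2 k (∑ i, w' x i k • F i x) := by
    filter_upwards [hsymm, hww'] with x h1 h2
    rw [Finset.sum_apply]
    simp only [PiLp.single, matAct, ← WithLp.toLp_sum, Finset.univ_sum_single, ← h2]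
    congr 1
    funext l
    exact Finset.sum_congr rfl fun i _ => by rw [h1 l i]
  rw [eLpNorm_congr_ae h1]
  refine (eLpNorm_sum_le (fun k _ => ?_) (by simpa using hr.lt.le)).trans ?_
  · refine aestronglyMeasurable_toLp
      (v := fun i x => (Pi.single k (∑ i, w' x i k • F i x) : Fin n → B) i) fun i => ?_
    by_cases h : i = k
    · subst h; simpa using hm i
    · simpa [h] using aestronglyMeasurable_const
  calc _ ≤ ∑ _k : Fin n, N := Finset.sum_le_sum fun k _ =>
        le_of_eq_of_le (eLpNorm_congr_norm_ae (Eventually.of_forall fun x =>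
          PiLp.norm_single 2 _ k _)) (hcomp k)
    _ = n * N := by simp

end Bound

end Duality

/-! ### Local integrability of the dual weight -/

section DualWeight

variable {d n : ℕ}

theorem enorm_apply_le_normMulVec (A : Matrix (Fin n) (Fin n) ℝ) (i j : Fin n) :
    ‖A i j‖ₑ ≤ normMulVec A (EuclideanSpace.single j 1) := by
  rw [normMulVec_eq_norm_sq, ← ofReal_norm, Real.norm_eq_abs, ← Real.sqrt_sq_eq_abs]
  refine ENNReal.ofReal_le_ofReal (Real.sqrt_le_sqrt ?_)
  have h1 : ∀ l, ∑ k, A l k * (EuclideanSpace.single j (1 : ℝ) : EuclideanSpace ℝ (Fin n)) k =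
      A l j := fun l => by simp
  simp only [h1]
  exact Finset.single_le_sum (f := fun l => A l j ^ 2) (fun l _ => sq_nonneg _) (Finset.mem_univ i)

/-- The entries of `W^{-1/r}` are bounded by `|W^{-1/t} e_j|^{1/p}`, and `r'/p ≤ t'`, so the local
integrability of `|W^{-1/t} e_j|^{t'}` suffices. It provides the dominating function for the right
side of `bound_of_stepFunctions`. -/
theorem IsMatrixWeight.setLIntegral_entries_ne_top
    {W : (Fin d → ℝ) → Matrix (Fin n) (Fin n) ℝ} (hW : IsMatrixWeight W) {p r r' t : ℝ}
    (hr : r.HolderConjugate r') (hp : 1 ≤ p) (hpr : p < r) (ht : t = r / p)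
    (hA : ApConst W t < ∞) {Q : Set (Fin d → ℝ)} (hQ : Q ∈ cubes d) (M : ℝ≥0) :
    ∫⁻ x in Q, (∑ i, ∑ j, ‖matPow (W x) (-(1 / r)) i j‖ₑ * M) ^ r' ≠ ∞ := by
  have hp0 : 0 < p := one_pos.trans_le hp
  have hr0 := hr.pos
  have hr'0 := hr.symm.pos
  have ht1 : 1 < t := by rw [ht, one_lt_div hp0]; exact hpr
  have hexp : r' * (1 / p) ≤ t.conjExponent := by
    rw [Real.conjExponent, hr.conjugate_eq, ht]
    have h1 : 0 < r - 1 := sub_pos.2 hr.lt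
    have h2 : 0 < r - p := sub_pos.2 hpr
    have h3 : r / p / (r / p - 1) = r / (r - p) := by field_simp
    rw [h3, div_mul_div_comm, mul_one]
    exact div_le_div_of_nonneg_left hr0.le h2 (by nlinarith)
  have hentry : ∀ i j, ∫⁻ x in Q, ‖matPow (W x) (-(1 / r)) i j‖ₑ ^ r' ≠ ∞ := by
    intro i j
    refine setLIntegral_ne_top_of_avg hQ ?_
    have := isProbabilityMeasure_avgMeasure hQ
    set e : EuclideanSpace ℝ (Fin n) := EuclideanSpace.single j 1
    have he : ‖e‖ = 1 := by simp [e]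
    have h1 : ∀ᵐ x ∂avgMeasure Q, ‖matPow (W x) (-(1 / r)) i j‖ₑ ^ r' ≤
        1 + normMulVec (matPow (W x) (-(1 / t))) e ^ t.conjExponent := by
      filter_upwards [(avgMeasure_absolutelyContinuous Q).ae_le hW.posDef] with x hx
      set u := normMulVec (matPow (W x) (-(1 / t))) e
      have h2 : ‖matPow (W x) (-(1 / r)) i j‖ₑ ≤ u ^ (1 / p) := by
        have h3 : -(1 / r) = -(1 / t) * (1 / p) := by rw [ht]; field_simp
        refine (enorm_apply_le_normMulVec _ i j).trans ?_
        rw [h3]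
        exact normMulVec_matPow_mul_le hx _ (by positivity) ((div_le_one hp0).2 hp) he
      refine (ENNReal.rpow_le_rpow h2 hr'0.le).trans ?_
      rw [← ENNReal.rpow_mul, mul_comm]
      rcases le_total u 1 with hu | hu
      · exact (ENNReal.rpow_le_one hu (by positivity)).trans le_self_add
      · exact (ENNReal.rpow_le_rpow_of_exponent_le hu hexp).trans le_add_self
    refine ne_top_of_le_ne_top ?_ (lintegral_mono_ae h1)
    rw [lintegral_add_left measurable_const, lintegral_one, measure_univ]
    exact ENNReal.add_ne_top.2 ⟨ENNReal.one_ne_top, hW.lintegral_dual_ne_top ht1 hA hQ e⟩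
  have hmem : ∀ i j, MemLp (fun x => matPow (W x) (-(1 / r)) i j) (ENNReal.ofReal r')
      (volume.restrict Q) := fun i j => by
    refine ⟨(hW.aemeasurable_matPow _ i j).aestronglyMeasurable.restrict, ?_⟩
    rw [eLpNorm_lt_top_iff_lintegral_rpow_enorm_lt_top (by simpa using hr'0) ENNReal.ofReal_ne_top,
      ENNReal.toReal_ofReal hr'0.le]
    exact (hentry i j).lt_top
  have hsum : MemLp (fun x => ∑ i, ∑ j, ‖matPow (W x) (-(1 / r)) i j‖ * (M : ℝ))
      (ENNReal.ofReal r') (volume.restrict Q) :=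
    memLp_finsetSum _ fun i _ => memLp_finsetSum _ fun j _ => (hmem i j).norm.mul_const _
  have h2 := lintegral_rpow_enorm_lt_top_of_eLpNorm_lt_top (by simpa using hr'0)
    ENNReal.ofReal_ne_top hsum.2
  rw [ENNReal.toReal_ofReal hr'0.le] at h2
  refine ne_top_of_le_ne_top h2.ne (le_of_eq (lintegral_congr fun x => ?_))
  congr 1
  rw [← ofReal_norm, Real.norm_of_nonneg (by positivity),
    ENNReal.ofReal_sum_of_nonneg fun i _ => by positivity]
  refine Finset.sum_congr rfl fun i _ => ?_
  rw [ENNReal.ofReal_sum_of_nonneg fun i _ => by positivity]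
  refine Finset.sum_congr rfl fun j _ => ?_
  rw [ENNReal.ofReal_mul (norm_nonneg _), ofReal_norm, ENNReal.ofReal_coe_nnreal]

end DualWeight

/-! ### Exponents -/

/-- Everything is expressed through `y = 1/q`, which treats `q = ∞` on the same footing: `1/q' = 1 -
y` and `1/s = 1 - r y`. -/
theorem sparse_exponents {p q q' : ℝ≥0∞} {r : ℝ≥0} [Fact (1 ≤ p)] (hqq' : q.HolderConjugate q')
    (hpr : p < r) (hrq : r < q) {s : ℝ} (hs : s = (q / r).conjExponent.toReal) :
    q' ≠ ∞ ∧ 0 < s ∧ q'.toReal < (r : ℝ).conjExponent ∧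
      1 / q'.toReal = 1 / (r * s) + 1 / (r : ℝ).conjExponent := by
  have hp : 1 ≤ p := Fact.out
  have hr1' : (1 : ℝ≥0∞) < r := hp.trans_lt hpr
  have hr1 : (1 : ℝ) < r := by exact_mod_cast hr1'
  have hr0 : (0 : ℝ) < r := one_pos.trans hr1
  have hc := Real.HolderConjugate.conjExponent hr1
  set y := q⁻¹.toReal with hy
  have hrE0 : (r : ℝ≥0∞) ≠ 0 := (one_pos.trans hr1').ne'
  have hyr : y < (r : ℝ)⁻¹ := by
    have : q⁻¹ < (r : ℝ≥0∞)⁻¹ := ENNReal.inv_lt_inv.2 hrq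
    simpa [hy] using (ENNReal.toReal_lt_toReal (this.trans_le le_top).ne (by simpa using hrE0)).2 this
  have hq'inv : q'.toReal⁻¹ = 1 - y := by
    have h1 := hqq'.inv_add_inv_eq_one
    have h2 := congrArg ENNReal.toReal h1
    rw [ENNReal.toReal_add (by
      intro h; rw [h] at h1; simp at h1) (by intro h; rw [h] at h1; simp at h1)] at h2
    simp only [ENNReal.toReal_inv, ENNReal.toReal_one] at h2 hy
    rw [hy]; linarith
  have hsinv : s⁻¹ = 1 - r * y := by
    have hz : 1 ≤ q / r := by
      rw [ENNReal.le_div_iff_mul_le (Or.inl hrE0) (Or.inl ENNReal.coe_ne_top), one_mul]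
      exact hrq.le
    have h1 := (ENNReal.HolderConjugate.conjExponent hz).inv_add_inv_eq_one
    have h2 := congrArg ENNReal.toReal h1
    rw [ENNReal.toReal_add (by
      intro h; rw [h] at h1; simp at h1) (by intro h; rw [h] at h1; simp at h1)] at h2
    simp only [ENNReal.toReal_inv, ENNReal.toReal_one, ENNReal.toReal_div, ← hs] at h2 hy
    rw [hy]
    simp at h2
    rw [div_eq_mul_inv] at h2
    linarith
  have hry : r * y < 1 := by
    have := mul_lt_mul_of_pos_left hyr hr0
    rwa [mul_inv_cancel₀ hr0.ne'] at this
  have hs0 : 0 < s := inv_pos.1 (by rw [hsinv]; linarith)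
  have hcinv := hc.inv_add_inv_eq_one
  have hkey : 1 / q'.toReal = 1 / (r * s) + 1 / (r : ℝ).conjExponent := by
    simp only [one_div, mul_inv, hq'inv, hsinv]
    have h3 : (r : ℝ)⁻¹ * r = 1 := inv_mul_cancel₀ hr0.ne'
    linear_combination y * h3 - hcinv
  have hlt : 1 / (r : ℝ).conjExponent < 1 / q'.toReal := by
    rw [hkey]
    have : 0 < 1 / (r * s) := by positivity
    linarith
  have hq'0 : 0 < q'.toReal := by
    refine one_div_pos.1 (lt_trans ?_ hlt)
    exact one_div_pos.2 hc.symm.pos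
  exact ⟨fun h => by simp [h] at hq'0, hs0, (one_div_lt_one_div hc.symm.pos hq'0).1 hlt, hkey⟩

end ConvexBody

end

/-! ### Conclusion: the sparse form bound combined with duality. -/

open ConvexBody in
theorem mainTheorem2 (d n : ℕ) (hd : 0 < d) (p q q' : ℝ≥0∞) (r : ℝ≥0)
    [Fact (1 ≤ p)] [Fact (1 ≤ q')] (hqq' : q.HolderConjugate q')
    (hpr : p < r) (hrq : r < q) (γ : ℝ) (hγ : 0 < γ)
    (t s : ℝ) (ht : t = r / p.toReal) (hs : s = (q / r).conjExponent.toReal) :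
    ∃ C₂ : ℝ≥0,
      ∀ (B₁ B₂ : Type*) [NormedAddCommGroup B₁] [NormedSpace ℝ B₁] [CompleteSpace B₁]
        [NormedAddCommGroup B₂] [NormedSpace ℝ B₂] [CompleteSpace B₂]
        (𝒟 : Set (Set (Fin d → ℝ))) (_ : ConvexBody.IsDyadicLattice 𝒟)
        (F : Submodule ℝ ((Fin d → ℝ) →ₘ[volume] B₁))
        (G : Submodule ℝ ((Fin d → ℝ) →ₘ[volume] StrongDual ℝ B₂))
        (_ : ConvexBody.stepFunctions 𝒟 (StrongDual ℝ B₂) ≤ G)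
        (T : F →ₗ[ℝ] ((Fin d → ℝ) →ₘ[volume] B₂)) (C₁ : ℝ≥0)
        (_ : ConvexBody.ConvexBodyDomination 𝒟 n p q' γ C₁ F G T)
        (W : (Fin d → ℝ) → Matrix (Fin n) (Fin n) ℝ) (_ : ConvexBody.IsMatrixWeight W)
        (_ : ConvexBody.ApConst W t < ∞) (_ : ConvexBody.RHConst W t s < ∞)
        (f : Fin n → F) (_ : ConvexBody.MemWeightedLp W r fun i => (f i : _ →ₘ[volume] B₁)),
        ConvexBody.MemWeightedLp W r (fun i => T (f i)) ∧
        ConvexBody.weightedNorm W r (fun i => T (f i)) ≤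
          C₁ * C₂ *
            ConvexBody.ApConst W t ^ (t.conjExponent / r + s / (r : ℝ).conjExponent) *
            ConvexBody.RHConst W t s ^ (1 / r + s / (r : ℝ).conjExponent) *
            ConvexBody.weightedNorm W r (fun i => (f i : _ →ₘ[volume] B₁)) := by
  have hp1 : 1 ≤ p := Fact.out
  have hptop : p ≠ ∞ := (hpr.trans_le le_top).ne
  have hp1' : 1 ≤ p.toReal := by simpa using ENNReal.toReal_mono hptop hp1
  have hr1 : (1 : ℝ) < r := by exact_mod_cast hp1.trans_lt hpr
  have hr0 : (0 : ℝ) < r := one_pos.trans hr1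
  have hpr' : p.toReal < r := by
    simpa using (ENNReal.toReal_lt_toReal hptop ENNReal.coe_ne_top).2 hpr
  have hc := Real.HolderConjugate.conjExponent hr1
  have ht1 : 1 < t := by rw [ht, one_lt_div (by linarith)]; exact hpr'
  have ht' := (Real.HolderConjugate.conjExponent ht1).symm.pos
  obtain ⟨hq'top, hs0, hqr, hqs⟩ := sparse_exponents hqq' hpr hrq hs
  obtain ⟨C, hC⟩ := exists_sparse_form_bound hd n hptop hq'top hc hpr' hqr ht hs0 hqs hγ
  -- `C` is the constant of the sparse form; the factor `n` is the cost of dualizing coordinate by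
  -- coordinate.
  refine ⟨n * C, ?_⟩
  intro B₁ B₂ _ _ _ _ _ _ 𝒟 h𝒟 F G hFG T C₁ hT W hW hA hRH f hf
  have hc' := hc.symm.pos
  set K : ℝ≥0∞ := ApConst W t ^ (t.conjExponent / r + s / (r : ℝ).conjExponent) *
    RHConst W t s ^ (1 / r + s / (r : ℝ).conjExponent) with hK
  have hKtop : K ≠ ∞ := ENNReal.mul_ne_top
    (ENNReal.rpow_ne_top_of_nonneg (by positivity) hA.ne)
    (ENNReal.rpow_ne_top_of_nonneg (by positivity) hRH.ne)
  set wf := weightedNorm W r fun i => (f i : _ →ₘ[volume] B₁) with hwf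
  have hwf' : wf = (∫⁻ x, ‖matAct (matPow (W x) (1 / r)) fun i =>
      (f i : _ →ₘ[volume] B₁) x‖ₑ ^ (r : ℝ)) ^ (1 / (r : ℝ)) := by
    rw [hwf, weightedNorm, eLpNorm_eq_lintegral_rpow_enorm_toReal (by
      simpa using hr0.ne') ENNReal.coe_ne_top]
    rfl
  have hN : C₁ * (C * K * wf) ≠ ∞ := ENNReal.mul_ne_top ENNReal.coe_ne_top
    (ENNReal.mul_ne_top (ENNReal.mul_ne_top ENNReal.coe_ne_top hKtop) hf.2.ne)
  have hnorm : weightedNorm W r (fun i => T (f i)) ≤ n * (C₁ * (C * K * wf)) := by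
    have h1 := eLpNorm_matAct_le hd h𝒟 hc (A := fun x => matPow (W x) (-(1 / r)))
      (w := fun x => matPow (W x) (1 / r)) (hW.aemeasurable_matPow _) (hW.aemeasurable_matPow _)
      (hW.posDef.mono fun x hx => matPow_neg_mul_matPow hx _)
      (hW.posDef.mono fun x hx => matPow_symm hx _)
      (fun Q hQ M => hW.setLIntegral_entries_ne_top hc hp1' hpr' ht hA hQ M)
      (F := fun i => T (f i)) hN (fun i g hg => hT.integrable (f i) ⟨g, hFG hg⟩) fun g hg => by
        obtain ⟨𝒬, h𝒬, hsp, hle⟩ := hT.domination f fun i => ⟨g i, hFG (hg i)⟩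
        refine hle.trans ?_
        rw [mul_assoc (C₁ : ℝ≥0∞), mul_assoc (C * K), hwf']
        exact mul_le_mul' le_rfl (hC h𝒟 hW hA hRH h𝒬 hsp _ _)
    rw [ENNReal.ofReal_coe_nnreal] at h1
    exact h1
  refine ⟨⟨hW.aestronglyMeasurable_matAct _ fun i => (T (f i)).aestronglyMeasurable,
    hnorm.trans_lt (ENNReal.mul_ne_top (ENNReal.natCast_ne_top n) hN).lt_top⟩,
    hnorm.trans (le_of_eq ?_)⟩
  rw [hK]
  push_cast
  ring
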